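/- All graphs are finite and simple. The signless Laplacian matrix of a graph $G$ is $|\mathrm L(G)| = \mathrm D(G)+\mathrm A(G)$, where $\mathrm D(G)$ is the diagonal matrix of vertex degrees and $\mathrm A(G)$ is the adjacency matrix. The signless Laplacian spectrum of $G$ is the multiset of eigenvalues of $|\mathrm L(G)|$. A graph $G$ is determined by its signless Laplacian spectrum if every graph with the same signless Laplacian spectrum as $G$ is isomorphic to $G$. A graph is sun-like if it is connected and deleting all its degree-1 vertices yields a cycle $C$. A vertex of $C$ with exactly $i\ge 1$ leaves attached to it (equivalently, of degree $i+2$) is called an $i$-hub, and a hub is an $i$-hub for some $i\ge 1$. For integers $k\ge 1$ and $\ell\ge\max(12k,15)$, a graph $G$ is $(\ell,k)$-nice if it is sun-like, its unique cycle $C$ has length $\ell$, it has exactly $k+1$ hubs, one of which is a 1-hub and the other $k$ of which are 2-hubs, and for some orientation of $C$ the following holds: walking around $C$ in the direction of the orientation, starting at the 1-hub, one meets the first 2-hub after distance $4$, and, for each $1\le i<k$, the $(i+1)$-st 2-hub at distance $4$ or $6$ after the $i$-th. Lemma. Let $k\ge 1$ and $\ell\ge\max(12k,15)$ be integers with $\ell\equiv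 2\pmod 4$, and let $G$ be an $(\ell,k)$-nice graph. Then $G$ is determined by its signless Laplacian spectrum. -/

import Mathlib

universe u v

namespace SunGraph

/-- The signless Laplacian matrix `D(G) + A(G)` of a finite simple graph, over the reals. -/
def signlessLaplacian {V : Type*} [Fintype V] [DecidableEq V] (G : SimpleGraph V)
    [DecidableRel G.Adj] : Matrix V V ℝ :=
  G.degMatrix ℝ + G.adjMatrix ℝ

/-- The signless Laplacian spectrum: the multiset of eigenvalues of `D(G) + A(G)`, counted with
multiplicity (the matrix is real symmetric, so all its eigenvalues are real). -/
noncomputable def signlessSpectrum {V : Type*} [Fintype V] [DecidableEq V] (G : SimpleGraph V)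
    [DecidableRel G.Adj] : Multiset ℝ :=
  (signlessLaplacian G).charpoly.roots

/-- `G` is determined by its signless Laplacian spectrum: every finite simple graph with the same
signless Laplacian spectrum as `G` is isomorphic to `G`. -/
def IsDeterminedBySignlessSpectrum {V : Type u} [Fintype V] [DecidableEq V]
    (G : SimpleGraph V) [DecidableRel G.Adj] : Prop :=
  ∀ (W : Type v) [Fintype W] [DecidableEq W] (H : SimpleGraph W) [DecidableRel H.Adj],
    signlessSpectrum H = signlessSpectrum G → Nonempty (H ≃g G)

/-- The graph that remains after all degree-1 vertices of `G` are deleted. -/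
abbrev core {V : Type*} [Fintype V] (G : SimpleGraph V) [DecidableRel G.Adj] :
    SimpleGraph {v : V | G.degree v ≠ 1} :=
  G.induce {v : V | G.degree v ≠ 1}

/-- `G` is sun-like with cycle length `ℓ`: it is connected, and deleting all degree-1 vertices
yields a cycle of length `ℓ`. -/
def IsSunLike {V : Type*} [Fintype V] (G : SimpleGraph V) [DecidableRel G.Adj] (ℓ : ℕ) : Prop :=
  G.Connected ∧ 3 ≤ ℓ ∧ Nonempty (SimpleGraph.cycleGraph ℓ ≃g core G)

/-- In a sun-like graph, an `i`-hub (`i ≥ 1`) is a vertex of the cycle with exactly `i` leaves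
attached, equivalently a vertex of degree `i + 2`. -/
def IsHub {V : Type*} [Fintype V] (G : SimpleGraph V) [DecidableRel G.Adj] (i : ℕ) (v : V) : Prop :=
  1 ≤ i ∧ G.degree v = i + 2

/-- `(ℓ, k)`-nice graphs. The isomorphism `e` labels the cycle by `0, 1, …, ℓ - 1` in clockwise
order, starting at the 1-hub (so it also fixes the orientation), and `p i` is the distance that one
walks clockwise from the 1-hub to the `i`-th 2-hub, `1 ≤ i ≤ k`. The first 2-hub is met after
distance 4, every later one at distance 4 or 6 after the previous one, and there are no hubs other
than these. -/
structure IsNice {V : Type*} [Fintype V] (G : SimpleGraph V) [DecidableRel G.Adj]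
    (ℓ k : ℕ) : Prop where
  one_le_k : 1 ≤ k
  le_length : max (12 * k) 15 ≤ ℓ
  sunLike : IsSunLike G ℓ
  hubs : ∃ (e : SimpleGraph.cycleGraph ℓ ≃g core G) (p : ℕ → ℕ),
    p 1 = 4 ∧
    (∀ i, 1 ≤ i → i < k → p (i + 1) = p i + 4 ∨ p (i + 1) = p i + 6) ∧
    (∀ j : Fin ℓ, IsHub G 1 (e j) ↔ (j : ℕ) = 0) ∧
    (∀ j : Fin ℓ, IsHub G 2 (e j) ↔ ∃ i, 1 ≤ i ∧ i ≤ k ∧ (j : ℕ) = p i) ∧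
    (∀ (v : V) (i : ℕ), IsHub G i v → i = 1 ∨ i = 2)

end SunGraph

set_option linter.unusedSectionVars false

/-! ### The spectrum, the integer characteristic polynomial, moments and eigenvalue bounds. -/

namespace SunGraph
open Polynomial Matrix

/-! Let `H` have the spectrum of the nice graph `G`. The proof recovers the local structure of `H`,
then the positions of its hubs.

Connectedness. The signless Laplacian of any nonempty graph has determinant divisible by 4, so the
characteristic polynomial of a disconnected graph has linear coefficient divisible by 4. For `G`
this coefficient is, up to sign, nℓ with n = ℓ + 2k + 1 odd and ℓ ≡ 2 mod 4. Hence `H` is connected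
(`connected_of_not_four_dvd_coeff_one`, `HubLabel.not_four_dvd`), and it is bipartite because 0 is
an eigenvalue (`exists_signColoring`).

Local structure. All eigenvalues of `G` are below 6, whereas a vertex of degree d ≥ 1 forces an
eigenvalue at least d + 1; so degrees in `H` are at most 4. Then one compares the moments of the
signless Laplacian minus 2, whose diagonal weight d - 2 vanishes at vertices of degree 2. Moments up
to 3 give the number of vertices of each degree. The fourth excludes 4-cycles and fixes the number
of edges between given degrees (`counts_of_trace_eq`). The sixth yields a sum of squares that is at
most 0, so every hub of degree d in `H` carries exactly d - 2 leaves (`leafCount_eq_of_trace_eq`).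
Deleting the leaves of `H` therefore leaves a connected 2-regular graph, a cycle of length ℓ, with
one 1-hub and k 2-hubs.

Hub positions. After elimination of the leaves and the substitution x = s + 1/s + 2, the inverse of
the cycle part is explicit, with entries proportional to s^d + s^(ℓ-d) at distance d. The
characteristic polynomial thus determines a determinant in these entries, weighted by the numbers of
leaves (`det_hubMatrix_eq`). Modulo 4 the 2-hubs enter it linearly, each interacting only with the
1-hub, so the parity of the number of 2-hubs at a given distance from the 1-hub can be read off
(`two_mul_count_eq`). As these distances are distinct in `G`, the 2-hubs of `H` sit at the positions
± `p i`. Over the integers the second-order term of the determinant compares distances between pairs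
of 2-hubs: consecutive ones, at distance 4 or 6, are visible in degree 8 or 12, while pairs on
opposite sides of the 1-hub appear only in degree 13 or later. So all 2-hubs of `H` lie on one side
(`side_eq`), and `H` is `G` up to reflection. -/

/-- The signless Laplacian with integer entries. -/
def intLaplacian {V : Type*} [Fintype V] [DecidableEq V] (G : SimpleGraph V)
    [DecidableRel G.Adj] : Matrix V V ℤ :=
  G.degMatrix ℤ + G.adjMatrix ℤ

section
variable {V W : Type*} [Fintype V] [DecidableEq V] [Fintype W] [DecidableEq W]
  {G : SimpleGraph V} [DecidableRel G.Adj] {H : SimpleGraph W} [DecidableRel H.Adj]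

theorem signlessLaplacian_eq_map (G : SimpleGraph V) [DecidableRel G.Adj] :
    signlessLaplacian G = (intLaplacian G).map (Int.castRingHom ℝ) := by
  ext i j
  simp [signlessLaplacian, intLaplacian, SimpleGraph.degMatrix, SimpleGraph.adjMatrix_apply,
    diagonal_apply]

theorem isHermitian_signlessLaplacian (G : SimpleGraph V) [DecidableRel G.Adj] :
    (signlessLaplacian G).IsHermitian :=
  (G.isHermitian_degMatrix (R := ℝ)).add (G.isHermitian_adjMatrix (R := ℝ))

theorem charpoly_signlessLaplacian (G : SimpleGraph V) [DecidableRel G.Adj] :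
    (signlessLaplacian G).charpoly = ((signlessSpectrum G).map fun a => X - C a).prod :=
  (isHermitian_signlessLaplacian G).splits_charpoly.eq_prod_roots_of_monic (charpoly_monic _)

theorem charpoly_eq_of_signlessSpectrum_eq (h : signlessSpectrum H = signlessSpectrum G) :
    (signlessLaplacian H).charpoly = (signlessLaplacian G).charpoly := by
  rw [charpoly_signlessLaplacian, charpoly_signlessLaplacian, h]

theorem intCharpoly_eq (h : signlessSpectrum H = signlessSpectrum G) :
    (intLaplacian H).charpoly = (intLaplacian G).charpoly := by
  have := charpoly_eq_of_signlessSpectrum_eq h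
  rw [signlessLaplacian_eq_map, signlessLaplacian_eq_map, charpoly_map, charpoly_map] at this
  exact Polynomial.map_injective _ Int.cast_injective this

theorem card_eq_of_signlessSpectrum_eq (h : signlessSpectrum H = signlessSpectrum G) :
    Fintype.card W = Fintype.card V := by
  have := congrArg natDegree (intCharpoly_eq h)
  simpa using this

theorem trace_sub_pow_eq {A : Matrix V V ℝ} (hA : A.IsHermitian) (c : ℝ) (j : ℕ) :
    ((A - c • (1 : Matrix V V ℝ)) ^ j).trace
      = (A.charpoly.roots.map fun a => (a - c) ^ j).sum := by
  set U : Matrix V V ℝ := ↑hA.eigenvectorUnitary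
  have h1 : star U * U = 1 := Unitary.coe_star_mul_self _
  have h2 : U * star U = 1 := Unitary.coe_mul_star_self _
  have h3 : A - c • (1 : Matrix V V ℝ)
      = U * (diagonal fun i => hA.eigenvalues i - c) * star U := by
    have : (diagonal fun i => hA.eigenvalues i - c)
        = diagonal (RCLike.ofReal ∘ hA.eigenvalues) - c • (1 : Matrix V V ℝ) := by
      ext i j
      by_cases hij : i = j <;> simp [one_apply, hij]
    rw [this, mul_sub, sub_mul]
    congr 1
    · conv_lhs => rw [hA.spectral_theorem, Unitary.conjStarAlgAut_apply]
    · simp [h2]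
  have h4 : (A - c • (1 : Matrix V V ℝ)) ^ j
      = U * (diagonal fun i => hA.eigenvalues i - c) ^ j * star U := by
    rw [h3]
    induction j with
    | zero => simp [h2]
    | succ j ih =>
      rw [pow_succ, ih, pow_succ]
      simp only [mul_assoc]
      rw [← mul_assoc (star U) U, h1, one_mul]
  rw [h4, trace_mul_comm, ← mul_assoc, h1, one_mul, diagonal_pow, trace_diagonal,
    hA.roots_charpoly_eq_eigenvalues]
  simp [Multiset.map_map]

theorem trace_intLaplacian_sub_pow (G : SimpleGraph V) [DecidableRel G.Adj] (c : ℤ) (j : ℕ) :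
    ((((intLaplacian G - c • (1 : Matrix V V ℤ)) ^ j).trace : ℤ) : ℝ)
      = ((signlessSpectrum G).map fun a : ℝ => (a - (c : ℝ)) ^ j).sum := by
  rw [signlessSpectrum, ← trace_sub_pow_eq (isHermitian_signlessLaplacian G),
    signlessLaplacian_eq_map]
  have : (intLaplacian G).map (Int.castRingHom ℝ) - (c : ℝ) • (1 : Matrix V V ℝ)
      = (Int.castRingHom ℝ).mapMatrix (intLaplacian G - c • (1 : Matrix V V ℤ)) := by
    ext a b
    by_cases hab : a = b <;>
      simp [one_apply, hab, -zsmul_eq_mul, -zsmul_one]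
  rw [this, ← map_pow]
  simp [trace]

/-- Used with `c = 2`, where the diagonal becomes d - 2 and degree-2 vertices drop out of many sums.
-/
theorem trace_intLaplacian_sub_pow_eq (h : signlessSpectrum H = signlessSpectrum G)
    (c : ℤ) (j : ℕ) :
    ((intLaplacian H - c • (1 : Matrix W W ℤ)) ^ j).trace
      = ((intLaplacian G - c • (1 : Matrix V V ℤ)) ^ j).trace := by
  have := trace_intLaplacian_sub_pow H c j
  rw [h, ← trace_intLaplacian_sub_pow G c j] at this
  exact_mod_cast this

theorem dotProduct_mulVec_lt_of_roots_lt {A : Matrix V V ℝ} {c : ℝ}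
    (hA : A.IsHermitian) (h : ∀ r ∈ A.charpoly.roots, r < c) :
    ∀ x : V → ℝ, x ≠ 0 → x ⬝ᵥ (A *ᵥ x) < c * (x ⬝ᵥ x) := by
  intro x hx
  have hB : (c • (1 : Matrix V V ℝ) - A).PosDef := by
    have h3 : c • (1 : Matrix V V ℝ) - A
        = (hA.eigenvectorUnitary : Matrix V V ℝ) * (diagonal fun i => c - hA.eigenvalues i)
          * star (hA.eigenvectorUnitary : Matrix V V ℝ) := by
      have : (diagonal fun i => c - hA.eigenvalues i)
          = c • (1 : Matrix V V ℝ) - diagonal (RCLike.ofReal ∘ hA.eigenvalues) := by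
        ext i j
        by_cases hij : i = j <;> simp [one_apply, hij]
      rw [this, mul_sub, sub_mul]
      congr 1
      · simp
      · conv_lhs => rw [hA.spectral_theorem, Unitary.conjStarAlgAut_apply]
    rw [h3, IsUnit.posDef_star_right_conjugate_iff Unitary.isUnit_coe]
    rw [posDef_diagonal_iff]
    intro i
    rw [sub_pos]
    apply h
    rw [hA.roots_charpoly_eq_eigenvalues]
    simp
  have := hB.re_dotProduct_pos hx
  simp [sub_mulVec, dotProduct_sub, smul_mulVec] at this
  linarith

/-- A positive vector `x` with `A x < c x` bounds all the eigenvalues of a nonnegative matrix. -/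
theorem roots_lt_of_positive_vector {A : Matrix V V ℝ} {c : ℝ} (hA : ∀ i j, 0 ≤ A i j)
    (x : V → ℝ) (hx : ∀ i, 0 < x i) (hAx : ∀ i, (A *ᵥ x) i < c * x i) :
    ∀ r ∈ A.charpoly.roots, r < c := by
  intro r hr
  have hr' : A.charpoly.IsRoot r := (mem_roots'.mp hr).2
  have hdet : (scalar V r - A).det = 0 := by
    rw [← eval_charpoly]; exact hr'
  obtain ⟨v, hv0, hv⟩ := exists_mulVec_eq_zero_iff.mpr hdet
  have hv' : A *ᵥ v = r • v := by
    rw [sub_mulVec] at hv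
    have h1 : scalar V r *ᵥ v = r • v := by
      ext i; simp [scalar_apply, mulVec_diagonal]
    rw [h1] at hv
    exact (sub_eq_zero.mp hv).symm
  obtain ⟨j, hj⟩ := Function.ne_iff.mp hv0
  -- The eigenvector is measured in the sup norm weighted by `x`; its eigenvalue equation is used
  -- only at an index where that norm is attained.
  obtain ⟨i, -, hi⟩ := Finset.exists_max_image Finset.univ (fun i => |v i| / x i) ⟨j, Finset.mem_univ j⟩
  have hpos : 0 < |v i| / x i :=
    lt_of_lt_of_le (div_pos (abs_pos.mpr hj) (hx j)) (hi j (Finset.mem_univ j))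
  set t := |v i| / x i with ht
  have hvi : |v i| = t * x i := by rw [ht]; field_simp [(hx i).ne']
  have hle : ∀ l, |v l| ≤ t * x l := fun l => by
    have := hi l (Finset.mem_univ l)
    exact (div_le_iff₀ (hx l)).mp this
  have h2 : r * |v i| ≤ t * (A *ᵥ x) i := by
    calc r * |v i| ≤ |r * v i| := by
          rw [abs_mul]; exact mul_le_mul_of_nonneg_right (le_abs_self r) (abs_nonneg _)
      _ = |(A *ᵥ v) i| := by rw [hv']; simp
      _ ≤ ∑ l, |A i l * v l| := by
          rw [mulVec, dotProduct]; exact Finset.abs_sum_le_sum_abs _ _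
      _ ≤ ∑ l, t * (A i l * x l) := by
          refine Finset.sum_le_sum fun l _ => ?_
          rw [abs_mul, abs_of_nonneg (hA i l)]
          nlinarith [mul_le_mul_of_nonneg_left (hle l) (hA i l)]
      _ = t * (A *ᵥ x) i := by rw [mulVec, dotProduct, Finset.mul_sum]
  by_contra! hc
  have h3 := hAx i
  have h4 : 0 < |v i| := by rw [hvi]; exact mul_pos hpos (hx i)
  have h5 : t * (A *ᵥ x) i < t * (c * x i) := mul_lt_mul_of_pos_left h3 hpos
  have h6 : c * |v i| ≤ r * |v i| := mul_le_mul_of_nonneg_right hc h4.le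
  rw [hvi] at h6 h2
  nlinarith

end
end SunGraph

/-! ### Divisibility by 4, connectedness and bipartiteness. -/

namespace SunGraph
open Polynomial Matrix

section
variable {V : Type*} [Fintype V] [DecidableEq V] {G : SimpleGraph V} [DecidableRel G.Adj]

theorem intLaplacian_apply (G : SimpleGraph V) [DecidableRel G.Adj] (i j : V) :
    intLaplacian G i j = (if i = j then (G.degree i : ℤ) else 0) + if G.Adj i j then 1 else 0 := by
  simp [intLaplacian, SimpleGraph.degMatrix, SimpleGraph.adjMatrix_apply, diagonal_apply]

theorem isSymm_intLaplacian (G : SimpleGraph V) [DecidableRel G.Adj] :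
    (intLaplacian G).IsSymm :=
  (G.isSymm_degMatrix (R := ℤ)).add (G.isSymm_adjMatrix (α := ℤ))

theorem sum_intLaplacian_row (G : SimpleGraph V) [DecidableRel G.Adj] (i : V) :
    ∑ j, intLaplacian G i j = 2 * G.degree i := by
  simp only [intLaplacian_apply, Finset.sum_add_distrib]
  simp only [Finset.sum_ite_eq, Finset.mem_univ, if_true, Finset.sum_boole]
  rw [← SimpleGraph.card_neighborFinset_eq_degree, SimpleGraph.neighborFinset_eq_filter]
  ring

theorem sum_intLaplacian_col (G : SimpleGraph V) [DecidableRel G.Adj] (j : V) :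
    ∑ i, intLaplacian G i j = 2 * G.degree j := by
  rw [← sum_intLaplacian_row]
  exact Finset.sum_congr rfl fun i _ => (isSymm_intLaplacian G).apply j i

/-- The determinant of the signless Laplacian is divisible by 4. -/
theorem four_dvd_det_intLaplacian [Nonempty V] (G : SimpleGraph V) [DecidableRel G.Adj] :
    (4 : ℤ) ∣ (intLaplacian G).det := by
  obtain ⟨v⟩ := ‹Nonempty V›
  set L := intLaplacian G with hL
  set d : V → ℤ := fun i => G.degree i
  -- The rows sum to twice the degree vector, so putting their sum in row `v` splits off a factor 2.
  have h1 : L.det = 2 * (L.updateRow v d).det := by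
    have := det_updateRow_sum L v (fun _ => 1)
    rw [one_smul] at this
    have key : (∑ k, (1 : ℤ) • L k) = (2 : ℤ) • d := by
      ext j
      rw [hL]
      refine (Finset.sum_apply _ _ _).trans ?_
      simp [sum_intLaplacian_col, d]
    exact this.symm.trans ((congrArg (fun r => (L.updateRow v r).det) key).trans
      (det_updateRow_smul L v 2 d))
  set M := L.updateRow v d with hM
  have hm : ∑ j, d j = 2 * (G.edgeFinset.card : ℤ) := by
    have := G.sum_degrees_eq_twice_card_edges
    simp only [d]
    exact_mod_cast this
  -- The columns are now summed: row `v` of `M` sums to twice the number of edges and every other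
  -- row to twice a degree, which gives the second factor 2.
  set c : V → ℤ := fun i => if i = v then G.edgeFinset.card else d i
  have h2 : M.det = 2 * (M.updateCol v c).det := by
    have := det_updateCol_sum M v (fun _ => 1)
    rw [one_smul] at this
    have key : (fun k => ∑ i, (1 : ℤ) • M k i) = (2 : ℤ) • c := by
      ext i
      by_cases hi : i = v
      · subst hi
        simp [hM, hm, c]
      · simp [hM, hi, c, hL, sum_intLaplacian_row, d]
    exact this.symm.trans ((congrArg (fun r => (M.updateCol v r).det) key).trans
      (det_updateCol_smul M v 2 c))
  rw [h1, h2]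
  exact ⟨_, by ring⟩

theorem four_dvd_coeff_zero [Nonempty V] (G : SimpleGraph V) [DecidableRel G.Adj] :
    (4 : ℤ) ∣ (intLaplacian G).charpoly.coeff 0 := by
  have h := four_dvd_det_intLaplacian G
  rw [det_eq_sign_charpoly_coeff] at h
  exact (Int.isUnit_iff.mpr (neg_one_pow_eq_or ℤ _)).dvd_mul_left.mp h

theorem intLaplacian_induce_apply (S : Set V) [DecidablePred (· ∈ S)]
    (hS : ∀ u v, u ∈ S → G.Adj u v → v ∈ S) (i j : S) :
    intLaplacian (G.induce S) i j = intLaplacian G i j := by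
  have hdeg : (G.induce S).degree i = G.degree i := by
    rw [← SimpleGraph.card_neighborFinset_eq_degree, ← SimpleGraph.card_neighborFinset_eq_degree]
    refine Finset.card_bij (fun a _ => (a : V)) ?_ ?_ ?_
    · intro a ha
      simpa using ha
    · intro a _ b _ h
      exact Subtype.ext h
    · intro b hb
      rw [SimpleGraph.mem_neighborFinset] at hb
      exact ⟨⟨b, hS i b i.2 hb⟩, by simpa using hb, rfl⟩
  rw [intLaplacian_apply, intLaplacian_apply, hdeg]
  simp [Subtype.ext_iff]

theorem charpoly_intLaplacian_eq_mul (S : Set V) [DecidablePred (· ∈ S)]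
    (hS : ∀ u v, G.Adj u v → (u ∈ S ↔ v ∈ S)) :
    (intLaplacian G).charpoly = (intLaplacian (G.induce S)).charpoly
      * (intLaplacian (G.induce (Sᶜ : Set V))).charpoly := by
  let e : V ≃ S ⊕ (Sᶜ : Set V) := (Equiv.Set.sumCompl S).symm
  rw [← charpoly_reindex e, ← charpoly_fromBlocks_zero₁₂ (M₂₁ := 0)]
  congr 1
  ext (i | i) (j | j)
  · simp only [reindex_apply, submatrix_apply, fromBlocks_apply₁₁]
    rw [intLaplacian_induce_apply S fun u v hu huv => (hS u v huv).mp hu]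
    simp [e]
  · have h1 : (i : V) ≠ j := fun h => j.2 (h ▸ i.2)
    have h2 : ¬ G.Adj i j := fun h => j.2 ((hS i j h).mp i.2)
    simp [e, intLaplacian_apply, h1, h2]
  · have h1 : (i : V) ≠ j := fun h => i.2 (h ▸ j.2)
    have h2 : ¬ G.Adj i j := fun h => i.2 ((hS i j h).mpr j.2)
    simp [e, intLaplacian_apply, h1, h2]
  · simp only [reindex_apply, submatrix_apply, fromBlocks_apply₂₂]
    rw [intLaplacian_induce_apply Sᶜ fun u v hu huv hv => hu ((hS u v huv).mpr hv)]
    simp [e]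

/-- For a disconnected graph the polynomial is a product fg over two nonempty unions of components.
In f₀g₁ + f₁g₀ both constant terms are divisible by 4. -/
theorem connected_of_not_four_dvd_coeff_one [Nonempty V]
    (h : ¬ (4 : ℤ) ∣ (intLaplacian G).charpoly.coeff 1) : G.Connected := by
  classical
  by_contra hG
  apply h
  obtain ⟨v, w, hvw⟩ : ∃ v w, ¬ G.Reachable v w := by
    by_contra! hc
    exact hG ⟨hc⟩
  let S : Set V := {x | G.Reachable v x}
  rw [charpoly_intLaplacian_eq_mul S fun a b hab =>
    ⟨fun h => h.trans hab.reachable, fun h => h.trans hab.symm.reachable⟩, mul_coeff_one]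
  have : Nonempty S := ⟨⟨v, SimpleGraph.Reachable.refl v⟩⟩
  have : Nonempty (Sᶜ : Set V) := ⟨⟨w, hvw⟩⟩
  exact dvd_add ((four_dvd_coeff_zero _).mul_right _) ((four_dvd_coeff_zero _).mul_left _)

/-- `σ` is a proper 2-colouring of `G` with colours `1` and `-1`. -/
def IsSignColoring (G : SimpleGraph V) (σ : V → ℤ) : Prop :=
  (∀ v, σ v * σ v = 1) ∧ ∀ u v, G.Adj u v → σ u = - σ v

/-- The factor 2 appears because each edge is counted in both directions on the right. -/
theorem two_mul_dotProduct_intLaplacian {R : Type*} [CommRing R] (x : V → R) :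
    2 * (x ⬝ᵥ ((G.degMatrix R + G.adjMatrix R) *ᵥ x))
      = ∑ u, ∑ v, if G.Adj u v then (x u + x v) ^ 2 else 0 := by
  have h1 : ∀ u, ∑ v, (if G.Adj u v then (x u + x v) ^ 2 else 0)
      = G.degree u * x u ^ 2 + 2 * (x u * ∑ v ∈ G.neighborFinset u, x v)
        + ∑ v, if G.Adj u v then x v ^ 2 else 0 := by
    intro u
    rw [← Finset.sum_filter, ← Finset.sum_filter, ← SimpleGraph.neighborFinset_eq_filter]
    simp only [add_sq, Finset.sum_add_distrib, Finset.sum_const, nsmul_eq_mul,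
      SimpleGraph.card_neighborFinset_eq_degree, mul_assoc, Finset.mul_sum]
  have h2 : ∑ u, ∑ v, (if G.Adj u v then x v ^ 2 else 0) = ∑ u, (G.degree u : R) * x u ^ 2 := by
    rw [Finset.sum_comm]
    refine Finset.sum_congr rfl fun v _ => ?_
    simp only [G.adj_comm _ v]
    rw [← Finset.sum_filter, ← SimpleGraph.neighborFinset_eq_filter]
    simp
  have h3 : ∀ u, x u * ((G.degMatrix R + G.adjMatrix R) *ᵥ x) u
      = G.degree u * x u ^ 2 + x u * ∑ v ∈ G.neighborFinset u, x v := by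
    intro u
    rw [add_mulVec, Pi.add_apply, SimpleGraph.degMatrix_mulVec_apply,
      SimpleGraph.adjMatrix_mulVec_apply]
    ring
  simp only [dotProduct, h1, h2, h3, Finset.sum_add_distrib, ← Finset.mul_sum]
  ring

/-- The quadratic form of a kernel vector is a vanishing sum of squares, so its values at adjacent
vertices are opposite. By connectedness it vanishes nowhere, and its signs give the colouring. -/
theorem exists_signColoring (hG : G.Connected) (h0 : (intLaplacian G).det = 0) :
    ∃ σ : V → ℤ, IsSignColoring G σ := by
  obtain ⟨x, hx0, hx⟩ := exists_mulVec_eq_zero_iff.mpr h0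
  have h := two_mul_dotProduct_intLaplacian (G := G) x
  change 2 * (x ⬝ᵥ (intLaplacian G *ᵥ x)) = _ at h
  rw [hx, dotProduct_zero, mul_zero] at h
  have hadj : ∀ u v, G.Adj u v → x u = - x v := by
    intro u v huv
    have hn : ∀ u v, 0 ≤ if G.Adj u v then (x u + x v) ^ 2 else 0 := fun u v => by
      split_ifs <;> positivity
    have h1 := (Finset.sum_eq_zero_iff_of_nonneg
      (fun u _ => Finset.sum_nonneg fun v _ => hn u v)).mp h.symm u (Finset.mem_univ u)
    have h2 := (Finset.sum_eq_zero_iff_of_nonneg (fun v _ => hn u v)).mp h1 v (Finset.mem_univ v)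
    rw [if_pos huv] at h2
    have := pow_eq_zero_iff (two_ne_zero) |>.mp h2
    linarith
  obtain ⟨w, hw⟩ := Function.ne_iff.mp hx0
  have hne : ∀ v, x v ≠ 0 := by
    intro v hv
    obtain ⟨p⟩ := hG.preconnected v w
    have : ∀ {a b : V} (_ : G.Walk a b), x a = 0 → x b = 0 := by
      intro a b p
      induction p with
      | nil => exact id
      | cons hab _ ih =>
        intro ha
        apply ih
        have := hadj _ _ hab
        linarith
    exact hw (this p hv)
  refine ⟨fun v => (x v).sign, fun v => ?_, fun u v huv => ?_⟩
  · rcases lt_or_gt_of_ne (hne v) with h | h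
    · simp [Int.sign_eq_neg_one_of_neg h]
    · simp [Int.sign_eq_one_of_pos h]
  · simp only
    rw [hadj u v huv, Int.sign_neg]

end
end SunGraph

/-! ### Second, third, fourth and sixth moments of a weighted bipartite graph. -/

namespace SunGraph
open Matrix

section Traces
variable {V : Type*} [Fintype V] [DecidableEq V]

theorem trace_mul_self_of_isSymm {N : Matrix V V ℤ} (hN : N.IsSymm) :
    (N * N).trace = ∑ u, ∑ v, N u v ^ 2 := by
  simp only [trace, diag_apply, mul_apply]
  refine Finset.sum_congr rfl fun u _ => Finset.sum_congr rfl fun v _ => ?_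
  rw [hN.apply u v, sq]

/-- The row sums of a matrix. -/
def rowSum (A : Matrix V V ℤ) (u : V) : ℤ := ∑ v, A u v

/-- Conjugating by a sign colouring changes the sign of the adjacency matrix. -/
theorem trace_pow_neg {A : Matrix V V ℤ} (f σ : V → ℤ) (hσ : ∀ v, σ v * σ v = 1)
    (hA : ∀ u v, σ u * A u v * σ v = - A u v) (j : ℕ) :
    ((diagonal f - A) ^ j).trace = ((diagonal f + A) ^ j).trace := by
  have h1 : diagonal σ * diagonal σ = 1 := by
    rw [diagonal_mul_diagonal, ← diagonal_one]
    congr 1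
    ext v
    exact hσ v
  have h2 : diagonal f - A = diagonal σ * (diagonal f + A) * diagonal σ := by
    ext u v
    rw [mul_diagonal, diagonal_mul, Matrix.sub_apply, Matrix.add_apply, mul_add, add_mul, hA]
    by_cases h : u = v
    · subst h
      rw [diagonal_apply_eq]
      linear_combination (-f u) * hσ u
    · rw [diagonal_apply_ne _ h]
      ring
  have h3 : (diagonal f - A) ^ j = diagonal σ * (diagonal f + A) ^ j * diagonal σ := by
    rw [h2]
    induction j with
    | zero => simp [h1]
    | succ j ih =>
      rw [pow_succ, ih, pow_succ]
      simp only [mul_assoc]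
      rw [← mul_assoc (diagonal σ) (diagonal σ), h1, one_mul]
  rw [h3, trace_mul_comm, ← mul_assoc, h1, one_mul]

/-- `E` and `O` will be the parts of a power of `diagonal f + A` that are even and odd in `A`; the
hypothesis makes the cross terms traceless. -/
theorem trace_sq_add {E O : Matrix V V ℤ}
    (h : ((E - O) * (E - O)).trace = ((E + O) * (E + O)).trace) :
    ((E + O) * (E + O)).trace = (E * E).trace + (O * O).trace := by
  have h1 : (E - O) * (E - O) + (E + O) * (E + O) = 2 • (E * E + O * O) := by noncomm_ring
  have h2 := congrArg trace h1
  rw [trace_add, h, trace_smul, trace_add] at h2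
  simp only [nsmul_eq_mul, Nat.cast_ofNat] at h2
  linarith

variable {A : Matrix V V ℤ} (f : V → ℤ)

/-- Replacing `A` by `-A` does not change the trace, so only the terms even in `A` survive. -/
theorem trace_pow_three {σ : V → ℤ} (hσ : ∀ v, σ v * σ v = 1)
    (hA : ∀ u v, σ u * A u v * σ v = - A u v) (hs : A.IsSymm) (h01 : ∀ u v, A u v ^ 2 = A u v) :
    ((diagonal f + A) ^ 3).trace = ∑ u, (f u ^ 3 + 3 * (f u * rowSum A u)) := by
  have h1 : (diagonal f + A) ^ 3 + (diagonal f - A) ^ 3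
      = 2 • (diagonal f * diagonal f * diagonal f + (diagonal f * (A * A)
        + A * diagonal f * A + A * A * diagonal f)) := by noncomm_ring
  have h2 := congrArg trace h1
  rw [trace_add, trace_pow_neg f σ hσ hA, trace_smul] at h2
  simp only [nsmul_eq_mul, Nat.cast_ofNat, trace_add] at h2
  rw [trace_mul_comm (A * A), mul_assoc A (diagonal f), trace_mul_comm A (diagonal f * A),
    mul_assoc (diagonal f) A A] at h2
  have h3 : (diagonal f * (A * A)).trace = ∑ u, f u * rowSum A u := by
    simp only [trace, diag_apply, diagonal_mul]
    refine Finset.sum_congr rfl fun u _ => ?_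
    rw [mul_apply, rowSum]
    congr 1
    refine Finset.sum_congr rfl fun v _ => ?_
    rw [← hs.apply v u, ← sq, h01]
  have h4 : (diagonal f * diagonal f * diagonal f).trace = ∑ u, f u ^ 3 := by
    simp only [diagonal_mul_diagonal, trace_diagonal]
    exact Finset.sum_congr rfl fun u _ => by ring
  rw [h3, h4] at h2
  rw [Finset.sum_add_distrib, ← Finset.mul_sum]
  linarith

theorem trace_pow_two (hs : A.IsSymm) (h01 : ∀ u v, A u v ^ 2 = A u v) (h0 : ∀ u, A u u = 0) :
    ((diagonal f + A) ^ 2).trace = ∑ u, (f u ^ 2 + rowSum A u) := by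
  rw [sq, trace_mul_self_of_isSymm ((isSymm_diagonal f).add hs)]
  refine Finset.sum_congr rfl fun u _ => ?_
  have : ∀ v, (diagonal f + A) u v ^ 2 = (if u = v then f u ^ 2 else 0) + A u v := by
    intro v
    by_cases h : u = v
    · subst h; simp [h0]
    · simp [h, h01]
  simp only [this, Finset.sum_add_distrib, Finset.sum_ite_eq, Finset.mem_univ, if_true, rowSum]

theorem sq_apply_self (hs : A.IsSymm) (h01 : ∀ u v, A u v ^ 2 = A u v) (u : V) :
    (A * A) u u = rowSum A u := by
  rw [mul_apply, rowSum]
  refine Finset.sum_congr rfl fun v _ => ?_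
  rw [← hs.apply v u, ← sq, h01]

theorem sum_sq_apply (hs : A.IsSymm) :
    ∑ u, ∑ v, (A * A) u v = ∑ w, rowSum A w ^ 2 := by
  simp only [mul_apply]
  have : ∀ u, ∑ v, ∑ w, A u w * A w v = ∑ w, A u w * rowSum A w := by
    intro u
    rw [Finset.sum_comm]
    exact Finset.sum_congr rfl fun w _ => by rw [rowSum, Finset.mul_sum]
  simp only [this]
  rw [Finset.sum_comm]
  refine Finset.sum_congr rfl fun w _ => ?_
  rw [← Finset.sum_mul, sq]
  congr 1
  exact Finset.sum_congr rfl fun v _ => hs.apply _ _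

/-- The number of ordered pairs of distinct common neighbours, counted over all ordered pairs of
distinct vertices. -/
def codegreeExcess (A : Matrix V V ℤ) : ℤ :=
  ∑ u, ∑ v, if u = v then 0 else (A * A) u v * ((A * A) u v - 1)

/-- The square of the second power is split into parts even and odd in `A`, both symmetric, so the
trace is the sum of their squared entries. An off-diagonal entry c of `A * A` gives c² = c + c(c -
1): the first summand depends on degrees only, the second detects 4-cycles. -/
theorem trace_pow_four {σ : V → ℤ} (hσ : ∀ v, σ v * σ v = 1)
    (hA : ∀ u v, σ u * A u v * σ v = - A u v) (hs : A.IsSymm) (h01 : ∀ u v, A u v ^ 2 = A u v) :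
    ((diagonal f + A) ^ 4).trace = ∑ u, ((f u ^ 2 + rowSum A u) ^ 2 - rowSum A u)
      + ∑ w, rowSum A w ^ 2 + ∑ u, ∑ v, A u v * (f u + f v) ^ 2 + codegreeExcess A := by
  set E := diagonal f * diagonal f + A * A with hE
  set O := diagonal f * A + A * diagonal f with hO
  have hEO : (diagonal f + A) ^ 4 = (E + O) * (E + O) := by rw [hE, hO]; noncomm_ring
  have hEO' : (diagonal f - A) ^ 4 = (E - O) * (E - O) := by rw [hE, hO]; noncomm_ring
  have h := trace_pow_neg f σ hσ hA 4
  rw [hEO, hEO'] at h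
  have hsE : E.IsSymm := by
    rw [IsSymm, hE]; simp [transpose_mul, hs.eq]
  have hsO : O.IsSymm := by
    rw [IsSymm, hO]; simp [transpose_mul, hs.eq, add_comm]
  rw [hEO, trace_sq_add h, trace_mul_self_of_isSymm hsE, trace_mul_self_of_isSymm hsO]
  have h1 : ∀ u v, E u v ^ 2 = (if u = v then (f u ^ 2 + rowSum A u) ^ 2 - rowSum A u else 0)
      + (A * A) u v + if u = v then 0 else (A * A) u v * ((A * A) u v - 1) := by
    intro u v
    rw [hE, diagonal_mul_diagonal, Matrix.add_apply]
    by_cases h : u = v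
    · subst h
      simp [sq_apply_self hs h01]
      ring
    · simp [h]
      ring
  have h2 : ∀ u v, O u v ^ 2 = A u v * (f u + f v) ^ 2 := by
    intro u v
    rw [hO, Matrix.add_apply, diagonal_mul, mul_diagonal]
    linear_combination (f u + f v) ^ 2 * h01 u v
  simp only [h1, h2, Finset.sum_add_distrib, Finset.sum_ite_eq, Finset.mem_univ, if_true]
  rw [sum_sq_apply hs, codegreeExcess]
  ring

/-- At most one coefficient is nonzero. This removes cross terms when distinct vertices have at most
one common neighbour. -/
theorem sq_sum_of_sum_le_one {a c : V → ℤ} (ha : ∀ w, a w = 0 ∨ a w = 1) (h1 : ∑ w, a w ≤ 1) :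
    (∑ w, a w * c w) ^ 2 = ∑ w, a w * c w ^ 2 := by
  by_cases h : ∃ w, a w = 1
  · obtain ⟨w, hw⟩ := h
    have hz : ∀ x, x ≠ w → a x = 0 := by
      intro x hx
      rcases ha x with h | h
      · exact h
      · have h2 : a w + a x ≤ ∑ w, a w := by
          rw [← Finset.sum_pair hx.symm]
          refine Finset.sum_le_sum_of_subset_of_nonneg (Finset.subset_univ _) fun i _ _ => ?_
          rcases ha i with h | h <;> omega
        omega
    rw [Finset.sum_eq_single w (fun x _ hx => by rw [hz x hx, zero_mul]) (by simp),
      Finset.sum_eq_single w (fun x _ hx => by rw [hz x hx, zero_mul]) (by simp), hw]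
    ring
  · push Not at h
    have : ∀ x, a x = 0 := fun x => (ha x).resolve_right (h x)
    simp [this]

theorem evenPart_apply (u v : V) :
    (diagonal f * diagonal f * diagonal f + (diagonal f * (A * A)
        + A * diagonal f * A + A * A * diagonal f)) u v
      = (if u = v then f u ^ 3 else 0) + ∑ w, A u w * A w v * (f u + f v + f w) := by
  have h1 : (diagonal f * diagonal f * diagonal f) u v = if u = v then f u ^ 3 else 0 := by
    rw [diagonal_mul_diagonal, diagonal_mul_diagonal, diagonal_apply]
    congr 1
    ring
  rw [Matrix.add_apply, h1, Matrix.add_apply, Matrix.add_apply, diagonal_mul, mul_diagonal, mul_apply, mul_apply,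
    Finset.mul_sum, Finset.sum_mul, ← Finset.sum_add_distrib, ← Finset.sum_add_distrib]
  congr 1
  refine Finset.sum_congr rfl fun w _ => ?_
  rw [mul_diagonal]
  ring

theorem mul_apply_zero_or_one (h01 : ∀ u v, A u v = 0 ∨ A u v = 1) (u v w : V) :
    A u w * A w v = 0 ∨ A u w * A w v = 1 := by
  rcases h01 u w with h | h <;> rcases h01 w v with h' | h' <;> simp [h, h']

/-- Everything is determined by degrees and edges except the squares of `g`. One copy of `g u ^ 2`
comes from the diagonal entry at `u`, and two from the paths of length 2 centred at `u`, whose end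
weights multiply. -/
theorem sum_evenPart_sq (hs : A.IsSymm) (h01 : ∀ u v, A u v = 0 ∨ A u v = 1)
    (hB : ∀ u v, u ≠ v → (A * A) u v ≤ 1) (g : V → ℤ) (hg : ∀ u, g u = ∑ w, A u w * f w) :
    ∑ u, ∑ v, ((if u = v then f u ^ 3 else 0) + ∑ w, A u w * A w v * (f u + f v + f w)) ^ 2
      = 3 * ∑ u, g u ^ 2
        + ∑ u, ((f u ^ 3 + 2 * f u * rowSum A u) ^ 2 + rowSum A u ^ 2 * f u ^ 2)
        + ∑ u, ∑ w, A u w * (2 * (f u ^ 3 + 2 * f u * rowSum A u) * f w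
            + 2 * rowSum A u * f w ^ 2 + 4 * rowSum A u * f u * f w - (2 * f u + f w) ^ 2) := by
  have hsq : ∀ u v, A u v ^ 2 = A u v := fun u v => by rcases h01 u v with h | h <;> simp [h]
  have hdiag : ∀ (u : V) (c : V → ℤ), ∑ w, A u w * A w u * c w = ∑ w, A u w * c w := fun u c =>
    Finset.sum_congr rfl fun w _ => by rw [hs.apply u w, ← sq, hsq]
  have hself : ∀ u, ∑ w, A u w * A w u * (f u + f u + f w) = 2 * f u * rowSum A u + g u := by
    intro u
    rw [hdiag, hg, rowSum, Finset.mul_sum, ← Finset.sum_add_distrib]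
    exact Finset.sum_congr rfl fun w _ => by ring
  have h1 : ∀ u v, ((if u = v then f u ^ 3 else 0)
      + ∑ w, A u w * A w v * (f u + f v + f w)) ^ 2
      = (if u = v then (f u ^ 3 + 2 * f u * rowSum A u + g u) ^ 2
          - ∑ w, A u w * (2 * f u + f w) ^ 2 else 0)
        + ∑ w, A u w * A w v * (f u + f v + f w) ^ 2 := by
    intro u v
    by_cases h : u = v
    · subst h
      rw [if_pos rfl, if_pos rfl, hself, hdiag]
      simp only [two_mul]
      ring
    · rw [if_neg h, if_neg h, zero_add, zero_add]
      apply sq_sum_of_sum_le_one (mul_apply_zero_or_one h01 u v)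
      rw [← mul_apply]
      exact hB u v h
  simp only [h1, Finset.sum_add_distrib, Finset.sum_ite_eq, Finset.mem_univ, if_true]
  have h2 : ∑ u, ∑ v, ∑ w, A u w * A w v * (f u + f v + f w) ^ 2
      = ∑ w, (2 * rowSum A w * ∑ u, A w u * f u ^ 2 + 2 * g w ^ 2 + rowSum A w ^ 2 * f w ^ 2
        + 4 * rowSum A w * f w * g w) := by
    have : ∀ u, ∑ v, ∑ w, A u w * A w v * (f u + f v + f w) ^ 2
        = ∑ w, ∑ v, A u w * A w v * (f u + f v + f w) ^ 2 := fun u => Finset.sum_comm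
    simp only [this]
    rw [Finset.sum_comm]
    refine Finset.sum_congr rfl fun w _ => ?_
    have h3 : ∀ u, ∑ v, A u w * A w v * (f u + f v + f w) ^ 2
        = A w u * (f u + f w) ^ 2 * rowSum A w + A w u * (f u + f w) * (2 * g w)
          + A w u * ∑ v, A w v * f v ^ 2 := by
      intro u
      rw [hg, rowSum, hs.apply w u, Finset.mul_sum, Finset.mul_sum, Finset.mul_sum,
        Finset.mul_sum, ← Finset.sum_add_distrib, ← Finset.sum_add_distrib]
      exact Finset.sum_congr rfl fun v _ => by ring
    simp only [h3, Finset.sum_add_distrib, ← Finset.sum_mul]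
    have h4 : ∑ u, A w u * (f u + f w) = g w + f w * rowSum A w := by
      rw [hg, rowSum, Finset.mul_sum, ← Finset.sum_add_distrib]
      exact Finset.sum_congr rfl fun v _ => by ring
    have h5 : ∑ u, A w u * (f u + f w) ^ 2
        = ∑ u, A w u * f u ^ 2 + 2 * f w * g w + f w ^ 2 * rowSum A w := by
      rw [hg, rowSum, Finset.mul_sum, Finset.mul_sum, ← Finset.sum_add_distrib,
        ← Finset.sum_add_distrib]
      exact Finset.sum_congr rfl fun v _ => by ring
    rw [h4, h5, ← rowSum]
    ring
  have h6 : ∀ u, ∑ w, A u w * (2 * (f u ^ 3 + 2 * f u * rowSum A u) * f w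
            + 2 * rowSum A u * f w ^ 2 + 4 * rowSum A u * f u * f w - (2 * f u + f w) ^ 2)
      = 2 * (f u ^ 3 + 2 * f u * rowSum A u) * g u + 2 * rowSum A u * ∑ w, A u w * f w ^ 2
        + 4 * rowSum A u * f u * g u - ∑ w, A u w * (2 * f u + f w) ^ 2 := by
    intro u
    rw [hg, Finset.mul_sum, Finset.mul_sum, Finset.mul_sum, ← Finset.sum_add_distrib,
      ← Finset.sum_add_distrib, ← Finset.sum_sub_distrib]
    exact Finset.sum_congr rfl fun v _ => by ring
  simp only [h6]
  rw [h2, Finset.mul_sum]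
  simp only [← Finset.sum_add_distrib]
  refine Finset.sum_congr rfl fun u _ => ?_
  ring

/-- Walks of length 3 are counted by their middle edge. -/
theorem sum_cube_apply (hs : A.IsSymm) :
    ∑ u, ∑ v, (A * A * A) u v = ∑ u, ∑ v, A u v * (rowSum A u * rowSum A v) := by
  have h1 : ∀ u, ∑ v, (A * A * A) u v = ∑ x, (∑ w, A u w * A w x) * rowSum A x := by
    intro u
    simp only [mul_apply]
    rw [Finset.sum_comm]
    exact Finset.sum_congr rfl fun x _ => by rw [rowSum, Finset.mul_sum]
  simp only [h1, Finset.sum_mul]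
  have h2 : ∀ u, ∑ x, ∑ w, A u w * A w x * rowSum A x
      = ∑ w, ∑ x, A u w * A w x * rowSum A x := fun u => Finset.sum_comm
  simp only [h2]
  rw [Finset.sum_comm]
  refine Finset.sum_congr rfl fun w _ => ?_
  rw [Finset.sum_comm]
  refine Finset.sum_congr rfl fun x _ => ?_
  have : rowSum A w = ∑ u, A u w := Finset.sum_congr rfl fun u _ => hs.apply u w
  rw [this, Finset.sum_mul, Finset.mul_sum]
  exact Finset.sum_congr rfl fun u _ => by ring

/-- Without 4-cycles, a walk of length 3 between adjacent vertices must backtrack: it returns to `u`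
after two steps, or it is at `v` after one. The walk u, v, u, v is counted in both cases. -/
theorem cube_apply_of_adj (hs : A.IsSymm) (h01 : ∀ u v, A u v = 0 ∨ A u v = 1)
    (hB : ∀ u v, u ≠ v → (A * A) u v ≤ 1) {u v : V} (h : A u v = 1) :
    (A * A * A) u v = rowSum A u + rowSum A v - 1 := by
  have hsq : ∀ u v, A u v ^ 2 = A u v := fun u v => by rcases h01 u v with h | h <;> simp [h]
  rw [mul_assoc, mul_apply]
  have h1 : ∀ w, A u w * (A * A) w v
      = A u w + if w = v then rowSum A v - 1 else 0 := by
    intro w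
    by_cases hw : w = v
    · subst hw
      rw [if_pos rfl, sq_apply_self hs hsq, h]
      ring
    · rw [if_neg hw, add_zero]
      rcases h01 u w with h2 | h2
      · simp [h2]
      · have h3 : 1 ≤ (A * A) w v := by
          rw [mul_apply]
          have : A w u * A u v ≤ ∑ x, A w x * A x v := by
            refine Finset.single_le_sum (f := fun x => A w x * A x v) (fun x _ => ?_)
              (Finset.mem_univ u)
            rcases mul_apply_zero_or_one h01 w v x with h | h <;> simp [h]
          rw [hs.apply u w, h2, h] at this
          simpa using this
        rw [h2, le_antisymm (hB w v hw) h3]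
        rfl
  simp only [h1, Finset.sum_add_distrib, Finset.sum_ite_eq', Finset.mem_univ, if_true]
  rw [← rowSum]
  ring

/-- The part of the sixth moment that only depends on the degrees and the degrees of the ends of
the edges. -/
def sixthMomentEdgePart (A : Matrix V V ℤ) (f : V → ℤ) : ℤ :=
  ∑ u, ((f u ^ 3 + 2 * f u * rowSum A u) ^ 2 + rowSum A u ^ 2 * f u ^ 2)
  + ∑ u, ∑ w, A u w * (2 * (f u ^ 3 + 2 * f u * rowSum A u) * f w
      + 2 * rowSum A u * f w ^ 2 + 4 * rowSum A u * f u * f w - (2 * f u + f w) ^ 2)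
  + ∑ u, ∑ v, A u v * ((f u ^ 2 + f u * f v + f v ^ 2 + rowSum A u + rowSum A v - 1) ^ 2
      - (rowSum A u + rowSum A v - 1) + rowSum A u * rowSum A v)

/-- The cube is split into even and odd parts as before. The last sum, over nonadjacent pairs with
several walks of length 3 between them, is the contribution not covered by `g`, degrees and edges.
-/
theorem trace_pow_six {σ : V → ℤ} (hσ : ∀ v, σ v * σ v = 1)
    (hA : ∀ u v, σ u * A u v * σ v = - A u v) (hs : A.IsSymm)
    (h01 : ∀ u v, A u v = 0 ∨ A u v = 1)
    (hB : ∀ u v, u ≠ v → (A * A) u v ≤ 1) (g : V → ℤ) (hg : ∀ u, g u = ∑ w, A u w * f w) :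
    ((diagonal f + A) ^ 6).trace = 3 * ∑ u, g u ^ 2 + sixthMomentEdgePart A f
      + ∑ u, ∑ v, (1 - A u v) * ((A * A * A) u v * ((A * A * A) u v - 1)) := by
  set E := diagonal f * diagonal f * diagonal f + (diagonal f * (A * A)
        + A * diagonal f * A + A * A * diagonal f) with hE
  set O := diagonal f * diagonal f * A + diagonal f * A * diagonal f + A * diagonal f * diagonal f
    + A * A * A with hO
  have hEO : (diagonal f + A) ^ 6 = (E + O) * (E + O) := by
    rw [show (diagonal f + A) ^ 6 = (diagonal f + A) ^ 3 * (diagonal f + A) ^ 3 by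
      rw [← pow_add]]
    have : (diagonal f + A) ^ 3 = E + O := by rw [hE, hO]; noncomm_ring
    rw [this]
  have hEO' : (diagonal f - A) ^ 6 = (E - O) * (E - O) := by
    rw [show (diagonal f - A) ^ 6 = (diagonal f - A) ^ 3 * (diagonal f - A) ^ 3 by
      rw [← pow_add]]
    have : (diagonal f - A) ^ 3 = E - O := by rw [hE, hO]; noncomm_ring
    rw [this]
  have h := trace_pow_neg f σ hσ hA 6
  rw [hEO, hEO'] at h
  have hsE : E.IsSymm := by
    rw [IsSymm, hE]; simp only [transpose_add, transpose_mul, hs.eq, diagonal_transpose]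
    noncomm_ring
  have hsO : O.IsSymm := by
    rw [IsSymm, hO]; simp only [transpose_add, transpose_mul, hs.eq, diagonal_transpose]
    noncomm_ring
  rw [hEO, trace_sq_add h, trace_mul_self_of_isSymm hsE, trace_mul_self_of_isSymm hsO]
  have h1 := sum_evenPart_sq f hs h01 hB g hg
  simp only [← evenPart_apply, ← hE] at h1
  have h2 : ∀ u v, O u v ^ 2 = (1 - A u v) * ((A * A * A) u v * ((A * A * A) u v - 1))
      + A u v * ((f u ^ 2 + f u * f v + f v ^ 2 + rowSum A u + rowSum A v - 1) ^ 2
      - (rowSum A u + rowSum A v - 1)) + (A * A * A) u v := by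
    intro u v
    have h3 : O u v = A u v * (f u ^ 2 + f u * f v + f v ^ 2) + (A * A * A) u v := by
      rw [hO]
      simp only [Matrix.add_apply, diagonal_mul, mul_diagonal, diagonal_mul_diagonal, mul_assoc]
      ring
    rw [h3]
    rcases h01 u v with h | h
    · rw [h]; ring
    · rw [h, cube_apply_of_adj hs h01 hB h]; ring
  rw [h1]
  simp only [h2, Finset.sum_add_distrib]
  rw [sum_cube_apply hs, sixthMomentEdgePart]
  simp only [mul_add, Finset.sum_add_distrib]
  ring

theorem cube_apply_nonneg (h01 : ∀ u v, A u v = 0 ∨ A u v = 1) (u v : V) :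
    0 ≤ (A * A * A) u v := by
  have h0 : ∀ u v, 0 ≤ A u v := fun u v => by rcases h01 u v with h | h <;> simp [h]
  have h1 : ∀ u v, 0 ≤ (A * A) u v := fun u v => by
    rw [mul_apply]; exact Finset.sum_nonneg fun w _ => mul_nonneg (h0 _ _) (h0 _ _)
  rw [mul_apply]; exact Finset.sum_nonneg fun w _ => mul_nonneg (h1 _ _) (h0 _ _)

/-- The discarded sum is a sum of terms c(c - 1) with c a natural number. -/
theorem le_trace_pow_six {σ : V → ℤ} (hσ : ∀ v, σ v * σ v = 1)
    (hA : ∀ u v, σ u * A u v * σ v = - A u v) (hs : A.IsSymm)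
    (h01 : ∀ u v, A u v = 0 ∨ A u v = 1)
    (hB : ∀ u v, u ≠ v → (A * A) u v ≤ 1) (g : V → ℤ) (hg : ∀ u, g u = ∑ w, A u w * f w) :
    3 * ∑ u, g u ^ 2 + sixthMomentEdgePart A f ≤ ((diagonal f + A) ^ 6).trace := by
  rw [trace_pow_six f hσ hA hs h01 hB g hg]
  have : 0 ≤ ∑ u, ∑ v, (1 - A u v) * ((A * A * A) u v * ((A * A * A) u v - 1)) := by
    refine Finset.sum_nonneg fun u _ => Finset.sum_nonneg fun v _ => mul_nonneg ?_ ?_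
    · rcases h01 u v with h | h <;> simp [h]
    · have h := cube_apply_nonneg h01 u v
      generalize (A * A * A) u v = x at h
      rcases h.eq_or_lt with rfl | h
      · simp
      · exact mul_nonneg h.le (by omega)
  linarith

theorem codegreeExcess_eq_zero (h01 : ∀ u v, A u v = 0 ∨ A u v = 1)
    (hB : ∀ u v, u ≠ v → (A * A) u v ≤ 1) : codegreeExcess A = 0 := by
  refine Finset.sum_eq_zero fun u _ => Finset.sum_eq_zero fun v _ => ?_
  split_ifs with h
  · rfl
  · have h1 : 0 ≤ (A * A) u v := by
      rw [mul_apply]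
      refine Finset.sum_nonneg fun w _ => ?_
      rcases mul_apply_zero_or_one h01 u v w with h | h <;> simp [h]
    have h2 := hB u v h
    have : (A * A) u v = 0 ∨ (A * A) u v = 1 := by omega
    rcases this with h | h <;> simp [h]

end Traces
end SunGraph

/-! ### Degree and edge statistics, and the contribution of 4-cycles. -/

namespace SunGraph
open Matrix

section Profile
variable {V : Type*} [Fintype V] [DecidableEq V] (G : SimpleGraph V) [DecidableRel G.Adj]

/-- The vertex weight `d - 2`. -/
def excess (v : V) : ℤ := G.degree v - 2

/-- The number of leaves adjacent to a vertex. -/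
def leafCount (v : V) : ℤ := ∑ w, if G.degree w = 1 then G.adjMatrix ℤ v w else 0

/-- The number of vertices of degree `i`. -/
def degCount (i : ℕ) : ℤ := ∑ u, if G.degree u = i then 1 else 0

/-- The number of ordered pairs of adjacent vertices of degrees `i` and `j`. -/
def edgeCount (i j : ℕ) : ℤ :=
  ∑ u, ∑ v, if G.degree u = i ∧ G.degree v = j then G.adjMatrix ℤ u v else 0

theorem adjMatrix_zero_or_one (u v : V) : G.adjMatrix ℤ u v = 0 ∨ G.adjMatrix ℤ u v = 1 := by
  rw [SimpleGraph.adjMatrix_apply]; split_ifs <;> simp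

theorem adjMatrix_sq_apply (u v : V) : G.adjMatrix ℤ u v ^ 2 = G.adjMatrix ℤ u v := by
  rw [SimpleGraph.adjMatrix_apply]; split_ifs <;> simp

theorem adjMatrix_nonneg (u v : V) : 0 ≤ G.adjMatrix ℤ u v := by
  rw [SimpleGraph.adjMatrix_apply]; split_ifs <;> simp

theorem rowSum_adjMatrix (u : V) : rowSum (G.adjMatrix ℤ) u = G.degree u := by
  simp only [rowSum, SimpleGraph.adjMatrix_apply, Finset.sum_boole]
  rw [← SimpleGraph.card_neighborFinset_eq_degree, SimpleGraph.neighborFinset_eq_filter]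

theorem intLaplacian_sub_two :
    intLaplacian G - (2 : ℤ) • (1 : Matrix V V ℤ) = diagonal (excess G) + G.adjMatrix ℤ := by
  ext i j
  rw [Matrix.sub_apply, Matrix.add_apply, intLaplacian_apply, SimpleGraph.adjMatrix_apply,
    Matrix.smul_apply, one_apply, diagonal_apply, excess]
  split_ifs <;> simp
  ring

theorem signColoring_conj {σ : V → ℤ} (hσ : IsSignColoring G σ) (u v : V) :
    σ u * G.adjMatrix ℤ u v * σ v = - G.adjMatrix ℤ u v := by
  rw [SimpleGraph.adjMatrix_apply]
  split_ifs with h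
  · rw [hσ.2 u v h, mul_one, neg_mul, hσ.1]
  · simp

theorem edgeCount_nonneg (i j : ℕ) : 0 ≤ edgeCount G i j := by
  refine Finset.sum_nonneg fun u _ => Finset.sum_nonneg fun v _ => ?_
  split_ifs
  · exact adjMatrix_nonneg G u v
  · rfl

theorem edgeCount_comm (i j : ℕ) : edgeCount G i j = edgeCount G j i := by
  rw [edgeCount, Finset.sum_comm]
  refine Finset.sum_congr rfl fun u _ => Finset.sum_congr rfl fun v _ => ?_
  rw [(G.isSymm_adjMatrix (α := ℤ)).apply u v]
  simp only [and_comm]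

theorem edgeCount_eq_zero_iff (i j : ℕ) :
    edgeCount G i j = 0 ↔ ∀ u v, G.Adj u v → G.degree u = i → G.degree v ≠ j := by
  have hn : ∀ u v, 0 ≤ if G.degree u = i ∧ G.degree v = j then G.adjMatrix ℤ u v else 0 := by
    intro u v
    split_ifs
    · exact adjMatrix_nonneg G u v
    · rfl
  constructor
  · intro h u v huv hu hv
    have h1 := (Finset.sum_eq_zero_iff_of_nonneg
      (fun u _ => Finset.sum_nonneg fun v _ => hn u v)).mp h u (Finset.mem_univ u)
    have h2 := (Finset.sum_eq_zero_iff_of_nonneg (fun v _ => hn u v)).mp h1 v (Finset.mem_univ v)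
    rw [if_pos ⟨hu, hv⟩] at h2
    simp [huv] at h2
  · intro h
    refine Finset.sum_eq_zero fun u _ => Finset.sum_eq_zero fun v _ => ?_
    split_ifs with h1
    · rw [SimpleGraph.adjMatrix_apply, if_neg fun huv => h u v huv h1.1 h1.2]
    · rfl

theorem edgeCount_leaf (i : ℕ) :
    edgeCount G i 1 = ∑ u, if G.degree u = i then leafCount G u else 0 := by
  refine Finset.sum_congr rfl fun u _ => ?_
  by_cases h : G.degree u = i <;> simp [h, leafCount]

variable (hd : ∀ v, 1 ≤ G.degree v ∧ G.degree v ≤ 4)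
include hd

theorem sum_degree_eq (ψ : ℕ → ℤ) :
    ∑ u, ψ (G.degree u) = degCount G 1 * ψ 1 + degCount G 2 * ψ 2 + degCount G 3 * ψ 3
      + degCount G 4 * ψ 4 := by
  simp only [degCount, Finset.sum_mul, ← Finset.sum_add_distrib]
  refine Finset.sum_congr rfl fun u _ => ?_
  obtain ⟨h1, h2⟩ := hd u
  generalize G.degree u = a at h1 h2
  interval_cases a <;> simp

theorem sum_edge_eq (φ : ℕ → ℕ → ℤ) :
    ∑ u, ∑ v, G.adjMatrix ℤ u v * φ (G.degree u) (G.degree v)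
      = ∑ i ∈ Finset.Icc 1 4, ∑ j ∈ Finset.Icc 1 4, edgeCount G i j * φ i j := by
  have h1 : ∀ u v, G.adjMatrix ℤ u v * φ (G.degree u) (G.degree v)
      = ∑ i ∈ Finset.Icc 1 4, ∑ j ∈ Finset.Icc 1 4,
        (if G.degree u = i ∧ G.degree v = j then G.adjMatrix ℤ u v else 0) * φ i j := by
    intro u v
    rw [Finset.sum_eq_single (G.degree u), Finset.sum_eq_single (G.degree v)]
    · simp
    · intro j _ hj; simp [hj.symm]
    · intro h; exact absurd (Finset.mem_Icc.mpr (hd v)) h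
    · intro i _ hi; simp [hi.symm]
    · intro h; exact absurd (Finset.mem_Icc.mpr (hd u)) h
  simp only [h1, edgeCount, Finset.sum_mul]
  have h2 : ∀ u, ∑ v, ∑ i ∈ Finset.Icc 1 4, ∑ j ∈ Finset.Icc 1 4,
        (if G.degree u = i ∧ G.degree v = j then G.adjMatrix ℤ u v else 0) * φ i j
      = ∑ i ∈ Finset.Icc 1 4, ∑ j ∈ Finset.Icc 1 4, ∑ v,
        (if G.degree u = i ∧ G.degree v = j then G.adjMatrix ℤ u v else 0) * φ i j := by
    intro u
    rw [Finset.sum_comm]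
    exact Finset.sum_congr rfl fun i _ => Finset.sum_comm
  simp only [h2]
  rw [Finset.sum_comm]
  exact Finset.sum_congr rfl fun i _ => Finset.sum_comm

theorem sum_edgeCount (i : ℕ) :
    edgeCount G i 1 + edgeCount G i 2 + edgeCount G i 3 + edgeCount G i 4 = i * degCount G i := by
  simp only [edgeCount, degCount, Finset.mul_sum, ← Finset.sum_add_distrib]
  refine Finset.sum_congr rfl fun u _ => ?_
  by_cases h : G.degree u = i
  · simp only [h, if_true, mul_one, true_and]
    rw [← h, ← rowSum_adjMatrix, rowSum]
    refine Finset.sum_congr rfl fun v _ => ?_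
    obtain ⟨h1, h2⟩ := hd v
    generalize G.degree v = a at h1 h2
    interval_cases a <;> simp
  · simp [h]

end Profile

section Excess
variable {V : Type*} [Fintype V] [DecidableEq V] {A : Matrix V V ℤ}

theorem exists_two_of_two_le_sum {a : V → ℤ} (ha : ∀ w, a w = 0 ∨ a w = 1)
    (h : 2 ≤ ∑ w, a w) : ∃ w x, w ≠ x ∧ a w = 1 ∧ a x = 1 := by
  by_contra! hc
  have : ∑ w, a w ≤ 1 := by
    by_cases h1 : ∃ w, a w = 1
    · obtain ⟨w, hw⟩ := h1
      rw [Finset.sum_eq_single w (fun x _ hx => (ha x).resolve_right (hc w x hx.symm hw)) (by simp),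
        hw]
    · push Not at h1
      rw [Finset.sum_eq_zero fun x _ => (ha x).resolve_right (h1 x)]
      exact zero_le_one
  omega

theorem sq_apply_nonneg (h01 : ∀ u v, A u v = 0 ∨ A u v = 1) (u v : V) : 0 ≤ (A * A) u v := by
  rw [mul_apply]
  refine Finset.sum_nonneg fun w _ => ?_
  rcases mul_apply_zero_or_one h01 u v w with h | h <;> simp [h]

theorem two_le_sum_of_two {a : V → ℤ} (ha : ∀ w, 0 ≤ a w) {w x : V} (hwx : w ≠ x)
    (hw : a w = 1) (hx : a x = 1) : 2 ≤ ∑ y, a y := by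
  have : a w + a x ≤ ∑ y, a y := by
    rw [← Finset.sum_pair hwx]
    exact Finset.sum_le_sum_of_subset_of_nonneg (Finset.subset_univ _) fun i _ _ => ha i
  omega

theorem codegreeExcess_nonneg (h01 : ∀ u v, A u v = 0 ∨ A u v = 1) : 0 ≤ codegreeExcess A := by
  refine Finset.sum_nonneg fun u _ => Finset.sum_nonneg fun v _ => ?_
  split_ifs
  · rfl
  · have := sq_apply_nonneg h01 u v
    generalize (A * A) u v = x at this
    rcases this.eq_or_lt with rfl | h
    · simp
    · exact mul_nonneg h.le (by omega)

/-- Each 4-cycle contributes 8 to the codegree excess. -/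
theorem eight_le_codegreeExcess (hs : A.IsSymm) (h01 : ∀ u v, A u v = 0 ∨ A u v = 1)
    (h0 : ∀ u, A u u = 0) {u v : V} (huv : u ≠ v) (h : 2 ≤ (A * A) u v) :
    8 ≤ codegreeExcess A := by
  obtain ⟨w, x, hwx, hw, hx⟩ := exists_two_of_two_le_sum (mul_apply_zero_or_one h01 u v)
    (by rwa [mul_apply] at h)
  have split : ∀ {a b : V}, A u a * A a b = 1 → A u a = 1 ∧ A a b = 1 := by
    intro a b hab
    rcases h01 u a with h | h <;> rcases h01 a b with h' | h' <;> simp_all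
  obtain ⟨huw, hwv⟩ := split hw
  obtain ⟨hux, hxv⟩ := split hx
  have hne : ∀ {a b : V}, A a b = 1 → a ≠ b := by
    rintro a b hab rfl
    rw [h0] at hab
    exact zero_ne_one hab
  -- The other diagonal of the 4-cycle also has two common neighbours. The four ordered diagonals
  -- contribute at least 2 each.
  have h2 : 2 ≤ (A * A) w x := by
    rw [mul_apply]
    refine two_le_sum_of_two (fun y => ?_) huv ?_ ?_
    · rcases mul_apply_zero_or_one h01 w x y with h | h <;> simp [h]
    · rw [hs.apply u w, huw, hux, one_mul]
    · rw [hwv, hs.apply x v, hxv, one_mul]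
  have hAA : (A * A).IsSymm := by rw [IsSymm, transpose_mul, hs.eq]
  let F : V × V → ℤ := fun p => if p.1 = p.2 then 0 else (A * A) p.1 p.2 * ((A * A) p.1 p.2 - 1)
  have hF : ∀ p, 0 ≤ F p := by
    intro p
    simp only [F]
    split_ifs
    · rfl
    · have := sq_apply_nonneg h01 p.1 p.2
      generalize (A * A) p.1 p.2 = x at this
      rcases this.eq_or_lt with rfl | h
      · simp
      · exact mul_nonneg h.le (by omega)
  have hF2 : ∀ a b, a ≠ b → 2 ≤ (A * A) a b → 2 ≤ F (a, b) := by
    intro a b hab h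
    simp only [F, if_neg hab]
    nlinarith
  have hsum : codegreeExcess A = ∑ p, F p := by
    rw [codegreeExcess, Fintype.sum_prod_type]
  have hle : ∑ p ∈ ({(u, v), (v, u), (w, x), (x, w)} : Finset (V × V)), F p ≤ ∑ p, F p :=
    Finset.sum_le_sum_of_subset_of_nonneg (Finset.subset_univ _) fun i _ _ => hF i
  have n1 := hne huw
  have n2 := hne hux
  have n3 := hne hwv
  have n4 := hne hxv
  rw [Finset.sum_insert (by simp [huv, n1, n2]), Finset.sum_insert (by simp [n3.symm, n4.symm]),
    Finset.sum_insert (by simp [hwx]), Finset.sum_singleton] at hle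
  have e1 := hF2 u v huv h
  have e2 := hF2 v u huv.symm (by rwa [hAA.apply])
  have e3 := hF2 w x hwx h2
  have e4 := hF2 x w hwx.symm (by rwa [hAA.apply])
  omega

end Excess

/-- The local structure of a sun-like graph with one 1-hub, `k` 2-hubs and long distances between
the hubs. -/
structure HasSunProfile {V : Type*} [Fintype V] [DecidableEq V] (G : SimpleGraph V)
    [DecidableRel G.Adj] (k : ℕ) : Prop where
  degree_mem : ∀ v, 1 ≤ G.degree v ∧ G.degree v ≤ 4
  leafCount_eq : ∀ v, G.degree v ≠ 1 → leafCount G v = G.degree v - 2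
  leaf_adj : ∀ u v, G.Adj u v → G.degree u = 1 → G.degree v ≠ 1
  hub_adj : ∀ u v, G.Adj u v → 3 ≤ G.degree u → G.degree v ≤ 2
  hub_unique : ∀ v a b, G.degree v = 2 → G.Adj v a → G.Adj v b → 3 ≤ G.degree a →
    3 ≤ G.degree b → a = b
  codegree_le : ∀ u v, u ≠ v → (G.adjMatrix ℤ * G.adjMatrix ℤ) u v ≤ 1
  cube_le : ∀ u v, ¬ G.Adj u v →
    (G.adjMatrix ℤ * G.adjMatrix ℤ * G.adjMatrix ℤ) u v ≤ 1
  degCount_three : degCount G 3 = 1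
  degCount_four : degCount G 4 = k

/-- The numbers of vertices and edges with prescribed degrees in a sun-like graph. -/
structure HasSunCounts {V : Type*} [Fintype V] [DecidableEq V] (G : SimpleGraph V)
    [DecidableRel G.Adj] (k : ℕ) : Prop where
  degree_mem : ∀ v, 1 ≤ G.degree v ∧ G.degree v ≤ 4
  d1 : degCount G 1 = 2 * k + 1
  d3 : degCount G 3 = 1
  d4 : degCount G 4 = k
  e11 : edgeCount G 1 1 = 0
  e12 : edgeCount G 1 2 = 0
  e13 : edgeCount G 1 3 = 1
  e14 : edgeCount G 1 4 = 2 * k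
  e33 : edgeCount G 3 3 = 0
  e34 : edgeCount G 3 4 = 0
  e44 : edgeCount G 4 4 = 0

/-! ### Comparison of the moments of the two graphs. -/

section Compare
variable {V : Type*} [Fintype V] [DecidableEq V] {G : SimpleGraph V} [DecidableRel G.Adj]
  {W : Type*} [Fintype W] [DecidableEq W] {H : SimpleGraph W} [DecidableRel H.Adj] {k : ℕ}

theorem HasSunProfile.counts (hG : HasSunProfile G k) : HasSunCounts G k := by
  have e11 : edgeCount G 1 1 = 0 := (edgeCount_eq_zero_iff G 1 1).mpr hG.leaf_adj
  have hl : ∀ i, i ≠ 1 → edgeCount G i 1 = ((i : ℤ) - 2) * degCount G i := by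
    intro i hi
    rw [edgeCount_leaf, degCount, Finset.mul_sum]
    refine Finset.sum_congr rfl fun u _ => ?_
    split_ifs with h
    · rw [hG.leafCount_eq u (by omega), h, mul_one]
    · simp
  have e12 : edgeCount G 1 2 = 0 := by rw [edgeCount_comm, hl 2 (by norm_num)]; simp
  have e13 : edgeCount G 1 3 = 1 := by
    rw [edgeCount_comm, hl 3 (by norm_num), hG.degCount_three]; norm_num
  have e14 : edgeCount G 1 4 = 2 * k := by
    rw [edgeCount_comm, hl 4 (by norm_num), hG.degCount_four]; norm_num
  have h1 := sum_edgeCount G hG.degree_mem 1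
  have hub : ∀ i j : ℕ, 3 ≤ i → 3 ≤ j → edgeCount G i j = 0 := fun i j hi hj =>
    (edgeCount_eq_zero_iff G i j).mpr fun u v huv hu hv => by
      have := hG.hub_adj u v huv (by omega)
      omega
  refine ⟨hG.degree_mem, ?_, hG.degCount_three, hG.degCount_four, e11, e12, e13, e14,
    hub _ _ (by norm_num) (by norm_num), hub _ _ (by norm_num) (by norm_num),
    hub _ _ (by norm_num) (by norm_num)⟩
  rw [e11, e12, e13, e14] at h1
  push_cast at h1
  linarith

/-- The counts not listed in `HasSunCounts` all involve degree 2 and follow from the total degree in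
each class. -/
theorem HasSunCounts.edgeCount_eq (hG : HasSunCounts G k) (hH : HasSunCounts H k)
    (h2 : degCount H 2 = degCount G 2) :
    ∀ i ∈ Finset.Icc 1 4, ∀ j ∈ Finset.Icc 1 4, edgeCount H i j = edgeCount G i j := by
  have g2 := sum_edgeCount G hG.degree_mem 2
  have g3 := sum_edgeCount G hG.degree_mem 3
  have g4 := sum_edgeCount G hG.degree_mem 4
  have k2 := sum_edgeCount H hH.degree_mem 2
  have k3 := sum_edgeCount H hH.degree_mem 3
  have k4 := sum_edgeCount H hH.degree_mem 4
  obtain ⟨-, g01, g03, g04, g11, g12, g13, g14, g33, g34, g44⟩ := hG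
  obtain ⟨-, k01, k03, k04, k11, k12, k13, k14, k33, k34, k44⟩ := hH
  have G21 := edgeCount_comm G 2 1
  have G31 := edgeCount_comm G 3 1
  have G41 := edgeCount_comm G 4 1
  have G32 := edgeCount_comm G 3 2
  have G42 := edgeCount_comm G 4 2
  have G43 := edgeCount_comm G 4 3
  have H21 := edgeCount_comm H 2 1
  have H31 := edgeCount_comm H 3 1
  have H41 := edgeCount_comm H 4 1
  have H32 := edgeCount_comm H 3 2
  have H42 := edgeCount_comm H 4 2
  have H43 := edgeCount_comm H 4 3
  push_cast at g2 g3 g4 k2 k3 k4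
  intro i hi j hj
  rw [Finset.mem_Icc] at hi hj
  obtain ⟨hi1, hi2⟩ := hi
  obtain ⟨hj1, hj2⟩ := hj
  interval_cases i <;> interval_cases j <;> omega

theorem sum_edge_congr (hG : HasSunCounts G k) (hH : HasSunCounts H k)
    (h2 : degCount H 2 = degCount G 2) (φ : ℕ → ℕ → ℤ) :
    ∑ u, ∑ v, H.adjMatrix ℤ u v * φ (H.degree u) (H.degree v)
      = ∑ u, ∑ v, G.adjMatrix ℤ u v * φ (G.degree u) (G.degree v) := by
  rw [sum_edge_eq G hG.degree_mem, sum_edge_eq H hH.degree_mem]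
  exact Finset.sum_congr rfl fun i hi => Finset.sum_congr rfl fun j hj => by
    rw [hG.edgeCount_eq hH h2 i hi j hj]

theorem sum_degree_congr (hG : ∀ v, 1 ≤ G.degree v ∧ G.degree v ≤ 4)
    (hH : ∀ v, 1 ≤ H.degree v ∧ H.degree v ≤ 4)
    (h : ∀ i ∈ Finset.Icc 1 4, degCount H i = degCount G i) (ψ : ℕ → ℤ) :
    ∑ u, ψ (H.degree u) = ∑ u, ψ (G.degree u) := by
  rw [sum_degree_eq G hG, sum_degree_eq H hH, h 1 (by simp), h 2 (by simp), h 3 (by simp),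
    h 4 (by simp)]

/-- The moments 0 to 3 are sums over the vertices of polynomials in the degree, of exact degrees 0,
1, 2, 3. On the four values 1, 2, 3, 4 this is an invertible Vandermonde system. -/
theorem degCount_eq_of_trace_eq {σ : V → ℤ} {τ : W → ℤ} (hσ : IsSignColoring G σ)
    (hτ : IsSignColoring H τ) (hG : ∀ v, 1 ≤ G.degree v ∧ G.degree v ≤ 4)
    (hH : ∀ v, 1 ≤ H.degree v ∧ H.degree v ≤ 4)
    (hcard : Fintype.card W = Fintype.card V)
    (htr : ∀ j, ((diagonal (excess H) + H.adjMatrix ℤ) ^ j).trace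
      = ((diagonal (excess G) + G.adjMatrix ℤ) ^ j).trace) :
    ∀ i ∈ Finset.Icc 1 4, degCount H i = degCount G i := by
  have t0 : ∑ _u : W, (1 : ℤ) = ∑ _u : V, (1 : ℤ) := by simp [hcard]
  have t1 := htr 1
  have t2 := htr 2
  have t3 := htr 3
  rw [trace_pow_two _ (G.isSymm_adjMatrix) (adjMatrix_sq_apply G) (by simp),
    trace_pow_two _ (H.isSymm_adjMatrix) (adjMatrix_sq_apply H) (by simp)] at t2
  rw [trace_pow_three _ hσ.1 (signColoring_conj G hσ) (G.isSymm_adjMatrix) (adjMatrix_sq_apply G),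
    trace_pow_three _ hτ.1 (signColoring_conj H hτ) (H.isSymm_adjMatrix)
      (adjMatrix_sq_apply H)] at t3
  simp only [pow_one, trace_add, trace_diagonal, SimpleGraph.trace_adjMatrix, add_zero,
    rowSum_adjMatrix, excess] at t1 t2 t3
  rw [sum_degree_eq G hG (fun _ => 1), sum_degree_eq H hH (fun _ => 1)] at t0
  rw [sum_degree_eq G hG (fun d => (d : ℤ) - 2), sum_degree_eq H hH (fun d => (d : ℤ) - 2)] at t1
  rw [sum_degree_eq G hG (fun d => ((d : ℤ) - 2) ^ 2 + d),
    sum_degree_eq H hH (fun d => ((d : ℤ) - 2) ^ 2 + d)] at t2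
  rw [sum_degree_eq G hG (fun d => ((d : ℤ) - 2) ^ 3 + 3 * (((d : ℤ) - 2) * d)),
    sum_degree_eq H hH (fun d => ((d : ℤ) - 2) ^ 3 + 3 * (((d : ℤ) - 2) * d))] at t3
  norm_num at t0 t1 t2 t3
  intro i hi
  rw [Finset.mem_Icc] at hi
  obtain ⟨hi1, hi2⟩ := hi
  interval_cases i <;> omega

theorem edgeCount_three_three (h3 : degCount G 3 = 1) : edgeCount G 3 3 = 0 := by
  rw [edgeCount_eq_zero_iff]
  intro u v huv hu hv
  have : 2 ≤ degCount G 3 := by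
    refine two_le_sum_of_two (fun y => ?_) huv.ne ?_ ?_
    · split_ifs <;> simp
    · simp [hu]
    · simp [hv]
  omega

theorem codegreeExcess_eq_or (G : SimpleGraph V) [DecidableRel G.Adj] :
    (∀ u v, u ≠ v → (G.adjMatrix ℤ * G.adjMatrix ℤ) u v ≤ 1) ∨
      8 ≤ codegreeExcess (G.adjMatrix ℤ) := by
  by_contra! h
  obtain ⟨⟨u, v, huv, h1⟩, h2⟩ := h
  have := eight_le_codegreeExcess G.isSymm_adjMatrix (adjMatrix_zero_or_one G) (by simp) huv
    (by omega)
  omega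

/-- With e the edge counts of `H` and c its codegree excess, equality of the fourth moments becomes
3e₁₁ + 2e₁₂ + 4e₃₄ + 4e₄₄ + c/2 = 2e₁₄ - 4k. Since e₁₁ + e₁₂ + e₁₃ + e₁₄ = 2k + 1, this yields 5e₁₁
+ 4e₁₂ + 4e₃₄ + 4e₄₄ + c/2 ≤ 2, so all these edge counts vanish. A 4-cycle would give c ≥ 8, so
there is none and c = 0. -/
theorem counts_of_trace_eq {σ : V → ℤ} {τ : W → ℤ} (hσ : IsSignColoring G σ)
    (hτ : IsSignColoring H τ) (hG : HasSunProfile G k)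
    (hH : ∀ v, 1 ≤ H.degree v ∧ H.degree v ≤ 4)
    (hdeg : ∀ i ∈ Finset.Icc 1 4, degCount H i = degCount G i)
    (htr : ((diagonal (excess H) + H.adjMatrix ℤ) ^ 4).trace
      = ((diagonal (excess G) + G.adjMatrix ℤ) ^ 4).trace) :
    HasSunCounts H k ∧ ∀ u v, u ≠ v → (H.adjMatrix ℤ * H.adjMatrix ℤ) u v ≤ 1 := by
  have hGc := hG.counts
  rw [trace_pow_four _ hσ.1 (signColoring_conj G hσ) (G.isSymm_adjMatrix) (adjMatrix_sq_apply G),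
    trace_pow_four _ hτ.1 (signColoring_conj H hτ) (H.isSymm_adjMatrix)
      (adjMatrix_sq_apply H),
    codegreeExcess_eq_zero (adjMatrix_zero_or_one G) hG.codegree_le] at htr
  simp only [rowSum_adjMatrix, excess] at htr
  rw [sum_degree_congr hG.degree_mem hH hdeg (fun d => (((d : ℤ) - 2) ^ 2 + d) ^ 2 - d),
    sum_degree_congr hG.degree_mem hH hdeg (fun d => (d : ℤ) ^ 2),
    sum_edge_eq G hG.degree_mem (fun a b => ((a : ℤ) - 2 + (b - 2)) ^ 2),
    sum_edge_eq H hH (fun a b => ((a : ℤ) - 2 + (b - 2)) ^ 2)] at htr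
  have d1 := hdeg 1 (by simp)
  have d2 := hdeg 2 (by simp)
  have d3 := hdeg 3 (by simp)
  have d4 := hdeg 4 (by simp)
  have k33 := edgeCount_three_three (d3.trans hGc.d3)
  have g2 := sum_edgeCount G hG.degree_mem 2
  have g3 := sum_edgeCount G hG.degree_mem 3
  have g4 := sum_edgeCount G hG.degree_mem 4
  have k1 := sum_edgeCount H hH 1
  have k2 := sum_edgeCount H hH 2
  have k3 := sum_edgeCount H hH 3
  have k4 := sum_edgeCount H hH 4
  have hGc' := hGc
  obtain ⟨-, g01, g03, g04, g11, g12, g13, g14, g33, g34, g44⟩ := hGc'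
  have G21 := edgeCount_comm G 2 1
  have G31 := edgeCount_comm G 3 1
  have G41 := edgeCount_comm G 4 1
  have G32 := edgeCount_comm G 3 2
  have G42 := edgeCount_comm G 4 2
  have G43 := edgeCount_comm G 4 3
  have H21 := edgeCount_comm H 2 1
  have H31 := edgeCount_comm H 3 1
  have H41 := edgeCount_comm H 4 1
  have H32 := edgeCount_comm H 3 2
  have H42 := edgeCount_comm H 4 2
  have H43 := edgeCount_comm H 4 3
  have n11 := edgeCount_nonneg H 1 1
  have n12 := edgeCount_nonneg H 1 2
  have n13 := edgeCount_nonneg H 1 3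
  have n14 := edgeCount_nonneg H 1 4
  have n34 := edgeCount_nonneg H 3 4
  have n44 := edgeCount_nonneg H 4 4
  have nx := codegreeExcess_nonneg (adjMatrix_zero_or_one H)
  have hIcc : Finset.Icc 1 4 = ({1, 2, 3, 4} : Finset ℕ) := rfl
  simp [hIcc] at htr
  push_cast at g2 g3 g4 k1 k2 k3 k4
  have hB : ∀ u v, u ≠ v → (H.adjMatrix ℤ * H.adjMatrix ℤ) u v ≤ 1 :=
    (codegreeExcess_eq_or H).resolve_right fun h8 => by omega
  rw [codegreeExcess_eq_zero (adjMatrix_zero_or_one H) hB] at htr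
  refine ⟨⟨hH, by omega, by omega, by omega, by omega, by omega, by omega, by omega, by omega,
    by omega, by omega⟩, hB⟩

/-- The sum of the excesses of the neighbours. -/
def neighborExcess (G : SimpleGraph V) [DecidableRel G.Adj] (u : V) : ℤ :=
  ∑ w, G.adjMatrix ℤ u w * excess G w

theorem HasSunCounts.neighborExcess_hub (hG : HasSunCounts G k) {w : V} (hw : 3 ≤ G.degree w) :
    neighborExcess G w = - leafCount G w := by
  rw [neighborExcess, leafCount, ← Finset.sum_neg_distrib]
  refine Finset.sum_congr rfl fun u _ => ?_
  by_cases h : G.Adj w u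
  · have h1 := hG.degree_mem w
    have h2 := hG.degree_mem u
    have h33 := (edgeCount_eq_zero_iff G 3 3).mp hG.e33 w u h
    have h34 := (edgeCount_eq_zero_iff G 3 4).mp hG.e34 w u h
    have h43 := (edgeCount_eq_zero_iff G 3 4).mp hG.e34 u w h.symm
    have h44 := (edgeCount_eq_zero_iff G 4 4).mp hG.e44 w u h
    have : G.degree u = 1 ∨ G.degree u = 2 := by omega
    rcases this with h | h <;> simp [excess, h]
  · simp [h]

theorem HasSunCounts.excess_nonneg_of_adj (hG : HasSunCounts G k) {w u : V}
    (hw : ¬ 3 ≤ G.degree w) (h : G.Adj w u) : 0 ≤ excess G u := by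
  have h1 := hG.degree_mem w
  have h2 := hG.degree_mem u
  have h11 := (edgeCount_eq_zero_iff G 1 1).mp hG.e11 w u h
  have h12 := (edgeCount_eq_zero_iff G 1 2).mp hG.e12 u w h.symm
  rw [excess]
  omega

/-- At a vertex that is not a hub all neighbours have nonnegative excess, and a sum of squares of
nonnegative numbers is at most the square of their sum. -/
theorem HasSunCounts.sum_excess_sq_le (hG : HasSunCounts G k) {w : V}
    (hw : ¬ 3 ≤ G.degree w) :
    ∑ u, G.adjMatrix ℤ w u * excess G u ^ 2 ≤ neighborExcess G w ^ 2 := by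
  have h0 : ∀ u, 0 ≤ G.adjMatrix ℤ w u * excess G u := fun u => by
    rw [SimpleGraph.adjMatrix_apply]
    split_ifs with h
    · rw [one_mul]; exact hG.excess_nonneg_of_adj hw h
    · simp
  rw [neighborExcess]
  calc ∑ u, G.adjMatrix ℤ w u * excess G u ^ 2
      = ∑ u, (G.adjMatrix ℤ w u * excess G u) ^ 2 := Finset.sum_congr rfl fun u _ => by
        rw [mul_pow, adjMatrix_sq_apply]
    _ ≤ _ := Finset.sum_sq_le_sq_sum_of_nonneg fun i _ => h0 i

/-- Equality holds in `HasSunCounts.sum_excess_sq_le` because a vertex that is not a hub has at most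
one neighbouring hub. -/
theorem HasSunProfile.neighborExcess_sq (hG : HasSunProfile G k) {w : V}
    (hw : ¬ 3 ≤ G.degree w) :
    neighborExcess G w ^ 2 = ∑ u, G.adjMatrix ℤ w u * excess G u ^ 2 := by
  have hz : ∀ a b, a ≠ b → (G.adjMatrix ℤ w a * excess G a) * (G.adjMatrix ℤ w b * excess G b)
      = 0 := by
    intro a b hab
    by_cases ha : G.Adj w a
    swap
    · simp [ha]
    by_cases hb : G.Adj w b
    swap
    · simp [hb]
    have h1 := hG.counts.excess_nonneg_of_adj hw ha
    have h2 := hG.counts.excess_nonneg_of_adj hw hb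
    have hw1 := hG.degree_mem w
    rcases (show G.degree w = 1 ∨ G.degree w = 2 by omega) with h | h
    · exfalso
      have : 2 ≤ G.degree w := by
        rw [← SimpleGraph.card_neighborFinset_eq_degree, ← Finset.card_pair hab]
        apply Finset.card_le_card
        intro x hx
        rw [Finset.mem_insert, Finset.mem_singleton] at hx
        rw [SimpleGraph.mem_neighborFinset]
        rcases hx with rfl | rfl <;> assumption
      omega
    · by_cases ha3 : 3 ≤ G.degree a
      · by_cases hb3 : 3 ≤ G.degree b
        · exact absurd (hG.hub_unique w a b h ha hb ha3 hb3) hab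
        · have : excess G b = 0 := by rw [excess] at *; omega
          simp [this]
      · have : excess G a = 0 := by rw [excess] at *; omega
        simp [this]
  rw [neighborExcess, sq, Finset.sum_mul_sum]
  refine Finset.sum_congr rfl fun a _ => ?_
  rw [Finset.sum_eq_single a (fun b _ hb => hz a b hb.symm) (by simp)]
  linear_combination excess G a ^ 2 * adjMatrix_sq_apply G w a

theorem HasSunCounts.sum_leafCount (hG : HasSunCounts G k) :
    ∑ w, (if 3 ≤ G.degree w then leafCount G w * (G.degree w - 2) else 0) = 4 * k + 1 := by
  have h3 := hG.e13
  have h4 := hG.e14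
  rw [edgeCount_comm, edgeCount_leaf] at h3 h4
  have : ∑ w, (if 3 ≤ G.degree w then leafCount G w * (G.degree w - 2) else 0)
      = ∑ w, (if G.degree w = 3 then leafCount G w else 0)
        + 2 * ∑ w, (if G.degree w = 4 then leafCount G w else 0) := by
    rw [Finset.mul_sum, ← Finset.sum_add_distrib]
    refine Finset.sum_congr rfl fun w _ => ?_
    obtain ⟨h1, h2⟩ := hG.degree_mem w
    generalize G.degree w = a at h1 h2
    interval_cases a <;> simp
    ring
  rw [this, h3, h4]
  ring

theorem HasSunCounts.sum_hub_sq (hG : HasSunCounts G k) :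
    ∑ w, (if 3 ≤ G.degree w then ((G.degree w : ℤ) - 2) ^ 2 else 0) = (4 * k + 1 : ℤ) := by
  have := sum_degree_eq G hG.degree_mem (fun d => if 3 ≤ d then ((d : ℤ) - 2) ^ 2 else 0)
  rw [this, hG.d3, hG.d4]
  norm_num
  ring

/-- The sixth moment of a sun-like graph detects the numbers of leaves at the hubs. -/
theorem leafCount_eq_of_trace_eq {σ : V → ℤ} {τ : W → ℤ} (hσ : IsSignColoring G σ)
    (hτ : IsSignColoring H τ) (hG : HasSunProfile G k) (hH : HasSunCounts H k)
    (h2 : degCount H 2 = degCount G 2)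
    (hB : ∀ u v, u ≠ v → (H.adjMatrix ℤ * H.adjMatrix ℤ) u v ≤ 1)
    (htr : ((diagonal (excess H) + H.adjMatrix ℤ) ^ 6).trace
      = ((diagonal (excess G) + G.adjMatrix ℤ) ^ 6).trace) :
    ∀ v, H.degree v ≠ 1 → leafCount H v = H.degree v - 2 := by
  have hGc := hG.counts
  have hdeg : ∀ i ∈ Finset.Icc 1 4, degCount H i = degCount G i := by
    intro i hi
    rw [Finset.mem_Icc] at hi
    obtain ⟨hi1, hi2⟩ := hi
    interval_cases i
    · rw [hH.d1, hGc.d1]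
    · exact h2
    · rw [hH.d3, hGc.d3]
    · rw [hH.d4, hGc.d4]
  -- In `G` nonadjacent vertices are joined by at most one walk of length 3, so its sixth moment has
  -- no extra term; that of `H` is only bounded below.
  have hcube : ∑ u, ∑ v, (1 - G.adjMatrix ℤ u v)
      * ((G.adjMatrix ℤ * G.adjMatrix ℤ * G.adjMatrix ℤ) u v
        * ((G.adjMatrix ℤ * G.adjMatrix ℤ * G.adjMatrix ℤ) u v - 1)) = 0 := by
    refine Finset.sum_eq_zero fun u _ => Finset.sum_eq_zero fun v _ => ?_
    by_cases h : G.Adj u v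
    · simp [h]
    · have h1 := hG.cube_le u v h
      have h0 := cube_apply_nonneg (adjMatrix_zero_or_one G) u v
      generalize (G.adjMatrix ℤ * G.adjMatrix ℤ * G.adjMatrix ℤ) u v = x at h0 h1
      rcases (show x = 0 ∨ x = 1 by omega) with rfl | rfl <;> simp
  have hle := le_trace_pow_six (excess H) hτ.1 (signColoring_conj H hτ) H.isSymm_adjMatrix
    (adjMatrix_zero_or_one H) hB (neighborExcess H) (fun _ => rfl)
  rw [htr, trace_pow_six (excess G) hσ.1 (signColoring_conj G hσ) G.isSymm_adjMatrix
    (adjMatrix_zero_or_one G) hG.codegree_le (neighborExcess G) (fun _ => rfl), hcube] at hle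
  have hedge : sixthMomentEdgePart (H.adjMatrix ℤ) (excess H)
      = sixthMomentEdgePart (G.adjMatrix ℤ) (excess G) := by
    simp only [sixthMomentEdgePart, rowSum_adjMatrix, excess]
    rw [sum_degree_congr hGc.degree_mem hH.degree_mem hdeg (fun d =>
        (((d : ℤ) - 2) ^ 3 + 2 * ((d : ℤ) - 2) * d) ^ 2 + (d : ℤ) ^ 2 * ((d : ℤ) - 2) ^ 2),
      sum_edge_congr hGc hH h2 (fun a b =>
        2 * (((a : ℤ) - 2) ^ 3 + 2 * ((a : ℤ) - 2) * a) * ((b : ℤ) - 2)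
          + 2 * (a : ℤ) * ((b : ℤ) - 2) ^ 2 + 4 * (a : ℤ) * ((a : ℤ) - 2) * ((b : ℤ) - 2)
          - (2 * ((a : ℤ) - 2) + ((b : ℤ) - 2)) ^ 2),
      sum_edge_congr hGc hH h2 (fun a b =>
        (((a : ℤ) - 2) ^ 2 + ((a : ℤ) - 2) * ((b : ℤ) - 2) + ((b : ℤ) - 2) ^ 2 + a + b - 1) ^ 2
          - ((a : ℤ) + b - 1) + (a : ℤ) * b)]
  have hsumG : ∑ w, neighborExcess G w ^ 2
      = ∑ w, (if 3 ≤ G.degree w then ((G.degree w : ℤ) - 2) ^ 2 else 0)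
        + ∑ w, ∑ u, G.adjMatrix ℤ w u
          * (if 3 ≤ G.degree w then 0 else ((G.degree u : ℤ) - 2) ^ 2) := by
    rw [← Finset.sum_add_distrib]
    refine Finset.sum_congr rfl fun w _ => ?_
    split_ifs with hw
    · rw [hGc.neighborExcess_hub hw, hG.leafCount_eq w (by omega)]
      simp only [mul_zero, Finset.sum_const_zero]
      ring
    · rw [hG.neighborExcess_sq hw]
      simp [excess]
  have hsumH : ∑ w, (if 3 ≤ H.degree w then leafCount H w ^ 2 else 0)
        + ∑ w, ∑ u, H.adjMatrix ℤ w u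
          * (if 3 ≤ H.degree w then 0 else ((H.degree u : ℤ) - 2) ^ 2)
      ≤ ∑ w, neighborExcess H w ^ 2 := by
    rw [← Finset.sum_add_distrib]
    refine Finset.sum_le_sum fun w _ => ?_
    split_ifs with hw
    · rw [hH.neighborExcess_hub hw]
      simp
    · have := hH.sum_excess_sq_le hw
      simpa [excess] using this
  rw [sum_edge_congr hGc hH h2 (fun a b => if 3 ≤ a then 0 else ((b : ℤ) - 2) ^ 2)] at hsumH
  -- The sixth moment bounds the sum of squared leaf counts at hubs by 4k + 1. The mixed sum and the
  -- sum of (d - 2)² both equal 4k + 1, so the squared differences sum to at most 0.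
  have hsq : ∑ w, (if 3 ≤ H.degree w then (leafCount H w - ((H.degree w : ℤ) - 2)) ^ 2 else 0)
      ≤ 0 := by
    have : ∑ w, (if 3 ≤ H.degree w then (leafCount H w - ((H.degree w : ℤ) - 2)) ^ 2 else 0)
        = ∑ w, (if 3 ≤ H.degree w then leafCount H w ^ 2 else 0)
          - 2 * ∑ w, (if 3 ≤ H.degree w then leafCount H w * (H.degree w - 2) else 0)
          + ∑ w, (if 3 ≤ H.degree w then ((H.degree w : ℤ) - 2) ^ 2 else 0) := by
      rw [Finset.mul_sum, ← Finset.sum_sub_distrib, ← Finset.sum_add_distrib]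
      refine Finset.sum_congr rfl fun w _ => ?_
      split_ifs <;> ring
    rw [this, hH.sum_leafCount, hH.sum_hub_sq]
    rw [hGc.sum_hub_sq] at hsumG
    linarith
  have hnn : ∀ w ∈ Finset.univ,
      0 ≤ if 3 ≤ H.degree w then (leafCount H w - ((H.degree w : ℤ) - 2)) ^ 2 else 0 :=
    fun w _ => by split_ifs <;> positivity
  have hz := (Finset.sum_eq_zero_iff_of_nonneg hnn).mp (le_antisymm hsq (Finset.sum_nonneg hnn))
  intro v hv
  have hv1 := hH.degree_mem v
  by_cases h3 : 3 ≤ H.degree v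
  · have := hz v (Finset.mem_univ v)
    rw [if_pos h3] at this
    have := pow_eq_zero_iff (two_ne_zero) |>.mp this
    linarith
  · have hv2 : H.degree v = 2 := by omega
    rw [hv2, leafCount]
    refine (Finset.sum_eq_zero fun w _ => ?_).trans (by norm_num)
    split_ifs with hw
    · rw [SimpleGraph.adjMatrix_apply,
        if_neg fun hadj => (edgeCount_eq_zero_iff H 1 2).mp hH.e12 w v hadj.symm hw hv2]
    · rfl

end Compare
end SunGraph

/-! ### Cycle graphs and connected 2-regular graphs. -/

namespace SunGraph
open Matrix

section CycleGraph

theorem cycleGraph_adj_iff {n : ℕ} (hn : 3 ≤ n) (i j : Fin n) :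
    (SimpleGraph.cycleGraph n).Adj i j ↔ (j : ℕ) = i + 1 ∨ (i : ℕ) = j + 1
      ∨ ((i : ℕ) = 0 ∧ (j : ℕ) + 1 = n) ∨ ((j : ℕ) = 0 ∧ (i : ℕ) + 1 = n) := by
  rw [SimpleGraph.cycleGraph_adj']
  have h1 := i.2
  have h2 := j.2
  rw [Fin.sub_def, Fin.sub_def]
  simp only
  constructor
  · rintro (h | h)
    · rcases lt_or_ge (n - (j : ℕ) + i) n with h3 | h3
      · rw [Nat.mod_eq_of_lt h3] at h; omega
      · rw [Nat.mod_eq_sub_mod h3, Nat.mod_eq_of_lt (by omega)] at h; omega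
    · rcases lt_or_ge (n - (i : ℕ) + j) n with h3 | h3
      · rw [Nat.mod_eq_of_lt h3] at h; omega
      · rw [Nat.mod_eq_sub_mod h3, Nat.mod_eq_of_lt (by omega)] at h; omega
  · rintro (h | h | h | h)
    · right
      rw [show n - (i : ℕ) + j = 1 + n by omega, Nat.add_mod_right, Nat.mod_eq_of_lt (by omega)]
    · left
      rw [show n - (j : ℕ) + i = 1 + n by omega, Nat.add_mod_right, Nat.mod_eq_of_lt (by omega)]
    · left
      rw [show n - (j : ℕ) + i = 1 by omega, Nat.mod_eq_of_lt (by omega)]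
    · right
      rw [show n - (i : ℕ) + j = 1 by omega, Nat.mod_eq_of_lt (by omega)]

theorem cycleGraph_degree {n : ℕ} (hn : 3 ≤ n) (i : Fin n) :
    (SimpleGraph.cycleGraph n).degree i = 2 := by
  obtain ⟨m, rfl⟩ := Nat.exists_eq_add_of_le' hn
  exact SimpleGraph.cycleGraph_degree_three_le

/-- A finite connected 2-regular graph is a cycle. -/
theorem exists_iso_cycleGraph {U : Type*} [Fintype U] {K : SimpleGraph U} [DecidableRel K.Adj]
    (hK : K.Connected) (hd : ∀ v, K.degree v = 2) :
    Nonempty (SimpleGraph.cycleGraph (Fintype.card U) ≃g K) := by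
  classical
  have hnt : Nontrivial U := by
    obtain ⟨v⟩ := hK.nonempty
    have : 0 < K.degree v := by rw [hd]; norm_num
    obtain ⟨w, hw⟩ := (K.degree_pos_iff_exists_adj v).mp this
    exact ⟨v, w, hw.ne⟩
  -- A nontrivial tree has a vertex of degree 1.
  have hac : ¬ K.IsAcyclic := by
    intro h
    have ht : K.IsTree := ⟨hK, h⟩
    have h1 := ht.minDegree_eq_one_of_nontrivial
    obtain ⟨v, hv⟩ := K.exists_minimal_degree_vertex
    rw [h1, hd] at hv
    norm_num at hv
  rw [SimpleGraph.isAcyclic_iff_free_cycleGraph] at hac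
  push Not at hac
  obtain ⟨n, hn, hfree⟩ := hac
  obtain ⟨φ⟩ := hfree
  have hinj : Function.Injective φ := φ.injective
  -- The two neighbours within the embedded cycle exhaust the degree, so no edge leaves the image;
  -- connectedness then makes `φ` surjective.
  have hadj : ∀ i u, K.Adj (φ i) u → ∃ j, (SimpleGraph.cycleGraph n).Adj i j ∧ φ j = u := by
    intro i u hu
    have hsub : ((SimpleGraph.cycleGraph n).neighborFinset i).image φ ⊆ K.neighborFinset (φ i) := by
      intro x hx
      obtain ⟨j, hj, rfl⟩ := Finset.mem_image.mp hx
      rw [SimpleGraph.mem_neighborFinset] at hj ⊢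
      exact φ.toHom.map_adj hj
    have heq := Finset.eq_of_subset_of_card_le hsub (by
      rw [Finset.card_image_of_injective _ hinj, SimpleGraph.card_neighborFinset_eq_degree,
        SimpleGraph.card_neighborFinset_eq_degree, hd, cycleGraph_degree hn])
    have : u ∈ K.neighborFinset (φ i) := by rwa [SimpleGraph.mem_neighborFinset]
    rw [← heq, Finset.mem_image] at this
    obtain ⟨j, hj, rfl⟩ := this
    exact ⟨j, by rwa [SimpleGraph.mem_neighborFinset] at hj, rfl⟩
  have hsurj : Function.Surjective φ := by
    intro u
    obtain ⟨p⟩ := hK.preconnected (φ ⟨0, by omega⟩) u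
    have : ∀ {a b : U} (_ : K.Walk a b), (∃ i, φ i = a) → ∃ i, φ i = b := by
      intro a b p
      induction p with
      | nil => exact id
      | cons hab _ ih =>
        rintro ⟨i, rfl⟩
        obtain ⟨j, -, hj⟩ := hadj _ _ hab
        exact ih ⟨j, hj⟩
    exact this p ⟨_, rfl⟩
  have hcard : n = Fintype.card U := by
    simpa using Fintype.card_of_bijective (f := φ) ⟨hinj, hsurj⟩
  subst hcard
  refine ⟨⟨Equiv.ofBijective φ ⟨hinj, hsurj⟩, ?_⟩⟩
  intro i j
  constructor
  · intro h
    obtain ⟨l, hl, hlj⟩ := hadj i _ h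
    rwa [← hinj hlj]
  · exact fun h => φ.toHom.map_adj h

end CycleGraph

/-! ### Vertex degrees and the largest eigenvalue. -/

section Bound
variable {V : Type*} [Fintype V] [DecidableEq V] {G : SimpleGraph V} [DecidableRel G.Adj]

theorem signlessLaplacian_mulVec_apply (x : V → ℝ) (v : V) :
    (signlessLaplacian G *ᵥ x) v = G.degree v * x v + ∑ w ∈ G.neighborFinset v, x w := by
  rw [signlessLaplacian, add_mulVec, Pi.add_apply, SimpleGraph.degMatrix_mulVec_apply,
    SimpleGraph.adjMatrix_mulVec_apply]

/-- The largest signless Laplacian eigenvalue is at least the maximum degree plus one. -/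
theorem degree_add_one_lt_of_roots_lt {c : ℝ}
    (h : ∀ r ∈ (signlessLaplacian G).charpoly.roots, r < c) {v : V} (hv : 1 ≤ G.degree v) :
    (G.degree v : ℝ) + 1 < c := by
  -- This is the Perron vector of the star at `v`, whose signless Laplacian has largest eigenvalue d
  -- + 1.
  set x : V → ℝ := fun w => if w = v then G.degree v else if G.Adj v w then 1 else 0 with hx
  have hx0 : ∀ w, 0 ≤ x w := fun w => by
    simp only [hx]; split_ifs <;> positivity
  have hxv : x v = G.degree v := by simp [hx]
  have hxn : ∀ w, G.Adj v w → x w = 1 := fun w hw => by simp [hx, hw.ne', hw]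
  have hpt : ∀ w, ((G.degree v : ℝ) + 1) * x w ≤ (signlessLaplacian G *ᵥ x) w := by
    intro w
    rw [signlessLaplacian_mulVec_apply]
    by_cases hw : w = v
    · subst hw
      have : ∑ u ∈ G.neighborFinset w, x u = G.degree w := by
        rw [Finset.sum_congr rfl fun u hu => hxn u ((G.mem_neighborFinset _ _).mp hu)]
        simp
      rw [this, hxv]
      linarith
    · by_cases ha : G.Adj v w
      · have h1 : x v ≤ ∑ u ∈ G.neighborFinset w, x u :=
          Finset.single_le_sum (f := x) (fun u _ => hx0 u)
            ((G.mem_neighborFinset _ _).mpr ha.symm)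
        have h2 : (1 : ℝ) ≤ G.degree w := by
          exact_mod_cast (G.degree_pos_iff_exists_adj w).mpr ⟨v, ha.symm⟩
        rw [hxn w ha]
        rw [hxv] at h1
        linarith
      · have : x w = 0 := by simp [hx, hw, ha]
        rw [this, mul_zero, mul_zero, zero_add]
        exact Finset.sum_nonneg fun u _ => hx0 u
  have hpos : 0 < x ⬝ᵥ x := by
    have : 0 < x v * x v := by
      rw [hxv]
      have : (0 : ℝ) < G.degree v := by exact_mod_cast hv
      positivity
    exact lt_of_lt_of_le this
      (Finset.single_le_sum (f := fun w => x w * x w) (fun w _ => mul_self_nonneg _)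
        (Finset.mem_univ v))
  have hne : x ≠ 0 := by
    rintro h0
    rw [h0, dotProduct_zero] at hpos
    exact lt_irrefl _ hpos
  have h1 := dotProduct_mulVec_lt_of_roots_lt (isHermitian_signlessLaplacian G) h x hne
  have h2 : ((G.degree v : ℝ) + 1) * (x ⬝ᵥ x) ≤ x ⬝ᵥ (signlessLaplacian G *ᵥ x) := by
    rw [dotProduct, dotProduct, Finset.mul_sum]
    refine Finset.sum_le_sum fun w _ => ?_
    have := mul_le_mul_of_nonneg_left (hpt w) (hx0 w)
    linarith
  exact lt_of_mul_lt_mul_right (h2.trans_lt h1) hpos.le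

theorem HasSunProfile.roots_lt {k : ℕ} (hG : HasSunProfile G k) :
    ∀ r ∈ (signlessLaplacian G).charpoly.roots, r < 6 := by
  -- With these weights the strict inequality for 6 holds at each vertex: a 2-hub gives 4 + 2/4 +
  -- 6/5 = 5.7 < 6, a 1-hub 4.45 < 6, a leaf at most 1.25 < 1.5, a degree-2 vertex at most 3.2 <
  -- 3.6.
  set x : V → ℝ := fun w => if G.degree w = 1 then 1 / 4 else if G.degree w = 2 then 3 / 5 else 1
    with hx
  have hx1 : ∀ w, x w ≤ 1 := fun w => by simp only [hx]; split_ifs <;> norm_num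
  refine roots_lt_of_positive_vector (fun i j => ?_) x (fun w => ?_) (fun v => ?_)
  · rw [signlessLaplacian_eq_map, map_apply, intLaplacian_apply]
    simp only [map_add]
    (split_ifs <;> simp); positivity
  · simp only [hx]; split_ifs <;> norm_num
  · rw [signlessLaplacian_mulVec_apply]
    have hd := hG.degree_mem v
    have hle : ∑ w ∈ G.neighborFinset v, x w ≤ G.degree v := by
      calc ∑ w ∈ G.neighborFinset v, x w ≤ ∑ w ∈ G.neighborFinset v, 1 :=
            Finset.sum_le_sum fun w _ => hx1 w
        _ = G.degree v := by simp
    by_cases h3 : 3 ≤ G.degree v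
    · have hsum : ∑ w ∈ G.neighborFinset v, x w
          = 3 / 5 * G.degree v - 7 / 20 * (leafCount G v : ℝ) := by
        have h1 : (leafCount G v : ℝ)
            = ∑ w ∈ G.neighborFinset v, if G.degree w = 1 then (1 : ℝ) else 0 := by
          rw [leafCount, SimpleGraph.neighborFinset_eq_filter, Finset.sum_filter]
          push_cast
          refine Finset.sum_congr rfl fun w _ => ?_
          rw [SimpleGraph.adjMatrix_apply]
          split_ifs <;> simp
        have h2 : (G.degree v : ℝ) = ∑ w ∈ G.neighborFinset v, 1 := by simp
        rw [h1, h2, Finset.mul_sum, Finset.mul_sum, ← Finset.sum_sub_distrib]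
        refine Finset.sum_congr rfl fun w hw => ?_
        rw [SimpleGraph.mem_neighborFinset] at hw
        have hw2 := hG.hub_adj v w hw h3
        have hw1 := (hG.degree_mem w).1
        rcases (show G.degree w = 1 ∨ G.degree w = 2 by omega) with h | h
        · simp [hx, h]
          norm_num
        · simp [hx, h]
      rw [hsum, hG.leafCount_eq v (by omega)]
      have hxv : x v = 1 := by
        simp only [hx]
        rw [if_neg (by omega), if_neg (by omega)]
      rw [hxv]
      push_cast
      rcases (show G.degree v = 3 ∨ G.degree v = 4 by omega) with h | h <;> rw [h] <;> norm_num
    · rcases (show G.degree v = 1 ∨ G.degree v = 2 by omega) with h | h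
      · rw [h] at hle ⊢
        have hxv : x v = 1 / 4 := by simp [hx, h]
        rw [hxv]
        push_cast at hle ⊢
        linarith
      · rw [h] at hle ⊢
        have hxv : x v = 3 / 5 := by simp [hx, h]
        rw [hxv]
        push_cast at hle ⊢
        linarith

end Bound

/-! ### The core that remains after deletion of the leaves. -/

section Core
variable {V : Type*} [Fintype V] [DecidableEq V] {G : SimpleGraph V} [DecidableRel G.Adj]

theorem core_connected (hG : G.Connected) (hd : ∃ v, G.degree v ≠ 1)
    (hleaf : ∀ u v, G.Adj u v → G.degree u = 1 → G.degree v ≠ 1) : (core G).Connected := by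
  -- A walk is retracted to the core: a core vertex represents itself, and a leaf is represented by
  -- its neighbour.
  let rep : V → {v : V | G.degree v ≠ 1} → Prop := fun u s =>
    (s : V) = u ∨ (G.degree u = 1 ∧ G.Adj u s)
  have huniq : ∀ {u a b : V}, G.degree u = 1 → G.Adj u a → G.Adj u b → a = b := by
    intro u a b hu ha hb
    rw [← SimpleGraph.card_neighborFinset_eq_degree, Finset.card_eq_one] at hu
    obtain ⟨c, hc⟩ := hu
    have h1 : a ∈ G.neighborFinset u := (G.mem_neighborFinset _ _).mpr ha
    have h2 : b ∈ G.neighborFinset u := (G.mem_neighborFinset _ _).mpr hb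
    rw [hc, Finset.mem_singleton] at h1 h2
    rw [h1, h2]
  have hwalk : ∀ {u v : V} (_ : G.Walk u v) (s t), rep u s → rep v t → (core G).Reachable s t := by
    intro u v p
    induction p with
    | nil =>
      rintro s t (hs | ⟨hu, hs⟩) (ht | ⟨hu', ht⟩)
      · rw [Subtype.ext (hs.trans ht.symm)]
      · exact absurd (hs ▸ hu') s.2
      · exact absurd (ht ▸ hu) t.2
      · rw [Subtype.ext (huniq hu hs ht)]
    | @cons u w v huw _ ih =>
      intro s t hs ht
      by_cases hw : G.degree w = 1
      · have hu : G.degree u ≠ 1 := hleaf w u huw.symm hw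
        rcases hs with hs | ⟨hu', -⟩
        · exact ih s t (Or.inr ⟨hw, hs ▸ huw.symm⟩) ht
        · exact absurd hu' hu
      · rcases hs with hs | ⟨hu, hs⟩
        · have : (core G).Adj s ⟨w, hw⟩ := by
            change G.Adj s w
            rw [hs]; exact huw
          exact this.reachable.trans (ih ⟨w, hw⟩ t (Or.inl rfl) ht)
        · exact ih s t (Or.inl (huniq hu hs huw)) ht
  obtain ⟨v, hv⟩ := hd
  have : Nonempty {v : V | G.degree v ≠ 1} := ⟨⟨v, hv⟩⟩
  refine ⟨fun s t => ?_⟩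
  obtain ⟨p⟩ := hG.preconnected s t
  exact hwalk p s t (Or.inl rfl) (Or.inl rfl)

theorem degree_eq_core_degree_add (v : {v : V | G.degree v ≠ 1}) :
    (G.degree v : ℤ) = (core G).degree v + leafCount G v := by
  have h1 : ((core G).degree v : ℤ)
      = ∑ w, if G.degree w ≠ 1 then G.adjMatrix ℤ v w else 0 := by
    rw [← rowSum_adjMatrix, rowSum, ← Finset.sum_filter]
    rw [Finset.sum_subtype (p := fun w => w ∈ {v : V | G.degree v ≠ 1}) _ (by simp)]
    rfl
  rw [h1, leafCount, ← Finset.sum_add_distrib, ← rowSum_adjMatrix, rowSum]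
  refine Finset.sum_congr rfl fun w _ => ?_
  by_cases h : G.degree w = 1 <;> simp [h]

theorem card_core : (Fintype.card {v : V | G.degree v ≠ 1} : ℤ)
    = Fintype.card V - degCount G 1 := by
  have h1 : degCount G 1 = (Finset.univ.filter fun v => G.degree v = 1).card := by
    simp [degCount]
  have h2 : Fintype.card {v : V | G.degree v ≠ 1}
      = (Finset.univ.filter fun v => ¬ G.degree v = 1).card :=
    Fintype.card_of_subtype _ (by simp)
  have h3 := Finset.card_filter_add_card_filter_not (s := (Finset.univ : Finset V))
    (fun v => G.degree v = 1)
  rw [Finset.card_univ] at h3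
  rw [h1, h2]
  omega

theorem exists_iso_core {ℓ : ℕ} (hG : G.Connected) (hd : ∃ v, G.degree v ≠ 1)
    (hleaf : ∀ u v, G.Adj u v → G.degree u = 1 → G.degree v ≠ 1)
    (hl : ∀ v, G.degree v ≠ 1 → leafCount G v = G.degree v - 2)
    (hcard : Fintype.card {v : V | G.degree v ≠ 1} = ℓ) :
    Nonempty (SimpleGraph.cycleGraph ℓ ≃g core G) := by
  subst hcard
  refine exists_iso_cycleGraph (core_connected hG hd hleaf) fun v => ?_
  have h1 := degree_eq_core_degree_add v
  have h2 := hl v v.2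
  omega

end Core
end SunGraph

/-! ### Sun-like graphs with a labelled cycle. -/

namespace SunGraph
open Matrix

section Labelled
variable {V : Type*} [Fintype V] [DecidableEq V] {G : SimpleGraph V} [DecidableRel G.Adj] {ℓ : ℕ}

theorem eq_of_adj_of_degree_eq_one {u a b : V} (hu : G.degree u = 1) (ha : G.Adj u a)
    (hb : G.Adj u b) : a = b := by
  rw [← SimpleGraph.card_neighborFinset_eq_degree, Finset.card_eq_one] at hu
  obtain ⟨c, hc⟩ := hu
  have h1 : a ∈ G.neighborFinset u := (G.mem_neighborFinset _ _).mpr ha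
  have h2 : b ∈ G.neighborFinset u := (G.mem_neighborFinset _ _).mpr hb
  rw [hc, Finset.mem_singleton] at h1 h2
  rw [h1, h2]

/-- Two adjacent leaves would form a whole component, hence the whole connected graph. -/
theorem degree_ne_one_of_adj_leaf (hG : G.Connected) (hd : ∃ v, G.degree v ≠ 1) {u v : V}
    (huv : G.Adj u v) (hu : G.degree u = 1) : G.degree v ≠ 1 := by
  intro hv
  obtain ⟨w, hw⟩ := hd
  obtain ⟨p⟩ := hG.preconnected u w
  have : ∀ {a b : V} (_ : G.Walk a b), (a = u ∨ a = v) → b = u ∨ b = v := by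
    intro a b p
    induction p with
    | nil => exact id
    | cons hab _ ih =>
      rintro (rfl | rfl)
      · exact ih (Or.inr (eq_of_adj_of_degree_eq_one hu hab huv))
      · exact ih (Or.inl (eq_of_adj_of_degree_eq_one hv hab huv.symm))
  rcases this p (Or.inl rfl) with rfl | rfl
  · exact hw hu
  · exact hw hv

theorem leafCount_of_label (hℓ : 3 ≤ ℓ) (e : SimpleGraph.cycleGraph ℓ ≃g core G) (v : V)
    (hv : G.degree v ≠ 1) : leafCount G v = G.degree v - 2 := by
  have h1 := degree_eq_core_degree_add (G := G) ⟨v, hv⟩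
  have h2 : (core G).degree ⟨v, hv⟩ = 2 := by
    obtain ⟨j, hj⟩ := e.surjective ⟨v, hv⟩
    rw [← hj, e.degree_eq, cycleGraph_degree hℓ]
  rw [h2] at h1
  simp only at h1
  push_cast at h1
  linarith

theorem two_le_degree_of_label (hℓ : 3 ≤ ℓ) (e : SimpleGraph.cycleGraph ℓ ≃g core G) (v : V)
    (hv : G.degree v ≠ 1) : 2 ≤ G.degree v := by
  have h1 := leafCount_of_label hℓ e v hv
  have h2 : 0 ≤ leafCount G v := Finset.sum_nonneg fun w _ => by
    split_ifs
    · exact adjMatrix_nonneg G v w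
    · rfl
  omega

theorem adj_label_iff (e : SimpleGraph.cycleGraph ℓ ≃g core G) (i j : Fin ℓ) :
    G.Adj (e i) (e j) ↔ (SimpleGraph.cycleGraph ℓ).Adj i j :=
  e.map_rel_iff (a := i) (b := j)

/-- Every vertex of a labelled sun-like graph has a base point on the cycle. -/
theorem exists_base (hG : G.Connected) (hℓ : 3 ≤ ℓ) (e : SimpleGraph.cycleGraph ℓ ≃g core G) :
    ∃ b : V → Fin ℓ, (∀ v, G.degree v ≠ 1 → (e (b v) : V) = v) ∧
      ∀ v, G.degree v = 1 → ∀ w, G.Adj v w ↔ w = e (b v) := by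
  have hd : ∃ v, G.degree v ≠ 1 := ⟨e ⟨0, by omega⟩, (e ⟨0, by omega⟩).2⟩
  have : ∀ v, ∃ j : Fin ℓ, (G.degree v ≠ 1 → (e j : V) = v) ∧
      (G.degree v = 1 → ∀ w, G.Adj v w ↔ w = e j) := by
    intro v
    by_cases hv : G.degree v = 1
    · obtain ⟨w, hw⟩ := (G.degree_pos_iff_exists_adj v).mp (by omega)
      have hw1 := degree_ne_one_of_adj_leaf hG hd hw hv
      obtain ⟨j, hj⟩ := e.surjective ⟨w, hw1⟩
      refine ⟨j, fun h => absurd hv h, fun _ x => ?_⟩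
      rw [hj]
      constructor
      · exact fun hx => eq_of_adj_of_degree_eq_one hv hx hw
      · rintro rfl; exact hw
    · obtain ⟨j, hj⟩ := e.surjective ⟨v, hv⟩
      exact ⟨j, fun _ => by rw [hj], fun h => absurd h hv⟩
  choose b hb using this
  exact ⟨b, fun v => (hb v).1, fun v => (hb v).2⟩

/-- The even cycle is coloured by the parity of its labels, and each leaf opposite to its base
point. -/
theorem exists_signColoring_of_label (hG : G.Connected) (hℓ : 3 ≤ ℓ) (heven : Even ℓ)
    (e : SimpleGraph.cycleGraph ℓ ≃g core G) : ∃ σ : V → ℤ, IsSignColoring G σ := by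
  obtain ⟨b, hb1, hb2⟩ := exists_base hG hℓ e
  have hd : ∃ v, G.degree v ≠ 1 := ⟨e ⟨0, by omega⟩, (e ⟨0, by omega⟩).2⟩
  have hbe : ∀ j, b (e j) = j := fun j => e.injective (Subtype.ext (hb1 (e j) (e j).2))
  let σ : V → ℤ := fun v => if G.degree v = 1 then -(-1) ^ (b v : ℕ) else (-1) ^ (b v : ℕ)
  have hleaf : ∀ u v, G.Adj u v → G.degree u = 1 → σ u = - σ v := by
    intro u v huv hu
    have hv := (hb2 u hu v).mp huv
    have hv1 : G.degree v ≠ 1 := hv ▸ (e (b u)).2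
    simp only [σ, if_pos hu, if_neg hv1]
    rw [hv, hbe]
  refine ⟨σ, fun v => ?_, fun u v huv => ?_⟩
  · simp only [σ]
    split_ifs <;> simp [← pow_add, ← two_mul]
  · by_cases hu : G.degree u = 1
    · exact hleaf u v huv hu
    by_cases hv : G.degree v = 1
    · rw [hleaf v u huv.symm hv, neg_neg]
    simp only [σ, if_neg hu, if_neg hv]
    rw [← hb1 u hu, ← hb1 v hv, adj_label_iff, cycleGraph_adj_iff hℓ] at huv
    rcases huv with h | h | ⟨h, h'⟩ | ⟨h, h'⟩
    · rw [h, pow_succ]; ring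
    · rw [h, pow_succ]; ring
    · rw [h]
      rw [← h'] at heven
      have : Odd (b v : ℕ) := by
        rw [← Nat.not_even_iff_odd]; exact fun h => by simp [Nat.even_add_one, h] at heven
      rw [this.neg_one_pow]; simp
    · rw [h]
      rw [← h'] at heven
      have : Odd (b u : ℕ) := by
        rw [← Nat.not_even_iff_odd]; exact fun h => by simp [Nat.even_add_one, h] at heven
      rw [this.neg_one_pow]; simp

theorem degree_ne_one_of_two_adj {v a b : V} (hab : a ≠ b) (ha : G.Adj v a) (hb : G.Adj v b) :
    G.degree v ≠ 1 := fun hv => hab (eq_of_adj_of_degree_eq_one hv ha hb)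

theorem cycleGraph_no_four {n : ℕ} (hn : 5 ≤ n) {u v w x : Fin n} (huv : u ≠ v) (hwx : w ≠ x)
    (h1 : (SimpleGraph.cycleGraph n).Adj u w) (h2 : (SimpleGraph.cycleGraph n).Adj w v)
    (h3 : (SimpleGraph.cycleGraph n).Adj u x) (h4 : (SimpleGraph.cycleGraph n).Adj x v) :
    False := by
  rw [cycleGraph_adj_iff (by omega)] at h1 h2 h3 h4
  rw [Ne, Fin.ext_iff] at huv hwx
  omega

theorem cycleGraph_no_six {n : ℕ} (hn : 7 ≤ n) {u a b v a' b' : Fin n} (_ : a ≠ a')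
    (hbb : b ≠ b') (hub : u ≠ b) (hub' : u ≠ b') (hav : a ≠ v) (hav' : a' ≠ v)
    (h1 : (SimpleGraph.cycleGraph n).Adj u a) (h2 : (SimpleGraph.cycleGraph n).Adj a b)
    (h3 : (SimpleGraph.cycleGraph n).Adj b v) (h4 : (SimpleGraph.cycleGraph n).Adj u a')
    (h5 : (SimpleGraph.cycleGraph n).Adj a' b') (h6 : (SimpleGraph.cycleGraph n).Adj b' v) :
    False := by
  rw [cycleGraph_adj_iff (by omega)] at h1 h2 h3 h4 h5 h6
  rw [Ne, Fin.ext_iff] at hbb hub hub' hav hav'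
  rcases h1 with h1 | h1 | h1 | h1 <;> rcases h4 with h4 | h4 | h4 | h4 <;> omega

theorem sq_adjMatrix_apply_eq (u v w : V) (h : G.adjMatrix ℤ u w * G.adjMatrix ℤ w v = 1) :
    G.Adj u w ∧ G.Adj w v := by
  rw [SimpleGraph.adjMatrix_apply, SimpleGraph.adjMatrix_apply] at h
  by_contra hc
  rw [not_and_or] at hc
  rcases hc with hc | hc <;> simp [hc] at h

/-- Two common neighbours would close a 4-cycle. Its vertices have degree at least 2, so it would
lie in the core, a cycle of length at least 5. -/
theorem codegree_le_one (hℓ : 5 ≤ ℓ) (e : SimpleGraph.cycleGraph ℓ ≃g core G) (u v : V)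
    (huv : u ≠ v) : (G.adjMatrix ℤ * G.adjMatrix ℤ) u v ≤ 1 := by
  by_contra! h
  rw [mul_apply] at h
  obtain ⟨w, x, hwx, hw, hx⟩ := exists_two_of_two_le_sum
    (mul_apply_zero_or_one (adjMatrix_zero_or_one G) u v) (by omega)
  obtain ⟨huw, hwv⟩ := sq_adjMatrix_apply_eq u v w hw
  obtain ⟨hux, hxv⟩ := sq_adjMatrix_apply_eq u v x hx
  obtain ⟨u', hu'⟩ := e.surjective ⟨u, degree_ne_one_of_two_adj hwx huw hux⟩
  obtain ⟨v', hv'⟩ := e.surjective ⟨v, degree_ne_one_of_two_adj hwx hwv.symm hxv.symm⟩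
  obtain ⟨w', hw'⟩ := e.surjective ⟨w, degree_ne_one_of_two_adj huv huw.symm hwv⟩
  obtain ⟨x', hx'⟩ := e.surjective ⟨x, degree_ne_one_of_two_adj huv hux.symm hxv⟩
  have eu : (e u' : V) = u := by rw [hu']
  have ev : (e v' : V) = v := by rw [hv']
  have ew : (e w' : V) = w := by rw [hw']
  have ex : (e x' : V) = x := by rw [hx']
  rw [← eu, ← ew, adj_label_iff] at huw
  rw [← ew, ← ev, adj_label_iff] at hwv
  rw [← eu, ← ex, adj_label_iff] at hux
  rw [← ex, ← ev, adj_label_iff] at hxv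
  refine cycleGraph_no_four hℓ (u := u') (v := v') (w := w') (x := x') ?_ ?_ huw hwv hux hxv
  · rintro rfl; exact huv (eu.symm.trans ev)
  · rintro rfl; exact hwx (ew.symm.trans ex)

theorem cube_le_one (hℓ : 7 ≤ ℓ) (e : SimpleGraph.cycleGraph ℓ ≃g core G) (u v : V)
    (huv : ¬ G.Adj u v) :
    (G.adjMatrix ℤ * G.adjMatrix ℤ * G.adjMatrix ℤ) u v ≤ 1 := by
  by_contra! h
  have hco := codegree_le_one (by omega) e
  have hterm : ∀ b, (G.adjMatrix ℤ * G.adjMatrix ℤ) u b * G.adjMatrix ℤ b v = 0 ∨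
      (G.adjMatrix ℤ * G.adjMatrix ℤ) u b * G.adjMatrix ℤ b v = 1 := by
    intro b
    by_cases hb : G.Adj b v
    · have h1 : u ≠ b := by rintro rfl; exact huv hb
      have h2 := hco u b h1
      have h3 := sq_apply_nonneg (adjMatrix_zero_or_one G) u b
      simp only [SimpleGraph.adjMatrix_apply _ b v, if_pos hb, mul_one]
      omega
    · simp only [SimpleGraph.adjMatrix_apply _ b v, if_neg hb, mul_zero, true_or]
  rw [mul_apply] at h
  obtain ⟨b, b', hbb, hb, hb'⟩ := exists_two_of_two_le_sum hterm (by omega)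
  have key : ∀ b, (G.adjMatrix ℤ * G.adjMatrix ℤ) u b * G.adjMatrix ℤ b v = 1 →
      ∃ a, G.Adj u a ∧ G.Adj a b ∧ G.Adj b v := by
    intro b hb
    have h1 : G.Adj b v := by
      by_contra hc
      rw [SimpleGraph.adjMatrix_apply _ b v, if_neg hc, mul_zero] at hb
      exact zero_ne_one hb
    rw [SimpleGraph.adjMatrix_apply _ b v, if_pos h1, mul_one, mul_apply] at hb
    obtain ⟨a, -, ha⟩ := Finset.exists_ne_zero_of_sum_ne_zero (hb.symm ▸ one_ne_zero)
    have := (mul_apply_zero_or_one (adjMatrix_zero_or_one G) u b a).resolve_left ha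
    obtain ⟨h2, h3⟩ := sq_adjMatrix_apply_eq u b a this
    exact ⟨a, h2, h3, h1⟩
  obtain ⟨a, hua, hab, hbv⟩ := key b hb
  obtain ⟨a', hua', hab', hbv'⟩ := key b' hb'
  have hav : a ≠ v := by rintro rfl; exact huv hua
  have hav' : a' ≠ v := by rintro rfl; exact huv hua'
  have hub : u ≠ b := by rintro rfl; exact huv hbv
  have hub' : u ≠ b' := by rintro rfl; exact huv hbv'
  -- If the walks shared their second vertex, that vertex and `v` would have two common neighbours.
  -- Hence all vertices of the walks have two distinct neighbours and lie in the core.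
  have haa : a ≠ a' := by
    rintro rfl
    have := hco a v hav
    rw [mul_apply] at this
    have h2 := two_le_sum_of_two (fun y => ?_) hbb
      (a := fun y => G.adjMatrix ℤ a y * G.adjMatrix ℤ y v) (by simp [hab, hbv])
      (by simp [hab', hbv'])
    · omega
    · exact mul_nonneg (adjMatrix_nonneg G _ _) (adjMatrix_nonneg G _ _)
  obtain ⟨u', hu'⟩ := e.surjective ⟨u, degree_ne_one_of_two_adj haa hua hua'⟩
  obtain ⟨v', hv'⟩ := e.surjective ⟨v, degree_ne_one_of_two_adj hbb hbv.symm hbv'.symm⟩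
  obtain ⟨x, hx⟩ := e.surjective ⟨a, degree_ne_one_of_two_adj hub hua.symm hab⟩
  obtain ⟨x', hx'⟩ := e.surjective ⟨a', degree_ne_one_of_two_adj hub' hua'.symm hab'⟩
  obtain ⟨y, hy⟩ := e.surjective ⟨b, degree_ne_one_of_two_adj hav hab.symm hbv⟩
  obtain ⟨y', hy'⟩ := e.surjective ⟨b', degree_ne_one_of_two_adj hav' hab'.symm hbv'⟩
  have eu : (e u' : V) = u := by rw [hu']
  have ev : (e v' : V) = v := by rw [hv']
  have ex : (e x : V) = a := by rw [hx]
  have ex' : (e x' : V) = a' := by rw [hx']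
  have ey : (e y : V) = b := by rw [hy]
  have ey' : (e y' : V) = b' := by rw [hy']
  rw [← eu, ← ex, adj_label_iff] at hua
  rw [← ex, ← ey, adj_label_iff] at hab
  rw [← ey, ← ev, adj_label_iff] at hbv
  rw [← eu, ← ex', adj_label_iff] at hua'
  rw [← ex', ← ey', adj_label_iff] at hab'
  rw [← ey', ← ev, adj_label_iff] at hbv'
  have hne : ∀ {i j : Fin ℓ} {p q : V}, (e i : V) = p → (e j : V) = q → p ≠ q → i ≠ j := by
    rintro i j p q hi hj hpq rfl
    exact hpq (hi.symm.trans hj)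
  exact cycleGraph_no_six hℓ (hne ex ex' haa) (hne ey ey' hbb) (hne eu ey hub) (hne eu ey' hub')
    (hne ex ev hav) (hne ex' ev hav') hua hab hbv hua' hab' hbv'

end Labelled

/-! ### Hub positions and the local structure of nice graphs. -/

/-- The positions of the 2-hubs of a nice graph: the first one is `4` and the gaps are `4` or
`6`. -/
def IsHubSequence (p : ℕ → ℕ) (k : ℕ) : Prop :=
  p 1 = 4 ∧ ∀ i, 1 ≤ i → i < k → p (i + 1) = p i + 4 ∨ p (i + 1) = p i + 6

theorem IsHubSequence.add_le {p : ℕ → ℕ} {k : ℕ} (hp : IsHubSequence p k) {i : ℕ} (hi : 1 ≤ i) :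
    ∀ d, i + d ≤ k → p i + 4 * d ≤ p (i + d) ∧ p (i + d) ≤ p i + 6 * d := by
  intro d
  induction d with
  | zero => intro _; simp
  | succ d ih =>
    intro h
    have h1 := ih (by omega)
    have h2 := hp.2 (i + d) (by omega) (by omega)
    rw [← add_assoc]
    omega

theorem IsHubSequence.bounds {p : ℕ → ℕ} {k : ℕ} (hp : IsHubSequence p k) {i : ℕ} (hi : 1 ≤ i)
    (hik : i ≤ k) : 4 * i ≤ p i ∧ p i + 2 ≤ 6 * i := by
  obtain ⟨d, rfl⟩ := Nat.exists_eq_add_of_le hi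
  have h1 := hp.add_le le_rfl d hik
  have h2 := hp.1
  omega

theorem IsHubSequence.lt {p : ℕ → ℕ} {k : ℕ} (hp : IsHubSequence p k) {i j : ℕ} (hi : 1 ≤ i)
    (hij : i < j) (hj : j ≤ k) : p i + 4 * (j - i) ≤ p j ∧ p j ≤ p i + 6 * (j - i) := by
  obtain ⟨d, rfl⟩ := Nat.exists_eq_add_of_le hij.le
  have h1 := hp.add_le hi d hj
  rw [Nat.add_sub_cancel_left]
  exact h1

section Nice
variable {V : Type*} [Fintype V] [DecidableEq V] {G : SimpleGraph V} [DecidableRel G.Adj]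
  {ℓ k : ℕ}

/-- A labelled sun-like graph with its 1-hub at `0` and its 2-hubs at `p 1, …, p k`. -/
structure HubLabel (G : SimpleGraph V) [DecidableRel G.Adj] (ℓ k : ℕ)
    (e : SimpleGraph.cycleGraph ℓ ≃g core G) (p : ℕ → ℕ) : Prop where
  one_le_k : 1 ≤ k
  le_length : max (12 * k) 15 ≤ ℓ
  connected : G.Connected
  seq : IsHubSequence p k
  degree_three : ∀ j : Fin ℓ, G.degree (e j : V) = 3 ↔ (j : ℕ) = 0
  degree_four : ∀ j : Fin ℓ, G.degree (e j : V) = 4 ↔ ∃ i, 1 ≤ i ∧ i ≤ k ∧ (j : ℕ) = p i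
  degree_le : ∀ v, G.degree v ≤ 4

theorem IsNice.exists_hubLabel (hG : IsNice G ℓ k) :
    ∃ e p, HubLabel G ℓ k e p := by
  obtain ⟨h1, h2, ⟨h3, h4, -⟩, e, p, hp1, hp2, he1, he2, hh⟩ := hG
  refine ⟨e, p, h1, h2, h3, ⟨hp1, hp2⟩, fun j => ?_, fun j => ?_, fun v => ?_⟩
  · rw [← he1 j, IsHub]; omega
  · rw [← he2 j, IsHub]; omega
  · by_contra! h
    have := hh v (G.degree v - 2) ⟨by omega, by omega⟩
    omega

namespace HubLabel
variable {e : SimpleGraph.cycleGraph ℓ ≃g core G} {p : ℕ → ℕ}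

theorem fifteen_le (h : HubLabel G ℓ k e p) : 15 ≤ ℓ := (le_max_right _ _).trans h.le_length

theorem twelve_mul_le (h : HubLabel G ℓ k e p) : 12 * k ≤ ℓ :=
  (le_max_left _ _).trans h.le_length

theorem hub_position (h : HubLabel G ℓ k e p) {j : Fin ℓ} (hj : 3 ≤ G.degree (e j : V)) :
    (j : ℕ) = 0 ∨ ∃ i, 1 ≤ i ∧ i ≤ k ∧ (j : ℕ) = p i := by
  have h1 := h.degree_le (e j)
  rcases (show G.degree (e j : V) = 3 ∨ G.degree (e j : V) = 4 by omega) with h2 | h2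
  · exact Or.inl ((h.degree_three j).mp h2)
  · exact Or.inr ((h.degree_four j).mp h2)

/-- The second bound, together with 12k ≤ ℓ, also makes the arc through the end of the labelling
long, so hubs are far apart both ways around the cycle. -/
theorem hub_separated (h : HubLabel G ℓ k e p) {i j : Fin ℓ} (hi : 3 ≤ G.degree (e i : V))
    (hj : 3 ≤ G.degree (e j : V)) (hij : (i : ℕ) < j) : (i : ℕ) + 4 ≤ j ∧ (j : ℕ) + 2 ≤ 6 * k := by
  have hj0 : ∃ b, 1 ≤ b ∧ b ≤ k ∧ (j : ℕ) = p b := (h.hub_position hj).resolve_left (by omega)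
  obtain ⟨b, hb1, hbk, hb⟩ := hj0
  have hbb := h.seq.bounds hb1 hbk
  rcases h.hub_position hi with hi | ⟨a, ha1, hak, ha⟩
  · omega
  · rcases lt_trichotomy a b with hab | rfl | hab
    · have := h.seq.lt ha1 hab hbk
      omega
    · omega
    · have := h.seq.lt hb1 hab hak
      omega

theorem exists_degree_ne_one (h : HubLabel G ℓ k e p) : ∃ v, G.degree v ≠ 1 :=
  have := h.fifteen_le
  ⟨e ⟨0, by omega⟩, (e ⟨0, by omega⟩).2⟩

theorem hasSunProfile (h : HubLabel G ℓ k e p) : HasSunProfile G k := by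
  have h15 := h.fifteen_le
  have h12 := h.twelve_mul_le
  have hk := h.one_le_k
  have hleaf : ∀ u v, G.Adj u v → G.degree u = 1 → G.degree v ≠ 1 := fun u v huv hu =>
    degree_ne_one_of_adj_leaf h.connected h.exists_degree_ne_one huv hu
  have hcore : ∀ v, G.degree v ≠ 1 → ∃ j, (e j : V) = v := fun v hv => by
    obtain ⟨j, hj⟩ := e.surjective ⟨v, hv⟩
    exact ⟨j, by rw [hj]⟩
  refine ⟨fun v => ⟨?_, h.degree_le v⟩, fun v hv => leafCount_of_label (by omega) e v hv, hleaf,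
    ?_, ?_, fun u v => codegree_le_one (by omega) e u v, fun u v => cube_le_one (by omega) e u v,
    ?_, ?_⟩
  · by_cases hv : G.degree v = 1
    · omega
    · have := two_le_degree_of_label (by omega) e v hv
      omega
  · intro u v huv hu
    by_contra! hv
    obtain ⟨i, rfl⟩ := hcore u (by omega)
    obtain ⟨j, rfl⟩ := hcore v (by omega)
    rw [adj_label_iff, cycleGraph_adj_iff (by omega)] at huv
    rcases lt_trichotomy (i : ℕ) j with hij | hij | hij
    · have := h.hub_separated hu hv hij; omega
    · omega
    · have := h.hub_separated hv hu hij; omega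
  · intro v a b hv hva hvb ha hb
    obtain ⟨i, rfl⟩ := hcore v (by omega)
    obtain ⟨j, rfl⟩ := hcore a (by omega)
    obtain ⟨l, rfl⟩ := hcore b (by omega)
    rw [adj_label_iff, cycleGraph_adj_iff (by omega)] at hva hvb
    rcases lt_trichotomy (j : ℕ) l with hij | hij | hij
    · have := h.hub_separated ha hb hij; omega
    · rw [Fin.ext hij]
    · have := h.hub_separated hb ha hij; omega
  · have h0 := (h.degree_three ⟨0, by omega⟩).mpr rfl
    rw [degCount, Finset.sum_eq_single (e ⟨0, by omega⟩ : V)]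
    · rw [if_pos h0]
    · intro v _ hv
      rw [if_neg]
      intro hv3
      obtain ⟨j, rfl⟩ := hcore v (by omega)
      exact hv (congrArg (fun j => (e j : V)) (Fin.ext ((h.degree_three j).mp hv3)))
    · simp
  · have hpl : ∀ i ∈ Finset.Icc 1 k, p i < ℓ := fun i hi => by
      rw [Finset.mem_Icc] at hi
      have := h.seq.bounds hi.1 hi.2
      omega
    have hset : (Finset.univ.filter fun v => G.degree v = 4)
        = (Finset.Icc 1 k).attach.image fun i => (e ⟨p i.1, hpl i.1 i.2⟩ : V) := by
      ext v
      rw [Finset.mem_filter, Finset.mem_image]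
      constructor
      · rintro ⟨-, hv⟩
        obtain ⟨j, rfl⟩ := hcore v (by omega)
        obtain ⟨i, hi1, hik, hi⟩ := (h.degree_four j).mp hv
        exact ⟨⟨i, Finset.mem_Icc.mpr ⟨hi1, hik⟩⟩, Finset.mem_attach _ _,
          congrArg (fun j => (e j : V)) (Fin.ext hi.symm)⟩
      · rintro ⟨⟨i, hi⟩, -, rfl⟩
        have hi' := Finset.mem_Icc.mp hi
        exact ⟨Finset.mem_univ _, (h.degree_four _).mpr ⟨i, hi'.1, hi'.2, rfl⟩⟩
    have : degCount G 4 = (Finset.univ.filter fun v => G.degree v = 4).card := by simp [degCount]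
    rw [this, hset, Finset.card_image_of_injective, Finset.card_attach, Nat.card_Icc]
    · simp
    · rintro ⟨a, ha⟩ ⟨b, hb⟩ hab
      have hab' : p a = p b := by
        have := e.injective (Subtype.ext hab)
        exact Fin.ext_iff.mp this
      rw [Finset.mem_Icc] at ha hb
      rw [Subtype.mk_eq_mk]
      rcases lt_trichotomy a b with hlt | heq | hlt
      · have := h.seq.lt ha.1 hlt hb.2; omega
      · exact heq
      · have := h.seq.lt hb.1 hlt ha.2; omega

end HubLabel
end Nice
end SunGraph

/-! ### Elimination of the leaves by a Schur complement. -/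

namespace SunGraph
open Matrix

section Schur
variable {V : Type*} [Fintype V] [DecidableEq V] {G : SimpleGraph V} [DecidableRel G.Adj] {ℓ : ℕ}

/-- The number of leaves at the `j`-th vertex of the cycle. -/
def hubWeight (e : SimpleGraph.cycleGraph ℓ ≃g core G) (j : Fin ℓ) : ℕ := G.degree (e j : V) - 2

theorem hubWeight_cast (hℓ : 3 ≤ ℓ) (e : SimpleGraph.cycleGraph ℓ ≃g core G) (j : Fin ℓ) :
    G.degree (e j : V) = hubWeight e j + 2 := by
  have := two_le_degree_of_label hℓ e (e j) (e j).2
  rw [hubWeight]; omega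

theorem leafCount_label (hℓ : 3 ≤ ℓ) (e : SimpleGraph.cycleGraph ℓ ≃g core G) (j : Fin ℓ) :
    leafCount G (e j) = hubWeight e j := by
  rw [leafCount_of_label hℓ e _ (e j).2, hubWeight_cast hℓ]
  push_cast
  ring

/-- Split the vertices of a labelled sun-like graph into the cycle and the leaves. -/
noncomputable def labelEquiv (e : SimpleGraph.cycleGraph ℓ ≃g core G) :
    Fin ℓ ⊕ {v : V // G.degree v = 1} ≃ V :=
  Equiv.ofBijective (Sum.elim (fun j => (e j : V)) Subtype.val) (by
    constructor
    · rintro (i | i) (j | j) h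
      · exact congrArg Sum.inl (e.injective (Subtype.ext h))
      · have h' : (e i : V) = j := h
        exact absurd (h' ▸ j.2) (e i).2
      · have h' : (i : V) = e j := h
        exact absurd (h' ▸ i.2) (e j).2
      · exact congrArg Sum.inr (Subtype.ext h)
    · intro v
      by_cases hv : G.degree v = 1
      · exact ⟨Sum.inr ⟨v, hv⟩, rfl⟩
      · obtain ⟨j, hj⟩ := e.surjective ⟨v, hv⟩
        exact ⟨Sum.inl j, by simp [hj]⟩)

@[simp]
theorem labelEquiv_inl (e : SimpleGraph.cycleGraph ℓ ≃g core G) (j : Fin ℓ) :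
    labelEquiv e (Sum.inl j) = e j := rfl

@[simp]
theorem labelEquiv_inr (e : SimpleGraph.cycleGraph ℓ ≃g core G)
    (u : {v : V // G.degree v = 1}) : labelEquiv e (Sum.inr u) = u := rfl

theorem card_eq_add_card_leaves (e : SimpleGraph.cycleGraph ℓ ≃g core G) :
    Fintype.card V = ℓ + Fintype.card {v : V // G.degree v = 1} := by
  rw [← Fintype.card_congr (labelEquiv e)]
  simp

theorem hubWeight_eq_sum (hℓ : 3 ≤ ℓ) (e : SimpleGraph.cycleGraph ℓ ≃g core G) {b : V → Fin ℓ}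
    (hb : ∀ v, G.degree v = 1 → ∀ w, G.Adj v w ↔ w = e (b v)) (i : Fin ℓ) :
    hubWeight e i = ∑ u : {v : V // G.degree v = 1}, if b u = i then 1 else 0 := by
  have hadj : ∀ u : {v : V // G.degree v = 1}, G.Adj (e i) u ↔ b u = i := by
    intro u
    rw [G.adj_comm, hb u u.2]
    exact ⟨fun h => (e.injective (Subtype.ext h)).symm, fun h => by rw [h]⟩
  have h : leafCount G (e i) = ∑ u : {v : V // G.degree v = 1}, if b u = i then 1 else 0 := by
    rw [leafCount, ← Finset.sum_filter,
      Finset.sum_subtype (p := fun w => G.degree w = 1)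
        (Finset.univ.filter fun w => G.degree w = 1) (by simp)]
    refine Finset.sum_congr rfl fun u _ => ?_
    rw [SimpleGraph.adjMatrix_apply]
    simp only [hadj]
  rw [leafCount_label hℓ] at h
  exact_mod_cast h

theorem sum_hubWeight (hG : G.Connected) (hℓ : 3 ≤ ℓ)
    (e : SimpleGraph.cycleGraph ℓ ≃g core G) :
    ∑ j, hubWeight e j = Fintype.card {v : V // G.degree v = 1} := by
  obtain ⟨b, -, hb2⟩ := exists_base hG hℓ e
  simp only [hubWeight_eq_sum hℓ e hb2]
  rw [Finset.sum_comm]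
  simp

/-- Eliminating the leaves from the characteristic polynomial of a sun-like graph. -/
theorem eval_charpoly_of_label (hG : G.Connected) (hℓ : 3 ≤ ℓ)
    (e : SimpleGraph.cycleGraph ℓ ≃g core G) {S : Type*} [CommRing S] (x d : S)
    (hd : (x - 1) * d = 1) :
    (intLaplacian G).charpoly.eval₂ (Int.castRingHom S) x
      = (x - 1) ^ Fintype.card {v : V // G.degree v = 1}
        * ((x - 2) • (1 : Matrix (Fin ℓ) (Fin ℓ) S) - (SimpleGraph.cycleGraph ℓ).adjMatrix S
          - (x * d) • diagonal fun j => (hubWeight e j : S)).det := by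
  obtain ⟨b, hb1, hb2⟩ := exists_base hG hℓ e
  let R : Matrix (Fin ℓ) {v : V // G.degree v = 1} S := of fun j u => if b u = j then 1 else 0
  set D : Matrix {v : V // G.degree v = 1} {v : V // G.degree v = 1} S := (x - 1) • 1 with hD
  -- The leaf block is x - 1 times the identity, so an inverse of x - 1 in `S` suffices. This allows
  -- both real numbers and power series, where X - 1 is a unit.
  let invD : Invertible D :=
    ⟨d • 1, by simp [hD, smul_smul, hd], by simp [hD, smul_smul, (mul_comm d _).trans hd]⟩
  have hadj : ∀ (j : Fin ℓ) (u : {v : V // G.degree v = 1}), G.Adj (e j) u ↔ b u = j := by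
    intro j u
    rw [G.adj_comm, hb2 u u.2]
    exact ⟨fun h => (e.injective (Subtype.ext h)).symm, fun h => by rw [h]⟩
  have hadj' : ∀ (j : Fin ℓ) (u : {v : V // G.degree v = 1}), G.Adj u (e j) ↔ b u = j :=
    fun j u => (G.adj_comm _ _).trans (hadj j u)
  have hne : ∀ (j : Fin ℓ) (u : {v : V // G.degree v = 1}), (e j : V) ≠ u := fun j u h =>
    (e j).2 (h ▸ u.2)
  have hblock : (scalar V x - (intLaplacian G).map (Int.castRingHom S)).submatrix
      (labelEquiv e) (labelEquiv e)
      = fromBlocks (diagonal (fun j => x - 2 - (hubWeight e j : S))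
        - (SimpleGraph.cycleGraph ℓ).adjMatrix S) (-R) (-Rᵀ) D := by
    ext (i | i) (j | j)
    · rw [submatrix_apply, fromBlocks_apply₁₁, Matrix.sub_apply, Matrix.sub_apply, map_apply,
        labelEquiv_inl, labelEquiv_inl, intLaplacian_apply, SimpleGraph.adjMatrix_apply,
        scalar_apply]
      simp only [adj_label_iff]
      by_cases hij : i = j
      · subst hij
        rw [diagonal_apply_eq, diagonal_apply_eq, if_pos rfl, hubWeight_cast hℓ e i]
        simp only [SimpleGraph.irrefl, if_false]
        push_cast
        simp
        ring
      · have hij' : (e i : V) ≠ e j := fun h => hij (e.injective (Subtype.ext h))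
        rw [diagonal_apply_ne _ hij, diagonal_apply_ne _ hij', if_neg hij']
        split_ifs <;> simp
    · rw [submatrix_apply, fromBlocks_apply₁₂, Matrix.sub_apply, map_apply, labelEquiv_inl,
        labelEquiv_inr, intLaplacian_apply, scalar_apply, diagonal_apply_ne _ (hne i j),
        if_neg (hne i j)]
      simp only [hadj, Matrix.neg_apply, R, of_apply]
      split_ifs <;> simp
    · rw [submatrix_apply, fromBlocks_apply₂₁, Matrix.sub_apply, map_apply, labelEquiv_inl,
        labelEquiv_inr, intLaplacian_apply, scalar_apply, diagonal_apply_ne _ (hne j i).symm,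
        if_neg (hne j i).symm]
      simp only [hadj', Matrix.neg_apply, R, of_apply, transpose_apply]
      split_ifs <;> simp
    · have hnadj : ¬ G.Adj (i : V) j := fun h =>
        degree_ne_one_of_adj_leaf hG ⟨e ⟨0, by omega⟩, (e ⟨0, by omega⟩).2⟩ h i.2 j.2
      rw [submatrix_apply, fromBlocks_apply₂₂, Matrix.sub_apply, map_apply, labelEquiv_inr,
        labelEquiv_inr, intLaplacian_apply, scalar_apply, if_neg hnadj, hD, Matrix.smul_apply,
        i.2]
      by_cases hij : i = j
      · subst hij; simp
      · have hij' : (i : V) ≠ j := fun h => hij (Subtype.ext h)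
        rw [diagonal_apply_ne _ hij', one_apply_ne hij, if_neg hij']
        simp
  -- Each leaf has a single base point, so the correction made by the Schur complement is diagonal.
  have hRR : R * Rᵀ = diagonal fun j => (hubWeight e j : S) := by
    ext i j
    rw [mul_apply, diagonal_apply]
    simp only [R, of_apply, transpose_apply]
    split_ifs with hij
    · subst hij
      simp only [mul_ite, mul_one, mul_zero]
      rw [hubWeight_eq_sum hℓ e hb2 i]
      push_cast
      refine Finset.sum_congr rfl fun u _ => ?_
      split_ifs <;> rfl
    · refine Finset.sum_eq_zero fun u _ => ?_
      split_ifs with h1 h2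
      · exact absurd (h1.symm.trans h2) hij
      all_goals simp
  have hdet : D.det = (x - 1) ^ Fintype.card {v : V // G.degree v = 1} := by
    rw [hD, det_smul, det_one, mul_one]
  rw [Polynomial.eval₂_eq_eval_map, ← charpoly_map, eval_charpoly,
    ← det_submatrix_equiv_self (labelEquiv e), hblock, det_fromBlocks₂₂, hdet]
  congr 2
  have : ⅟D = d • (1 : Matrix {v : V // G.degree v = 1} {v : V // G.degree v = 1} S) := rfl
  rw [this]
  simp only [Matrix.mul_smul, Matrix.mul_one, Matrix.neg_mul, Matrix.mul_neg, Matrix.smul_mul,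
    smul_neg, neg_neg, hRR]
  ext i j
  simp only [Matrix.sub_apply, Matrix.smul_apply, smul_eq_mul, diagonal_apply, one_apply]
  split_ifs
  -- The weight enters once through the degree and `d` times through the Schur complement, and 1 + d
  -- = xd.
  · linear_combination (hubWeight e i : S) * hd
  · ring

end Schur

/-! ### The determinant of the reduced signless Laplacian of a cycle. -/

section PathDet

/-- The bidiagonal factor of the path matrix. -/
def bidiag (m : ℕ) : Matrix (Fin m) (Fin m) ℤ :=
  of fun i j => (if i = j then 1 else 0) + if (i : ℕ) = j + 1 then 1 else 0

theorem det_bidiag (m : ℕ) : (bidiag m).det = 1 := by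
  rw [det_of_isLowerTriangular]
  · refine Finset.prod_eq_one fun i _ => ?_
    simp [bidiag]
  · intro i j hij
    have h1 : (i : ℕ) < j := by simpa using hij
    simp only [bidiag, of_apply]
    rw [if_neg (fun h => by rw [h] at h1; omega), if_neg (by omega), add_zero]

theorem sum_ite_val_succ {m : ℕ} (i : Fin m) (f : Fin m → ℤ) :
    (∑ j : Fin m, if (i : ℕ) = j + 1 then f j else 0)
      = if h : 0 < (i : ℕ) then f ⟨i - 1, by omega⟩ else 0 := by
  split_ifs with h
  · rw [Finset.sum_eq_single (⟨i - 1, by omega⟩ : Fin m)]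
    · rw [if_pos]; simp only; omega
    · intro j _ hj
      rw [if_neg]
      intro h'
      exact hj (Fin.ext (by simp only; omega))
    · simp
  · exact Finset.sum_eq_zero fun j _ => if_neg (by omega)

theorem bidiag_mulVec_apply {m : ℕ} (f : Fin m → ℤ) (i : Fin m) :
    (∑ j, bidiag m i j * f j) = f i + if h : 0 < (i : ℕ) then f ⟨i - 1, by omega⟩ else 0 := by
  simp only [bidiag, of_apply, add_mul, ite_mul, one_mul, zero_mul, Finset.sum_add_distrib,
    Finset.sum_ite_eq, Finset.mem_univ, if_true]
  rw [sum_ite_val_succ]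

/-- The signless Laplacian of a cycle with one vertex removed from the matrix. -/
def pathMatrix (m : ℕ) : Matrix (Fin m) (Fin m) ℤ :=
  of fun i j => (if i = j then 2 else 0) +
    if (i : ℕ) = j + 1 ∨ (j : ℕ) = i + 1 then 1 else 0

/-- The product `bidiag m * (bidiag m)ᵀ` differs from the path matrix only in its first diagonal
entry, which is 1 and not 2. The bidiagonal factor maps the alternating vector to the first unit
vector, so the rank-one term supplies the missing 1. -/
theorem pathMatrix_eq (m : ℕ) :
    pathMatrix m = bidiag m * (1 + replicateCol Unit (fun i : Fin m => (-1 : ℤ) ^ (i : ℕ))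
      * replicateRow Unit (fun i : Fin m => (-1 : ℤ) ^ (i : ℕ))) * (bidiag m)ᵀ := by
  have hv : bidiag m * replicateCol Unit (fun i : Fin m => (-1 : ℤ) ^ (i : ℕ))
      = replicateCol Unit fun i : Fin m => if (i : ℕ) = 0 then 1 else 0 := by
    ext i u
    rw [mul_apply]
    simp only [replicateCol_apply]
    rw [bidiag_mulVec_apply]
    split_ifs with h1 h2 h2
    · omega
    · simp only
      obtain ⟨t, ht⟩ := Nat.exists_eq_add_of_le h1
      rw [ht, show 0 + 1 + t - 1 = t by omega, show 0 + 1 + t = t + 1 by omega, pow_succ]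
      ring
    · simp [h2]
    · omega
  have hv' : replicateRow Unit (fun i : Fin m => (-1 : ℤ) ^ (i : ℕ)) * (bidiag m)ᵀ
      = (replicateCol Unit fun i : Fin m => if (i : ℕ) = 0 then (1 : ℤ) else 0)ᵀ := by
    rw [← hv, transpose_mul]
    rfl
  have : bidiag m * (1 + replicateCol Unit (fun i : Fin m => (-1 : ℤ) ^ (i : ℕ))
      * replicateRow Unit (fun i : Fin m => (-1 : ℤ) ^ (i : ℕ))) * (bidiag m)ᵀ
      = bidiag m * (bidiag m)ᵀ
        + (bidiag m * replicateCol Unit (fun i : Fin m => (-1 : ℤ) ^ (i : ℕ)))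
          * (replicateRow Unit (fun i : Fin m => (-1 : ℤ) ^ (i : ℕ)) * (bidiag m)ᵀ) := by
    simp only [Matrix.mul_add, Matrix.add_mul, Matrix.mul_one, Matrix.mul_assoc]
  rw [this, hv, hv']
  ext i j
  rw [Matrix.add_apply, mul_apply, mul_apply]
  simp only [transpose_apply, replicateCol_apply, Finset.univ_unique, Finset.sum_singleton]
  rw [bidiag_mulVec_apply]
  simp only [pathMatrix, bidiag, of_apply, Fin.ext_iff]
  split_ifs <;> simp <;> omega

theorem det_pathMatrix (m : ℕ) : (pathMatrix m).det = m + 1 := by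
  rw [pathMatrix_eq, det_mul, det_mul, det_transpose, det_bidiag,
    det_one_add_replicateCol_mul_replicateRow]
  simp [dotProduct, ← pow_add, ← two_mul]
  ring

end PathDet
end SunGraph

/-! ### The linear coefficient of the characteristic polynomial. -/

namespace SunGraph
open Matrix

section CoeffOne

/-- The alternating vector on a cycle. -/
def altSign (S : Type*) [CommRing S] {ℓ : ℕ} (j : Fin ℓ) : S := (-1) ^ (j : ℕ)

theorem altSign_mul_self {S : Type*} [CommRing S] {ℓ : ℕ} (j : Fin ℓ) :
    altSign S j * altSign S j = 1 := by
  rw [altSign, ← pow_add, ← two_mul]; simp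

theorem altSign_adj {S : Type*} [CommRing S] {ℓ : ℕ} (hℓ : 3 ≤ ℓ) (heven : Even ℓ) {i j : Fin ℓ}
    (h : (SimpleGraph.cycleGraph ℓ).Adj i j) : altSign S j = - altSign S i := by
  have hodd : ∀ a : ℕ, a + 1 = ℓ → (-1 : S) ^ a = -1 := by
    intro a ha
    rw [← ha] at heven
    have : Odd a := by
      rw [← Nat.not_even_iff_odd]; exact fun h => by simp [Nat.even_add_one, h] at heven
    exact this.neg_one_pow
  rw [cycleGraph_adj_iff hℓ] at h
  simp only [altSign]
  rcases h with h | h | ⟨h, h'⟩ | ⟨h, h'⟩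
  · rw [h, pow_succ]; ring
  · rw [h, pow_succ]; ring
  · rw [h, hodd _ h']; simp
  · rw [h, hodd _ h']; simp

theorem sum_altSign_adj {S : Type*} [CommRing S] {ℓ : ℕ} (hℓ : 3 ≤ ℓ) (heven : Even ℓ)
    (j : Fin ℓ) :
    ∑ i, altSign S i * (SimpleGraph.cycleGraph ℓ).adjMatrix S i j = -2 * altSign S j := by
  have h1 : ∀ i, altSign S i * (SimpleGraph.cycleGraph ℓ).adjMatrix S i j
      = if (SimpleGraph.cycleGraph ℓ).Adj j i then - altSign S j else 0 := by
    intro i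
    rw [SimpleGraph.adjMatrix_apply]
    simp only [SimpleGraph.adj_comm _ i j]
    split_ifs with h
    · rw [altSign_adj hℓ heven h, mul_one]
    · rw [mul_zero]
  simp only [h1]
  rw [← Finset.sum_filter, ← SimpleGraph.neighborFinset_eq_filter, Finset.sum_const,
    SimpleGraph.card_neighborFinset_eq_degree, cycleGraph_degree hℓ]
  simp

theorem coeff_one_X_mul (q : PowerSeries ℤ) :
    PowerSeries.coeff 1 (PowerSeries.X * q) = PowerSeries.constantCoeff q := by
  rw [show (1 : ℕ) = 0 + 1 from rfl, PowerSeries.coeff_succ_X_mul,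
    PowerSeries.coeff_zero_eq_constantCoeff]

/-- At X = 0 the matrix is minus the signless Laplacian of an even cycle, which the alternating
vector annihilates. The alternating sum of rows therefore yields a factor X; after its removal one
sets X = 0 and sums the columns in the same way. -/
theorem coeff_one_det {m : ℕ} (hm : 3 ≤ m + 1) (heven : Even (m + 1)) (ω : Fin (m + 1) → ℕ)
    (d : PowerSeries ℤ) (hd : PowerSeries.constantCoeff d = -1) :
    PowerSeries.X ∣ (((PowerSeries.X - 2 : PowerSeries ℤ) • (1 : Matrix (Fin (m + 1)) (Fin (m + 1)) (PowerSeries ℤ))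
        - (SimpleGraph.cycleGraph (m + 1)).adjMatrix (PowerSeries ℤ)
        - (PowerSeries.X * d) • diagonal fun j => (ω j : PowerSeries ℤ)).det) ∧
    PowerSeries.coeff 1 (((PowerSeries.X - 2 : PowerSeries ℤ) •
        (1 : Matrix (Fin (m + 1)) (Fin (m + 1)) (PowerSeries ℤ))
        - (SimpleGraph.cycleGraph (m + 1)).adjMatrix (PowerSeries ℤ)
        - (PowerSeries.X * d) • diagonal fun j => (ω j : PowerSeries ℤ)).det)
      = (-1) ^ m * ((m + 1 + ∑ j, ω j : ℕ) * (m + 1)) := by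
  set M : Matrix (Fin (m + 1)) (Fin (m + 1)) (PowerSeries ℤ) := (PowerSeries.X - 2 : PowerSeries ℤ) • 1
        - (SimpleGraph.cycleGraph (m + 1)).adjMatrix (PowerSeries ℤ)
        - (PowerSeries.X * d) • diagonal fun j => (ω j : PowerSeries ℤ) with hM
  let r : Fin (m + 1) → PowerSeries ℤ := fun j => altSign _ j * (1 - d * (ω j : PowerSeries ℤ))
  have hrow : (∑ k, altSign (PowerSeries ℤ) k • M k) = (PowerSeries.X : PowerSeries ℤ) • r := by
    ext1 j
    refine (Finset.sum_apply j Finset.univ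
      (fun k => (altSign (PowerSeries ℤ) k • M k : Fin (m + 1) → PowerSeries ℤ))).trans ?_
    have h1 : ∀ k, (altSign (PowerSeries ℤ) k • M k) j
        = (if k = j then altSign (PowerSeries ℤ) k
            * (PowerSeries.X - 2 - PowerSeries.X * d * (ω j : PowerSeries ℤ)) else 0)
          - altSign (PowerSeries ℤ) k
            * (SimpleGraph.cycleGraph (m + 1)).adjMatrix (PowerSeries ℤ) k j := by
      intro k
      change altSign (PowerSeries ℤ) k * M k j = _
      rw [hM, Matrix.sub_apply, Matrix.sub_apply, Matrix.smul_apply, Matrix.smul_apply,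
        one_apply, diagonal_apply]
      by_cases h : k = j
      · subst h; simp only [if_true, smul_eq_mul]; ring
      · simp only [h, if_false, smul_eq_mul]; ring
    simp only [h1, Finset.sum_sub_distrib, Finset.sum_ite_eq', Finset.mem_univ, if_true,
      sum_altSign_adj hm heven]
    change _ = PowerSeries.X * (altSign _ j * (1 - d * (ω j : PowerSeries ℤ)))
    ring
  have hdet : M.det = PowerSeries.X * (M.updateRow 0 r).det := by
    have h1 := det_updateRow_sum M 0 (altSign (PowerSeries ℤ))
    rw [hrow] at h1
    have h2 : altSign (PowerSeries ℤ) (0 : Fin (m + 1)) = 1 := by simp [altSign]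
    rw [h2, one_smul] at h1
    rw [← h1]
    exact det_updateRow_smul M 0 PowerSeries.X r
  refine ⟨⟨_, hdet⟩, ?_⟩
  rw [hdet, coeff_one_X_mul, RingHom.map_det]
  set N : Matrix (Fin (m + 1)) (Fin (m + 1)) ℤ :=
    PowerSeries.constantCoeff.mapMatrix (M.updateRow 0 r) with hN
  have hN0 : ∀ j, N 0 j = altSign ℤ j * (1 + ω j) := by
    intro j
    rw [hN, RingHom.mapMatrix_apply, map_apply, updateRow_self]
    simp [r, hd, altSign]
  have hN1 : ∀ i j, i ≠ 0 → N i j = -((if i = j then 2 else 0)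
      + (SimpleGraph.cycleGraph (m + 1)).adjMatrix ℤ i j) := by
    intro i j hi
    rw [hN, RingHom.mapMatrix_apply, map_apply, updateRow_ne hi, hM, Matrix.sub_apply,
      Matrix.sub_apply, Matrix.smul_apply, Matrix.smul_apply, one_apply, diagonal_apply,
      SimpleGraph.adjMatrix_apply, SimpleGraph.adjMatrix_apply]
    have h2 : PowerSeries.constantCoeff (2 : PowerSeries ℤ) = 2 := map_ofNat _ 2
    split_ifs <;> simp [h2]
  -- The alternating column sum vanishes outside row 0, so expansion along this column leaves a
  -- single minor, the negated path matrix.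
  let c : Fin (m + 1) → ℤ := fun i => if i = 0 then ((m + 1 + ∑ j, ω j : ℕ) : ℤ) else 0
  have hcol : (fun k => ∑ i, altSign ℤ i • N k i) = c := by
    ext1 k
    by_cases hk : k = 0
    · subst hk
      simp only [c, if_true, hN0, smul_eq_mul, ← mul_assoc, altSign_mul_self, one_mul,
        Finset.sum_add_distrib]
      simp
    · simp only [c, if_neg hk, hN1 k _ hk, smul_eq_mul, mul_neg, mul_add, Finset.sum_neg_distrib,
        Finset.sum_add_distrib]
      have h1 := sum_altSign_adj (S := ℤ) hm heven k
      simp only [(SimpleGraph.isSymm_adjMatrix (α := ℤ) _).apply k] at h1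
      rw [h1]
      simp
      ring
  have hdetN : N.det = (N.updateCol 0 c).det := by
    have h1 := det_updateCol_sum N 0 (altSign ℤ)
    have h2 : altSign ℤ (0 : Fin (m + 1)) = 1 := by simp [altSign]
    rw [hcol, h2, one_smul] at h1
    exact h1.symm
  have hsub : (N.updateCol 0 c).submatrix (Fin.succAbove 0) Fin.succ = - pathMatrix m := by
    ext i j
    rw [submatrix_apply, updateCol_ne (Fin.succ_ne_zero j), Fin.succAbove_zero,
      hN1 _ _ (Fin.succ_ne_zero i), SimpleGraph.adjMatrix_apply]
    have h1 : (SimpleGraph.cycleGraph (m + 1)).Adj i.succ j.succ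
        ↔ (i : ℕ) = j + 1 ∨ (j : ℕ) = i + 1 := by
      rw [cycleGraph_adj_iff hm]
      simp only [Fin.val_succ]
      omega
    simp only [h1, Fin.succ_inj, Matrix.neg_apply, pathMatrix, of_apply]
  rw [hdetN, det_succ_column_zero, Finset.sum_eq_single 0]
  · rw [hsub, det_neg, det_pathMatrix, updateCol_self]
    simp [c]
    ring
  · intro i _ hi
    rw [updateCol_self]
    simp [c, hi]
  · simp

variable {V : Type*} [Fintype V] [DecidableEq V] {G : SimpleGraph V} [DecidableRel G.Adj] {ℓ : ℕ}

/-- The linear coefficient of the characteristic polynomial of a bipartite sun-like graph is, up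
to sign, the number of vertices times the length of the cycle. -/
theorem exists_coeff_one_charpoly (hG : G.Connected) (hℓ : 3 ≤ ℓ) (heven : Even ℓ)
    (e : SimpleGraph.cycleGraph ℓ ≃g core G) :
    ∃ n : ℕ, (intLaplacian G).charpoly.coeff 1 = (-1) ^ n * (Fintype.card V * ℓ) := by
  obtain ⟨m, rfl⟩ := Nat.exists_eq_add_of_le' (show 1 ≤ ℓ by omega)
  -- The inverse of X - 1 is minus the geometric series.
  let d : PowerSeries ℤ := -PowerSeries.mk 1
  have hd : (PowerSeries.X - 1) * d = 1 := by
    have := PowerSeries.mk_one_mul_one_sub_eq_one ℤ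
    simp only [d]
    linear_combination this
  have hd0 : PowerSeries.constantCoeff d = -1 := by
    simp [d]
  have h1 := eval_charpoly_of_label hG hℓ e (PowerSeries.X : PowerSeries ℤ) d hd
  have h2 : (intLaplacian G).charpoly.eval₂ (Int.castRingHom (PowerSeries ℤ)) PowerSeries.X
      = ((intLaplacian G).charpoly : PowerSeries ℤ) := by
    rw [← Polynomial.eval₂_C_X_eq_coe]
    congr 1
    exact RingHom.ext_int _ _
  obtain ⟨⟨q, hq⟩, h3⟩ := coeff_one_det hℓ heven (hubWeight e) d hd0
  rw [h2] at h1
  have h4 := congrArg (PowerSeries.coeff 1) h1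
  rw [hq] at h3 h4
  rw [coeff_one_X_mul] at h3
  rw [Polynomial.coeff_coe, mul_left_comm, coeff_one_X_mul, map_mul, map_pow,
    map_sub, PowerSeries.constantCoeff_X, map_one, h3, zero_sub, sum_hubWeight hG hℓ,
    ← card_eq_add_card_leaves e] at h4
  refine ⟨Fintype.card {v : V // G.degree v = 1} + m, ?_⟩
  rw [h4, pow_add]
  push_cast
  ring

end CoeffOne

/-! ### The Green matrix of the cycle and the hub determinant. -/

section HubPoly
open Polynomial

/-- The entries of the Green matrix of a cycle, up to a common factor. -/
def greenEntry {S : Type*} [CommRing S] (s : S) {ℓ : ℕ} (i j : Fin ℓ) : S :=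
  s ^ ((i - j : Fin ℓ) : ℕ) + s ^ (ℓ - ((i - j : Fin ℓ) : ℕ))

/-- The matrix that is left after eliminating the cycle vertices without leaves. -/
def hubMatrix {S : Type*} [CommRing S] (s : S) {ℓ : ℕ} (ω : Fin ℓ → ℕ) :
    Matrix (Fin ℓ) (Fin ℓ) S :=
  ((1 - s ^ 3) * (1 - s ^ ℓ)) • (1 : Matrix (Fin ℓ) (Fin ℓ) S)
    - (s * (1 + s)) • (of (greenEntry s) * diagonal fun j => (ω j : S))

theorem greenEntry_map {S T : Type*} [CommRing S] [CommRing T] (f : S →+* T) (s : S) {ℓ : ℕ}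
    (i j : Fin ℓ) : f (greenEntry s i j) = greenEntry (f s) i j := by
  simp [greenEntry]

theorem hubMatrix_map {S T : Type*} [CommRing S] [CommRing T] (f : S →+* T) (s : S) {ℓ : ℕ}
    (ω : Fin ℓ → ℕ) : f.mapMatrix (hubMatrix s ω) = hubMatrix (f s) ω := by
  ext i j
  rw [RingHom.mapMatrix_apply, map_apply, hubMatrix, hubMatrix]
  simp only [Matrix.sub_apply, Matrix.smul_apply, smul_eq_mul, mul_diagonal, of_apply, map_sub,
    map_mul, map_pow, map_add, map_one, map_natCast, greenEntry_map, one_apply]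
  split_ifs <;> simp

/-- As a function of the distance t, both s^t and s^(ℓ-t) solve the recurrence (s + 1/s)f(t) =
f(t-1) + f(t+1). Their sum is consistent around the cycle and fails the equation only at t = 0. -/
theorem cycle_mul_green {m : ℕ} (s : ℝ) (hs : s ≠ 0) (i j : Fin (m + 3)) :
    (s + s⁻¹) * greenEntry s i j
      - ∑ l, (SimpleGraph.cycleGraph (m + 3)).adjMatrix ℝ i l * greenEntry s l j
      = if i = j then (s⁻¹ - s) * (1 - s ^ (m + 3)) else 0 := by
  have h1 : ∑ l, (SimpleGraph.cycleGraph (m + 3)).adjMatrix ℝ i l * greenEntry s l j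
      = greenEntry s (i - 1) j + greenEntry s (i + 1) j := by
    have hne : i - 1 ≠ i + 1 := by
      intro h
      have : (1 : Fin (m + 3)) + 1 = 0 := by
        rw [sub_eq_iff_eq_add, add_assoc] at h
        exact (left_eq_add.mp h)
      rw [Fin.ext_iff, Fin.val_add] at this
      simp at this
      rw [Nat.mod_eq_of_lt (by omega)] at this
      omega
    simp only [SimpleGraph.adjMatrix_apply, ite_mul, one_mul, zero_mul]
    rw [← Finset.sum_filter, ← SimpleGraph.neighborFinset_eq_filter,
      SimpleGraph.cycleGraph_neighborFinset, Finset.sum_pair hne]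
  rw [h1]
  simp only [greenEntry]
  rw [show i - 1 - j = i - j - 1 by abel, show i + 1 - j = i - j + 1 by abel]
  have hij : i = j ↔ i - j = 0 := sub_eq_zero.symm
  simp only [hij]
  generalize i - j = t
  -- When t + 1 wraps around to 0 the two summands are exchanged, so the formula without wrapping
  -- remains valid.
  have hplus : s ^ ((t + 1 : Fin (m + 3)) : ℕ) + s ^ (m + 3 - ((t + 1 : Fin (m + 3)) : ℕ))
      = s ^ ((t : ℕ) + 1) + s ^ (m + 3 - ((t : ℕ) + 1)) := by
    rcases Nat.lt_or_ge ((t : ℕ) + 1) (m + 3) with h | h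
    · rw [Fin.val_add_one_of_lt' h]
    · have ht : (t : ℕ) = m + 2 := by omega
      have : t = Fin.last (m + 2) := Fin.ext ht
      rw [this, Fin.last_add_one]
      simp only [Fin.val_zero, pow_zero, Nat.sub_zero, Fin.val_last]
      rw [show m + 2 + 1 = m + 3 from rfl, Nat.sub_self, pow_zero, add_comm]
  rw [hplus]
  by_cases h0 : t = 0
  · subst h0
    have hv : ((0 - 1 : Fin (m + 3)) : ℕ) = m + 2 := by
      rw [zero_sub, Fin.coe_neg_one]
    rw [hv, if_pos rfl]
    simp only [Fin.val_zero, Nat.sub_zero, zero_add, pow_zero, pow_one]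
    rw [show m + 3 - 1 = m + 2 by omega, show m + 3 - (m + 2) = 1 by omega, pow_succ s (m + 2)]
    field_simp
    ring
  · rw [if_neg h0]
    obtain ⟨a, ha⟩ := Nat.exists_eq_add_of_le' (show 1 ≤ (t : ℕ) from
      Nat.one_le_iff_ne_zero.mpr fun h => h0 (Fin.ext h))
    obtain ⟨c, hc⟩ := Nat.exists_eq_add_of_lt t.2
    have hv : ((t - 1 : Fin (m + 3)) : ℕ) = a := by
      rw [Fin.val_sub_one_of_ne_zero h0, ha]; rfl
    rw [hv, ha]
    rw [show m + 3 - a = c + 2 by omega, show m + 3 - (a + 1) = c + 1 by omega,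
      show m + 3 - (a + 1 + 1) = c by omega]
    field_simp
    ring

variable {V : Type*} [Fintype V] [DecidableEq V] {G : SimpleGraph V} [DecidableRel G.Adj] {ℓ : ℕ}

/-- The matrix `s + s⁻¹ - A` of a cycle with adjacency matrix `A`. -/
noncomputable def cycleResolvent (s : ℝ) (ℓ : ℕ) : Matrix (Fin ℓ) (Fin ℓ) ℝ :=
  (s + s⁻¹) • (1 : Matrix (Fin ℓ) (Fin ℓ) ℝ) - (SimpleGraph.cycleGraph ℓ).adjMatrix ℝ

theorem cycleResolvent_mul_green (hℓ : 3 ≤ ℓ) {s : ℝ} (hs : s ≠ 0) :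
    cycleResolvent s ℓ * of (greenEntry s) = ((s⁻¹ - s) * (1 - s ^ ℓ)) • 1 := by
  obtain ⟨m, rfl⟩ := Nat.exists_eq_add_of_le' hℓ
  ext i j
  rw [cycleResolvent, Matrix.sub_mul, Matrix.sub_apply, Matrix.smul_mul, Matrix.one_mul,
    Matrix.smul_apply, of_apply, smul_eq_mul, mul_apply, Matrix.smul_apply, one_apply]
  simp only [of_apply, cycle_mul_green s hs i j]
  simp

theorem eval_charpoly_mul_pow (hG : G.Connected) (hℓ : 3 ≤ ℓ)
    (e : SimpleGraph.cycleGraph ℓ ≃g core G) {s : ℝ} (hs0 : 0 < s) (hs1 : s < 1) :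
    (intLaplacian G).charpoly.eval₂ (Int.castRingHom ℝ) (s + s⁻¹ + 2)
        * ((1 - s ^ 3) * (1 - s ^ ℓ)) ^ ℓ
      = (s + s⁻¹ + 1) ^ Fintype.card {v : V // G.degree v = 1} * (cycleResolvent s ℓ).det
        * (hubMatrix s (hubWeight e)).det := by
  have hne : s ≠ 0 := hs0.ne'
  have hx : s + s⁻¹ + 2 - 1 ≠ 0 := by
    have := inv_pos.mpr hs0
    linarith
  have hℓ0 : 1 - s ^ ℓ ≠ 0 := by
    have := pow_lt_one₀ hs0.le hs1 (show ℓ ≠ 0 by omega)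
    linarith
  have h2 : 1 - s ^ 2 ≠ 0 := by
    have := pow_lt_one₀ hs0.le hs1 (show 2 ≠ 0 by norm_num)
    linarith
  have h3 : 1 - s ^ 3 ≠ 0 := by
    have := pow_lt_one₀ hs0.le hs1 (show 3 ≠ 0 by norm_num)
    linarith
  have hx' : s ^ 2 + s + 1 ≠ 0 := by positivity
  have h := eval_charpoly_of_label hG hℓ e (s + s⁻¹ + 2) (s + s⁻¹ + 2 - 1)⁻¹
    (mul_inv_cancel₀ hx)
  -- Here x = (1 + s)²/s and x - 1 = (1 + s + s²)/s. Division of x/(x - 1) by the Green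
  -- normalisation 1/s - s gives s(1 + s)/(1 - s³), whence the factors in `hubMatrix`.
  have hfac : ((1 - s ^ 3) * (1 - s ^ ℓ)) • ((s + s⁻¹ + 2 - 2) • (1 : Matrix (Fin ℓ) (Fin ℓ) ℝ)
      - (SimpleGraph.cycleGraph ℓ).adjMatrix ℝ
      - ((s + s⁻¹ + 2) * (s + s⁻¹ + 2 - 1)⁻¹) • diagonal fun j => (hubWeight e j : ℝ))
      = cycleResolvent s ℓ * hubMatrix s (hubWeight e) := by
    rw [hubMatrix, Matrix.mul_sub, Matrix.mul_smul, Matrix.mul_smul, Matrix.mul_one,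
      ← Matrix.mul_assoc, cycleResolvent_mul_green hℓ hne, smul_sub, Matrix.smul_mul,
      Matrix.one_mul, smul_smul, smul_smul, cycleResolvent, add_sub_cancel_right]
    congr 2
    have hq : s + s⁻¹ + 2 - 1 = (s ^ 2 + s + 1) / s := by field_simp; ring
    rw [hq]
    field_simp
    ring
  have hd := congrArg det hfac
  rw [det_smul, det_mul, Fintype.card_fin] at hd
  rw [h, mul_assoc, mul_comm (det _) (_ ^ ℓ), hd, ← mul_assoc]
  congr 3
  ring

theorem det_cycleResolvent_ne_zero (hℓ : 3 ≤ ℓ) {s : ℝ} (hs0 : 0 < s) (hs1 : s < 1) :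
    (cycleResolvent s ℓ).det ≠ 0 := by
  have h := congrArg det (cycleResolvent_mul_green hℓ hs0.ne')
  rw [det_mul, det_smul, det_one, mul_one] at h
  have hℓ0 : 1 - s ^ ℓ ≠ 0 := by
    have := pow_lt_one₀ hs0.le hs1 (show ℓ ≠ 0 by omega)
    linarith
  have h2 : s⁻¹ - s ≠ 0 := by
    have := (one_lt_inv₀ hs0).mpr hs1
    linarith
  intro h0
  rw [h0, zero_mul] at h
  exact pow_ne_zero _ (mul_ne_zero h2 hℓ0) h.symm

/-- The hub determinant of a sun-like graph is determined by its characteristic polynomial. -/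
theorem det_hubMatrix_eq {W : Type*} [Fintype W] [DecidableEq W] {H : SimpleGraph W}
    [DecidableRel H.Adj] (hG : G.Connected) (hH : H.Connected) (hℓ : 3 ≤ ℓ)
    (e : SimpleGraph.cycleGraph ℓ ≃g core G) (e' : SimpleGraph.cycleGraph ℓ ≃g core H)
    (hcard : Fintype.card W = Fintype.card V)
    (h : (intLaplacian H).charpoly = (intLaplacian G).charpoly) :
    (hubMatrix (X : ℤ[X]) (hubWeight e')).det = (hubMatrix (X : ℤ[X]) (hubWeight e)).det := by
  apply Polynomial.map_injective (Int.castRingHom ℝ) Int.cast_injective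
  apply Polynomial.eq_of_infinite_eval_eq
  -- All other factors in `eval_charpoly_mul_pow` are common to both graphs and nonzero for 0 < s <
  -- 1, so the two polynomials agree at infinitely many points.
  refine Set.Infinite.mono ?_ (Set.Ioo_infinite (show (0 : ℝ) < 1 by norm_num))
  rintro s ⟨hs0, hs1⟩
  have hev : ∀ ω : Fin ℓ → ℕ,
      eval s ((hubMatrix (X : ℤ[X]) ω).det.map (Int.castRingHom ℝ)) = (hubMatrix s ω).det := by
    intro ω
    rw [eval_map, ← coe_eval₂RingHom, RingHom.map_det, hubMatrix_map]
    simp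
  rw [Set.mem_ofPred_eq, hev, hev]
  have h1 := eval_charpoly_mul_pow hG hℓ e hs0 hs1
  have h2 := eval_charpoly_mul_pow hH hℓ e' hs0 hs1
  have hleaves : Fintype.card {v : W // H.degree v = 1}
      = Fintype.card {v : V // G.degree v = 1} := by
    have := card_eq_add_card_leaves e
    have := card_eq_add_card_leaves e'
    omega
  rw [h, h1, hleaves] at h2
  refine (mul_left_cancel₀ (mul_ne_zero (pow_ne_zero _ ?_) (det_cycleResolvent_ne_zero hℓ hs0 hs1))
    h2).symm
  have := inv_pos.mpr hs0
  linarith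

end HubPoly
end SunGraph

/-! ### Second-order expansion of the hub determinant. -/

namespace SunGraph
open Matrix

section HubDet

variable {S : Type*} [CommRing S] {ℓ : ℕ}

/-- Compressing the hub matrix to the hubs. -/
theorem det_hubMatrix_compress {ι : Type*} [Fintype ι] [DecidableEq ι] (s q : S)
    (hq : q * ((1 - s ^ 3) * (1 - s ^ ℓ)) = 1) (ω : Fin ℓ → ℕ) (a : ι → Fin ℓ) (w : ι → ℕ)
    (hω : ∀ j, ω j = ∑ i, if a i = j then w i else 0) :
    (hubMatrix s ω).det = ((1 - s ^ 3) * (1 - s ^ ℓ)) ^ ℓ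
      * (1 - of fun i j => s * (1 + s) * q * w i * greenEntry s (a i) (a j)).det := by
  -- The perturbation factors through the hubs, so the identity det(1 + AB) = det(1 + BA) reduces
  -- the size of the determinant.
  let A : Matrix (Fin ℓ) ι S := of fun l i => -(s * (1 + s) * q * greenEntry s l (a i))
  let B : Matrix ι (Fin ℓ) S := of fun i j => if a i = j then (w i : S) else 0
  have h1 : hubMatrix s ω = ((1 - s ^ 3) * (1 - s ^ ℓ)) • (1 + A * B) := by
    ext l j
    rw [hubMatrix, Matrix.sub_apply, Matrix.smul_apply, Matrix.smul_apply, Matrix.smul_apply,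
      Matrix.add_apply, mul_diagonal, mul_apply]
    simp only [A, B, of_apply, smul_eq_mul, mul_add, sub_eq_add_neg, hω j]
    congr 1
    push_cast
    rw [Finset.mul_sum, Finset.mul_sum, Finset.mul_sum, ← Finset.sum_neg_distrib]
    refine Finset.sum_congr rfl fun i _ => ?_
    split_ifs with h
    · rw [h]
      linear_combination (s * (1 + s) * greenEntry s l j * w i) * hq
    · simp
  have h2 : 1 + B * A = 1 - of fun i j => s * (1 + s) * q * w i * greenEntry s (a i) (a j) := by
    ext i j
    rw [Matrix.add_apply, Matrix.sub_apply, mul_apply]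
    simp only [A, B, of_apply, ite_mul, zero_mul, Finset.sum_ite_eq, Finset.mem_univ, if_true]
    ring
  rw [h1, det_smul, Fintype.card_fin, det_one_add_mul_comm, h2]

theorem greenEntry_of_le (s : S) {i j : Fin ℓ} (h : (j : ℕ) ≤ i) :
    greenEntry s i j = s ^ ((i : ℕ) - j) + s ^ (ℓ - ((i : ℕ) - j)) := by
  rw [greenEntry, Fin.coe_sub_iff_le.mpr h]

theorem greenEntry_comm (s : S) (i j : Fin ℓ) : greenEntry s i j = greenEntry s j i := by
  have key : ∀ i j : Fin ℓ, (i : ℕ) < j → greenEntry s i j = greenEntry s j i := by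
    intro i j h
    rw [greenEntry_of_le s h.le, greenEntry, Fin.coe_sub_iff_lt.mpr h, add_comm]
    congr 2 <;> omega
  rcases lt_trichotomy (i : ℕ) j with h | h | h
  · exact key i j h
  · rw [Fin.ext h]
  · exact (key j i h).symm

theorem greenEntry_self (s : S) (i : Fin ℓ) : greenEntry s i i = 1 + s ^ ℓ := by
  rw [greenEntry_of_le s le_rfl]; simp

theorem pow_dvd_greenEntry (s : S) {i j : Fin ℓ} {d : ℕ} (hij : (i : ℕ) + d ≤ j)
    (hji : (j : ℕ) + d ≤ i + ℓ) : s ^ d ∣ greenEntry s i j := by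
  rw [greenEntry_comm, greenEntry_of_le s (by omega)]
  exact dvd_add (pow_dvd_pow _ (by omega)) (pow_dvd_pow _ (by omega))

/-- If the determinants of `1 + x M` and `1 + x M'` agree, then so do the traces of the squares
of the traceless matrices `M` and `M'`, to first order. -/
theorem pow_dvd_trace_sq {ι : Type*} [Fintype ι] [DecidableEq ι] (x : S) (M M' : Matrix ι ι S)
    (hM : M.trace = 0) (hM' : M'.trace = 0) (h : (1 + x • M).det = (1 + x • M').det) :
    x ^ 3 ∣ x ^ 2 * ((M * M).trace - (M' * M').trace) := by
  have key : ∀ M : Matrix ι ι S, M.trace = 0 →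
      x ^ 3 ∣ (1 + x • M).det ^ 2 - (1 - x ^ 2 * (M * M).trace) := by
    intro M hM
    -- The linear term is the trace, which is 0, and the quadratic terms cancel. Multiplying det(1 +
    -- xM) by det(1 - xM) then gives the trace of `M * M` without division by 2.
    have h1 : x ^ 3 ∣ (1 + x • M).det - (1 + (-x) • M).det := by
      rw [det_one_add_smul x, det_one_add_smul (-x), hM]
      set f := (det (1 + (Polynomial.X : Polynomial S) • M.map Polynomial.C)).divX.divX
      obtain ⟨t, ht⟩ := f.sub_dvd_eval_sub x (-x)
      refine ⟨2 * t, ?_⟩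
      linear_combination x ^ 2 * ht
    have h2 : (1 + x • M).det * (1 + (-x) • M).det = (1 + (-x ^ 2) • (M * M)).det := by
      rw [← det_mul]
      congr 1
      rw [Matrix.add_mul, Matrix.one_mul, Matrix.mul_add, Matrix.mul_one, Matrix.smul_mul,
        Matrix.mul_smul, smul_smul, neg_smul, mul_neg, ← pow_two]
      abel
    rw [det_one_add_smul (-x ^ 2)] at h2
    obtain ⟨t, ht⟩ := h1
    rw [dvd_def]
    refine ⟨t * (1 + x • M).det + x *
      Polynomial.eval (-x ^ 2) (det (1 + (Polynomial.X : Polynomial S) •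
        (M * M).map Polynomial.C)).divX.divX, ?_⟩
    linear_combination (1 + x • M).det * ht + h2
  have h3 := dvd_sub (key M hM) (key M' hM')
  rw [h] at h3
  refine h3.trans (dvd_of_eq ?_)
  ring

end HubDet

section Series
open PowerSeries

theorem isUnit_of_constantCoeff_eq_one {f : ℤ⟦X⟧} (h : constantCoeff f = 1) : IsUnit f :=
  isUnit_iff_constantCoeff.mpr (h ▸ isUnit_one)

theorem exists_mul_hub_factor_eq_one {ℓ : ℕ} (hℓ : 1 ≤ ℓ) :
    ∃ q : ℤ⟦X⟧, q * ((1 - X ^ 3) * (1 - X ^ ℓ)) = 1 := by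
  have h : IsUnit ((1 - X ^ 3) * (1 - X ^ ℓ) : ℤ⟦X⟧) := by
    apply isUnit_of_constantCoeff_eq_one
    simp [show ℓ ≠ 0 by omega]
  obtain ⟨q, hq⟩ := h.exists_left_inv
  exact ⟨q, hq⟩

variable {ℓ : ℕ} {ι : Type*} [Fintype ι] [DecidableEq ι]

/-- The second-order term of the hub determinant. -/
theorem X_pow_dvd_sum_green_sq (hℓ : 1 ≤ ℓ) (ω ω' : Fin ℓ → ℕ) (a b : ι → Fin ℓ) (w : ι → ℕ)
    (hω : ∀ j, ω j = ∑ i, if a i = j then w i else 0)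
    (hω' : ∀ j, ω' j = ∑ i, if b i = j then w i else 0)
    (ha : ∀ i j, i ≠ j → (X ^ 4 : ℤ⟦X⟧) ∣ greenEntry X (a i) (a j))
    (hb : ∀ i j, i ≠ j → (X ^ 4 : ℤ⟦X⟧) ∣ greenEntry X (b i) (b j))
    (h : (hubMatrix (X : ℤ⟦X⟧) ω').det = (hubMatrix X ω).det) :
    ∃ r : ℤ⟦X⟧, ∃ d : ι → ℤ⟦X⟧, (∀ i, d i * (1 - r * (w i : ℤ⟦X⟧)) = 1) ∧
      X ^ 13 ∣ ∑ i, ∑ j, if i = j then 0 else d i * (w i : ℤ⟦X⟧) * (d j * (w j : ℤ⟦X⟧))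
        * (greenEntry X (a i) (a j) ^ 2 - greenEntry X (b i) (b j) ^ 2) := by
  obtain ⟨q, hq⟩ := exists_mul_hub_factor_eq_one hℓ
  -- The diagonal entries have constant term 1. Normalised by them, the rows become those of the
  -- identity plus a traceless matrix, which is divisible by X⁵: the Green entries supply X⁴ and the
  -- factor X(1 + X) one more X.
  have hD : ∀ i, ∃ d : ℤ⟦X⟧, d * (1 - X * (1 + X) * q * (1 + X ^ ℓ) * (w i : ℤ⟦X⟧)) = 1 := fun i => by
    have : IsUnit (1 - X * (1 + X) * q * (1 + X ^ ℓ) * (w i : ℤ⟦X⟧) : ℤ⟦X⟧) :=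
      isUnit_of_constantCoeff_eq_one (by simp)
    exact this.exists_left_inv
  choose d hd using hD
  refine ⟨X * (1 + X) * q * (1 + X ^ ℓ), d, hd, ?_⟩
  have key : ∀ c : ι → Fin ℓ, (∀ i j, i ≠ j → (X ^ 4 : ℤ⟦X⟧) ∣ greenEntry X (c i) (c j)) →
      ∃ M : Matrix ι ι ℤ⟦X⟧, M.trace = 0 ∧
        (1 - of fun i j => X * (1 + X) * q * (w i : ℤ⟦X⟧) * greenEntry X (c i) (c j)).det
          = (∏ i, (1 - X * (1 + X) * q * (1 + X ^ ℓ) * (w i : ℤ⟦X⟧))) * (1 + (X ^ 5 : ℤ⟦X⟧) • M).det ∧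
        X ^ 8 * (M * M).trace = ((1 + X) * q) ^ 2 * ∑ i, ∑ j, if i = j then 0 else
          d i * (w i : ℤ⟦X⟧) * (d j * (w j : ℤ⟦X⟧)) * greenEntry X (c i) (c j) ^ 2 := by
    intro c hc
    have : ∀ i j, ∃ g : ℤ⟦X⟧, i ≠ j → greenEntry X (c i) (c j) = X ^ 4 * g := fun i j => by
      by_cases hij : i = j
      · exact ⟨0, fun h => absurd hij h⟩
      · obtain ⟨g, hg⟩ := hc i j hij
        exact ⟨g, fun _ => hg⟩
    choose g hg using this
    refine ⟨of fun i j => if i = j then 0 else -((1 + X) * q * (d i * (w i : ℤ⟦X⟧)) * g i j), ?_, ?_, ?_⟩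
    · simp [trace]
    · rw [← det_diagonal, ← det_mul]
      congr 1
      ext1 i j
      rw [diagonal_mul, Matrix.add_apply, Matrix.sub_apply, Matrix.smul_apply, of_apply, of_apply,
        one_apply, smul_eq_mul]
      split_ifs with hij
      · subst hij
        rw [greenEntry_self]
        ring
      · rw [hg i j hij]
        linear_combination (X ^ 5 * (1 + X) * q * (w i : ℤ⟦X⟧) * g i j) * hd i
    · rw [trace, Finset.mul_sum, Finset.mul_sum]
      refine Finset.sum_congr rfl fun i _ => ?_
      rw [diag_apply, mul_apply, Finset.mul_sum, Finset.mul_sum]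
      refine Finset.sum_congr rfl fun j _ => ?_
      rw [of_apply, of_apply]
      by_cases hij : i = j
      · simp [hij]
      · rw [if_neg hij, if_neg (Ne.symm hij), if_neg hij, pow_two (greenEntry _ _ _)]
        nth_rewrite 2 [greenEntry_comm]
        rw [hg i j hij, hg j i (Ne.symm hij)]
        ring
  obtain ⟨M, hM0, hM1, hM2⟩ := key a ha
  obtain ⟨M', hM0', hM1', hM2'⟩ := key b hb
  rw [det_hubMatrix_compress X q hq ω a w hω, det_hubMatrix_compress X q hq ω' b w hω', hM1,
    hM1'] at h
  have hu1 : IsUnit (((1 - X ^ 3) * (1 - X ^ ℓ) : ℤ⟦X⟧) ^ ℓ) :=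
    IsUnit.pow _ (IsUnit.of_mul_eq_one_right _ hq)
  have hu2 : IsUnit (∏ i, (1 - X * (1 + X) * q * (1 + X ^ ℓ) * (w i : ℤ⟦X⟧) : ℤ⟦X⟧)) :=
    isUnit_of_constantCoeff_eq_one (by simp [map_prod])
  have h' := hu2.mul_left_cancel (hu1.mul_left_cancel h)
  have h3 := pow_dvd_trace_sq _ M M' hM0 hM0' h'.symm
  have hu3 : IsUnit (((1 + X) * q : ℤ⟦X⟧) ^ 2) :=
    (IsUnit.mul (isUnit_of_constantCoeff_eq_one (by simp)) (IsUnit.of_mul_eq_one _ hq)).pow 2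
  have h4 : (X ^ 5 : ℤ⟦X⟧) ^ 2 * ((M * M).trace - (M' * M').trace) = X ^ 2 * (((1 + X) * q) ^ 2 *
      ∑ i, ∑ j, if i = j then 0 else d i * (w i : ℤ⟦X⟧) * (d j * (w j : ℤ⟦X⟧))
        * (greenEntry X (a i) (a j) ^ 2 - greenEntry X (b i) (b j) ^ 2)) := by
    have : (∑ i, ∑ j, if i = j then 0 else d i * (w i : ℤ⟦X⟧) * (d j * (w j : ℤ⟦X⟧))
        * (greenEntry X (a i) (a j) ^ 2 - greenEntry X (b i) (b j) ^ 2))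
        = (∑ i, ∑ j, if i = j then 0 else d i * (w i : ℤ⟦X⟧) * (d j * (w j : ℤ⟦X⟧)) * greenEntry X (a i) (a j) ^ 2)
          - ∑ i, ∑ j, if i = j then 0 else
            d i * (w i : ℤ⟦X⟧) * (d j * (w j : ℤ⟦X⟧)) * greenEntry X (b i) (b j) ^ 2 := by
      simp only [← Finset.sum_sub_distrib]
      refine Finset.sum_congr rfl fun i _ => Finset.sum_congr rfl fun j _ => ?_
      split_ifs <;> ring
    rw [this]
    linear_combination X ^ 2 * hM2 - X ^ 2 * hM2'
  -- The modulus is (X⁵)³ = X¹⁵. Of the factor (X⁵)² before the traces, X⁸ is absorbed into the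
  -- squared Green entries, so X² cancels and 13 remains.
  rw [h4, ← pow_mul, show 5 * 3 = 2 + 13 from rfl, pow_add] at h3
  have h5 := (mul_dvd_mul_iff_left (pow_ne_zero 2 X_ne_zero)).mp h3
  exact (hu3.dvd_mul_left).mp h5

end Series
end SunGraph

/-! ### The hub determinant modulo 4 and distances from the 1-hub. -/

namespace SunGraph
open Matrix

section ModFour

/-- The weight function with value `1` at `z`, value `2` on `T` and value `0` elsewhere. -/
def hubFun {ℓ : ℕ} (z : Fin ℓ) (T : Finset (Fin ℓ)) (j : Fin ℓ) : ℕ :=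
  if j = z then 1 else if j ∈ T then 2 else 0

theorem hubFun_cast {S : Type*} [CommRing S] {ℓ : ℕ} {z : Fin ℓ} {T : Finset (Fin ℓ)} (hz : z ∉ T)
    (j : Fin ℓ) : (hubFun z T j : S) = (if j = z then 1 else 0) + 2 * if j ∈ T then 1 else 0 := by
  rw [hubFun]
  by_cases h1 : j = z
  · subst h1; simp [hz]
  · split_ifs <;> simp

variable {S : Type*} [CommRing S] {ℓ : ℕ}

/-- The hub determinant modulo 4. -/
theorem exists_mul_det_hubMatrix_eq (h4 : (4 : S) = 0) (s q d : S)
    (hq : q * ((1 - s ^ 3) * (1 - s ^ ℓ)) = 1)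
    (hd : d * (1 - s * (1 + s) * q * (1 + s ^ ℓ)) = 1) (z : Fin ℓ) :
    ∃ u : S, ∀ T : Finset (Fin ℓ), z ∉ T →
      u * (hubMatrix s (hubFun z T)).det = ((1 - s ^ 3) * (1 - s ^ ℓ)) ^ ℓ *
        (1 - 2 * (s * (1 + s) * q * ∑ v ∈ T, (1 + s ^ ℓ
          + d * (s * (1 + s) * q) * greenEntry s v z ^ 2))) := by
  set ρ := s * (1 + s) * q with hρ
  -- `F` is the contribution of the 1-hub. It is a multiple of an idempotent up to scaling, `F * F =
  -- (1 + s ^ ℓ) • F`, so 1 - ρF has the inverse 1 + dρF, whatever the set `T`.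
  let F : Matrix (Fin ℓ) (Fin ℓ) S := of fun i j => if j = z then greenEntry s i z else 0
  have hFF : F * F = (1 + s ^ ℓ) • F := by
    ext i j
    rw [mul_apply, Matrix.smul_apply]
    by_cases hj : j = z
    · simp only [F, of_apply, ite_mul, zero_mul, Finset.sum_ite_eq', Finset.mem_univ, if_true,
        greenEntry_self, smul_eq_mul, hj, mul_comm]
    · simp [F, hj]
  refine ⟨(1 + (d * ρ) • F).det, fun T hz => ?_⟩
  let B : Matrix (Fin ℓ) (Fin ℓ) S := of fun i j => if j ∈ T then greenEntry s i j else 0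
  have h1 : hubMatrix s (hubFun z T)
      = ((1 - s ^ 3) * (1 - s ^ ℓ)) • (1 - ρ • F - (2 * ρ) • B) := by
    ext i j
    rw [hubMatrix, Matrix.sub_apply, Matrix.smul_apply, Matrix.smul_apply, Matrix.smul_apply,
      Matrix.sub_apply, Matrix.sub_apply, Matrix.smul_apply, Matrix.smul_apply, mul_diagonal,
      hubFun_cast hz]
    simp only [F, B, of_apply, smul_eq_mul]
    have h2 : (if j = z then greenEntry s i z else 0)
        = greenEntry s i j * if j = z then 1 else 0 := by
      split_ifs with h
      · rw [h, mul_one]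
      · rw [mul_zero]
    have h3 : (if j ∈ T then greenEntry s i j else 0)
        = greenEntry s i j * if j ∈ T then 1 else 0 := by
      split_ifs <;> simp
    rw [h2, h3]
    linear_combination (s * (1 + s) * greenEntry s i j *
      ((if j = z then 1 else 0) + 2 * if j ∈ T then 1 else 0)) * hq
  have h2 : (1 + (d * ρ) • F) * (1 - ρ • F - (2 * ρ) • B)
      = 1 + (2 : S) • ((-ρ) • ((1 + (d * ρ) • F) * B)) := by
    have h3 : (1 + (d * ρ) • F) * (1 - ρ • F) = 1 := by
      rw [Matrix.mul_sub, Matrix.mul_one, Matrix.add_mul, Matrix.one_mul, Matrix.smul_mul,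
        Matrix.mul_smul, hFF, smul_smul, smul_smul]
      have : (d * ρ) • F = ρ • F + (d * ρ * ρ * (1 + s ^ ℓ)) • F := by
        rw [← add_smul]
        congr 1
        linear_combination ρ * hd
      rw [this]
      abel
    rw [Matrix.mul_sub, h3, Matrix.mul_smul, smul_smul, mul_neg, neg_smul, sub_eq_add_neg]
  have h3 : ((1 + (d * ρ) • F) * B).trace
      = ∑ v ∈ T, (1 + s ^ ℓ + d * ρ * greenEntry s v z ^ 2) := by
    have h5 : ∀ v, ((1 + (d * ρ) • F) * B) v v
        = if v ∈ T then 1 + s ^ ℓ + d * ρ * greenEntry s v z ^ 2 else 0 := by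
      intro v
      rw [Matrix.add_mul, Matrix.one_mul, Matrix.smul_mul, Matrix.add_apply, Matrix.smul_apply,
        mul_apply]
      simp only [F, B, of_apply, ite_mul, zero_mul, Finset.sum_ite_eq', Finset.mem_univ, if_true,
        greenEntry_self, greenEntry_comm s z v, smul_eq_mul]
      split_ifs
      · ring
      · simp
    rw [trace]
    simp only [diag_apply, h5, Finset.sum_ite_mem, Finset.univ_inter]
  rw [h1, det_smul, Fintype.card_fin, mul_left_comm, ← det_mul, h2, det_one_add_smul 2, trace_smul, h3]
  congr 1
  simp only [smul_eq_mul]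
  generalize Polynomial.eval (2 : S) _ = y
  -- The 2-hubs enter with weight 2, so all terms beyond the trace carry a factor 2² = 0.
  linear_combination y * h4

open PowerSeries in
/-- The hub determinant determines the parity of the number of 2-hubs at each distance from the
1-hub. -/
theorem two_mul_count_eq (z : Fin ℓ) (hz : (z : ℕ) = 0) (T T' : Finset (Fin ℓ)) (hT : z ∉ T)
    (hT' : z ∉ T') (hcard : T'.card = T.card)
    (h : (hubMatrix (Polynomial.X : Polynomial ℤ) (hubFun z T')).det
      = (hubMatrix (Polynomial.X : Polynomial ℤ) (hubFun z T)).det) (m : ℕ) :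
    ∑ v ∈ T', ((if (v : ℕ) = m then 2 else 0) + if (v : ℕ) + m = ℓ then 2 else 0 : ZMod 4)
      = ∑ v ∈ T, ((if (v : ℕ) = m then 2 else 0) + if (v : ℕ) + m = ℓ then 2 else 0) := by
  have hℓ : 1 ≤ ℓ := by have := z.2; omega
  have hmap : ∀ ω : Fin ℓ → ℕ, (hubMatrix (X : (ZMod 4)⟦X⟧) ω).det
      = Polynomial.eval₂RingHom (Int.castRingHom (ZMod 4)⟦X⟧) X
        (hubMatrix (Polynomial.X : Polynomial ℤ) ω).det := by
    intro ω
    rw [RingHom.map_det, hubMatrix_map]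
    simp
  have h1 : (hubMatrix (X : (ZMod 4)⟦X⟧) (hubFun z T')).det = (hubMatrix X (hubFun z T)).det := by
    rw [hmap, hmap, h]
  have hunit : ∀ f : (ZMod 4)⟦X⟧, constantCoeff f = 1 → IsUnit f := fun f hf =>
    isUnit_iff_constantCoeff.mpr (hf ▸ isUnit_one)
  have h4 : (4 : (ZMod 4)⟦X⟧) = 0 := by
    have : (4 : ZMod 4) = 0 := rfl
    rw [← map_ofNat (C : ZMod 4 →+* (ZMod 4)⟦X⟧) 4, this, map_zero]
  have hQ : IsUnit ((1 - X ^ 3) * (1 - X ^ ℓ) : (ZMod 4)⟦X⟧) := hunit _ (by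
    simp [show ℓ ≠ 0 by omega])
  obtain ⟨q, hq⟩ := hQ.exists_left_inv
  obtain ⟨d, hd⟩ := (hunit (1 - X * (1 + X) * q * (1 + X ^ ℓ)) (by simp)).exists_left_inv
  obtain ⟨u, hu⟩ := exists_mul_det_hubMatrix_eq h4 X q d hq hd z
  have h2 := hu T hT
  rw [← h1, hu T' hT'] at h2
  have h3 := (hQ.pow ℓ).mul_left_cancel h2
  simp only [Finset.sum_add_distrib, Finset.sum_const, hcard, ← Finset.mul_sum] at h3
  -- The contributions of single 2-hubs do not depend on their positions and cancel since the sets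
  -- have equal size; only the interaction with the 1-hub remains.
  have h5 : X ^ 2 * ((d * ((1 + X) * q) ^ 2) * (2 * ∑ v ∈ T', greenEntry X v z ^ 2))
      = X ^ 2 * ((d * ((1 + X) * q) ^ 2) * (2 * ∑ v ∈ T, greenEntry X v z ^ 2)) := by
    linear_combination -h3
  have hv : IsUnit (d * ((1 + X) * q) ^ 2) :=
    (IsUnit.of_mul_eq_one _ hd).mul (((hunit _ (by simp)).mul (IsUnit.of_mul_eq_one _ hq)).pow 2)
  have h6 := hv.mul_left_cancel (X_pow_mul_cancel h5)
  -- The cross term of the square carries the coefficient 2 · 2 = 0 modulo 4.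
  have h7 : ∀ v : Fin ℓ, PowerSeries.coeff (2 * m) (2 * greenEntry (X : (ZMod 4)⟦X⟧) v z ^ 2)
      = (if (v : ℕ) = m then 2 else 0) + if (v : ℕ) + m = ℓ then 2 else 0 := by
    intro v
    have hv := v.2
    have h8 : (2 * greenEntry (X : (ZMod 4)⟦X⟧) v z ^ 2)
        = C 2 * X ^ (2 * (v : ℕ)) + C 2 * X ^ (2 * (ℓ - v)) := by
      rw [greenEntry_of_le _ (by omega), hz, Nat.sub_zero, map_ofNat]
      linear_combination (X ^ (v : ℕ) * X ^ (ℓ - (v : ℕ))) * h4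
    rw [h8, map_add, coeff_C_mul, coeff_C_mul, coeff_X_pow, coeff_X_pow, mul_ite, mul_ite, mul_one,
      mul_zero]
    have e1 : 2 * m = 2 * (v : ℕ) ↔ (v : ℕ) = m := by omega
    have e2 : 2 * m = 2 * (ℓ - (v : ℕ)) ↔ (v : ℕ) + m = ℓ := by omega
    simp only [e1, e2]
  have h9 := congrArg (PowerSeries.coeff (2 * m)) h6
  rw [Finset.mul_sum, Finset.mul_sum, map_sum, map_sum] at h9
  simpa only [h7] using h9

end ModFour
end SunGraph

/-! ### Rigidity of the hub positions. -/

namespace SunGraph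
open Matrix

section Rigidity

theorem greenEntry_eq_of_dist {S : Type*} [CommRing S] (s : S) {ℓ : ℕ} {i j : Fin ℓ} {d : ℕ}
    (hd : d ≤ ℓ)
    (h : (i : ℕ) = j + d ∨ (j : ℕ) = i + d ∨ (i : ℕ) + ℓ = j + d ∨ (j : ℕ) + ℓ = i + d) :
    greenEntry s i j = s ^ d + s ^ (ℓ - d) := by
  have key : ∀ i j : Fin ℓ, (i : ℕ) = j + d ∨ (j : ℕ) + ℓ = i + d →
      greenEntry s i j = s ^ d + s ^ (ℓ - d) := by
    rintro i j (h | h)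
    · rw [greenEntry_of_le s (by omega), h, Nat.add_sub_cancel_left]
    · rw [greenEntry_of_le s (by omega), show (i : ℕ) - j = ℓ - d by omega,
        Nat.sub_sub_self hd, add_comm]
  rcases h with h | h | h | h
  · exact key i j (Or.inl h)
  · rw [greenEntry_comm]; exact key j i (Or.inl h)
  · rw [greenEntry_comm]; exact key j i (Or.inr h)
  · exact key i j (Or.inr h)

theorem pow_dvd_greenEntry_of_dist {S : Type*} [CommRing S] (s : S) {ℓ : ℕ} {i j : Fin ℓ} {d : ℕ}
    (h : ((i : ℕ) + d ≤ j ∧ (j : ℕ) + d ≤ i + ℓ) ∨ ((j : ℕ) + d ≤ i ∧ (i : ℕ) + d ≤ j + ℓ)) :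
    s ^ d ∣ greenEntry s i j := by
  rcases h with h | h
  · exact pow_dvd_greenEntry s h.1 h.2
  · rw [greenEntry_comm]; exact pow_dvd_greenEntry s h.1 h.2

open PowerSeries

theorem coeff_greenEntry_sq_nonneg {ℓ : ℕ} (i j : Fin ℓ) (n : ℕ) :
    0 ≤ coeff n (greenEntry (X : ℤ⟦X⟧) i j ^ 2) := by
  rw [greenEntry, show ∀ a b : ℤ⟦X⟧, (a + b) ^ 2 = a ^ 2 + b ^ 2 + (a * b + a * b) from
    fun a b => by ring]
  simp only [← pow_mul, ← pow_add, map_add, coeff_X_pow]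
  split_ifs <;> norm_num

theorem coeff_greenEntry_sq_pos {ℓ d : ℕ} {i j : Fin ℓ} (h : (i : ℕ) + d = j) :
    0 < coeff (2 * d) (greenEntry (X : ℤ⟦X⟧) i j ^ 2) := by
  have hj := j.2
  rw [greenEntry_eq_of_dist X (d := d) (by omega) (by omega),
    show ∀ a b : ℤ⟦X⟧, (a + b) ^ 2 = a ^ 2 + b ^ 2 + (a * b + a * b) from fun a b => by ring]
  simp only [← pow_mul, ← pow_add, map_add, coeff_X_pow]
  rw [if_pos (mul_comm _ _)]
  split_ifs <;> norm_num

theorem hubFun_eq_sum {ℓ k : ℕ} {z : Fin ℓ} {T : Finset (Fin ℓ)} {a : Fin (k + 1) → Fin ℓ}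
    (ha : Function.Injective a) (h0 : a 0 = z) (hT : ∀ j, j ∈ T ↔ ∃ i, i ≠ 0 ∧ a i = j) (j : Fin ℓ) :
    hubFun z T j = ∑ i, if a i = j then (if i = 0 then 1 else 2) else 0 := by
  by_cases h : ∃ i, a i = j
  · obtain ⟨i, rfl⟩ := h
    simp only [ha.eq_iff, Finset.sum_ite_eq', Finset.mem_univ, if_true]
    rw [hubFun, ← h0]
    simp only [ha.eq_iff]
    split_ifs with h1 h2
    · rfl
    · rfl
    · exact absurd ((hT _).mpr ⟨i, h1, rfl⟩) h2
  · push Not at h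
    rw [Finset.sum_eq_zero fun i _ => if_neg (h i), hubFun, if_neg (fun hj => h 0 (h0.trans hj.symm)),
      if_neg (fun hj => ?_)]
    obtain ⟨i, -, hi⟩ := (hT j).mp hj
    exact h i hi

/-- The hub positions of a nice graph, with the 1-hub at position `0`. -/
def hubPos (p : ℕ → ℕ) (i : ℕ) : ℕ := if i = 0 then 0 else p i

section
variable {p : ℕ → ℕ} {k ℓ : ℕ}

theorem hubPos_succ (hp : IsHubSequence p k) {i : ℕ} (hi : i < k) :
    hubPos p (i + 1) = hubPos p i + 4 ∨ hubPos p (i + 1) = hubPos p i + 6 := by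
  rw [hubPos, hubPos, if_neg (Nat.succ_ne_zero i)]
  split_ifs with h
  · subst h; left; rw [hp.1]
  · exact hp.2 i (by omega) hi

theorem hubPos_bounds (hp : IsHubSequence p k) {i : ℕ} (h0 : i ≠ 0) (hi : i ≤ k) :
    4 ≤ hubPos p i ∧ hubPos p i + 2 ≤ 6 * i := by
  rw [hubPos, if_neg h0]
  have := hp.bounds (show 1 ≤ i by omega) hi
  omega

theorem hubPos_add_le (hp : IsHubSequence p k) {i j : ℕ} (hij : i < j) (hj : j ≤ k) :
    hubPos p i + 4 ≤ hubPos p j := by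
  rw [hubPos, hubPos, if_neg (show j ≠ 0 by omega)]
  split_ifs with h
  · have := hp.bounds (show 1 ≤ j by omega) hj
    omega
  · have := hp.lt (show 1 ≤ i by omega) hij hj
    omega

/-- If the hub determinants agree and the 2-hubs sit at the positions `± p i`, then they are all
on the same side of the 1-hub. -/
theorem side_eq (hp : IsHubSequence p k) (hℓ : 12 * k ≤ ℓ) {z : Fin ℓ} (hz : (z : ℕ) = 0)
    {T T' : Finset (Fin ℓ)} {a b : Fin (k + 1) → Fin ℓ}
    (ha : ∀ i, (a i : ℕ) = hubPos p i) (hT : ∀ j, j ∈ T ↔ ∃ i, i ≠ 0 ∧ a i = j) (hb0 : b 0 = z)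
    (hb : ∀ i, i ≠ 0 → (b i : ℕ) = hubPos p i ∨ (b i : ℕ) + hubPos p i = ℓ)
    (hT' : ∀ j, j ∈ T' ↔ ∃ i, i ≠ 0 ∧ b i = j)
    (h : (hubMatrix (X : ℤ⟦X⟧) (hubFun z T')).det = (hubMatrix X (hubFun z T)).det)
    {i j : Fin (k + 1)} (hi0 : i ≠ 0) (hij : (j : ℕ) = i + 1) :
    (b i : ℕ) = hubPos p i ↔ (b j : ℕ) = hubPos p j := by
  have hval : ∀ i : Fin (k + 1), (i : ℕ) ≤ k := fun i => Nat.lt_succ_iff.mp i.2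
  have hne0 : ∀ i : Fin (k + 1), i ≠ 0 → (i : ℕ) ≠ 0 := fun i hi h => hi (Fin.ext h)
  have hP0 : hubPos p 0 = 0 := if_pos rfl
  have hbd : ∀ i : Fin (k + 1), i ≠ 0 → 4 ≤ hubPos p i ∧ hubPos p i + 2 ≤ 6 * i :=
    fun i hi => hubPos_bounds hp (hne0 i hi) (hval i)
  have hsep : ∀ i j : Fin (k + 1), (i : ℕ) < j → hubPos p i + 4 ≤ hubPos p j :=
    fun i j hij => hubPos_add_le hp hij (hval j)
  have hlt : ∀ i j : Fin (k + 1), i ≠ j → (i : ℕ) < j ∨ (j : ℕ) < i := fun i j hij => by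
    rw [← Fin.lt_def, ← Fin.lt_def]; exact lt_or_gt_of_ne hij
  have hsum : ∀ i j : Fin (k + 1), i ≠ 0 → j ≠ 0 → i ≠ j →
      hubPos p i + hubPos p j + 10 ≤ ℓ := fun i j hi hj hij => by
    have h1 := hbd i hi
    have h2 := hbd j hj
    have h3 := hval i
    have h4 := hval j
    have h5 := hlt i j hij
    omega
  have ha0 : a 0 = z := Fin.ext (by rw [ha, hz]; exact hP0)
  have hb0' : (b 0 : ℕ) = 0 := by rw [hb0, hz]
  have h1 : 1 ≤ ℓ := by have := z.2; omega
  have hsepa : ∀ i j, i ≠ j → (X ^ 4 : ℤ⟦X⟧) ∣ greenEntry X (a i) (a j) := fun i j hij => by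
    apply pow_dvd_greenEntry_of_dist
    have h3 := hval i
    have h4 := hval j
    rw [ha, ha]
    rcases hlt i j hij with hlt | hlt
    · have h1 := hsep i j hlt
      have h2 := hbd j (fun h => by simp [h] at hlt)
      omega
    · have h1 := hsep j i hlt
      have h2 := hbd i (fun h => by simp [h] at hlt)
      omega
  have hsepb : ∀ i j, i ≠ j → (X ^ 4 : ℤ⟦X⟧) ∣ greenEntry X (b i) (b j) := fun i j hij => by
    apply pow_dvd_greenEntry_of_dist
    have h3 := hval i
    have h4 := hval j
    by_cases hi : i = 0
    · subst hi
      have h5 := hb j (Ne.symm hij)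
      have h6 := hbd j (Ne.symm hij)
      omega
    · have h5 := hb i hi
      have h6 := hbd i hi
      by_cases hj : j = 0
      · subst hj
        omega
      · have h7 := hb j hj
        have h8 := hbd j hj
        have h9 := hsum i j hi hj hij
        rcases hlt i j hij with hlt | hlt
        · have h1 := hsep i j hlt
          omega
        · have h1 := hsep j i hlt
          omega
  have hinja : Function.Injective a := fun i j hij => by
    by_contra hne
    have : (a i : ℕ) = a j := by rw [hij]
    rw [ha, ha] at this
    rcases hlt i j hne with hlt | hlt
    · have := hsep i j hlt; omega
    · have := hsep j i hlt; omega
  have hinjb : Function.Injective b := fun i j hij => by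
    by_contra hne
    have heq : (b i : ℕ) = b j := by rw [hij]
    by_cases hi : i = 0
    · subst hi
      have h5 := hb j (Ne.symm hne)
      have h6 := hbd j (Ne.symm hne)
      have := hval j
      omega
    · have h5 := hb i hi
      have h6 := hbd i hi
      have := hval i
      by_cases hj : j = 0
      · subst hj
        omega
      · have h7 := hb j hj
        have h9 := hsum i j hi hj hne
        rcases hlt i j hne with hlt | hlt
        · have h1 := hsep i j hlt
          omega
        · have h1 := hsep j i hlt
          omega
  obtain ⟨r, d, hd, hdvd⟩ := X_pow_dvd_sum_green_sq h1 _ _ a b _ (hubFun_eq_sum hinja ha0 hT)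
    (hubFun_eq_sum hinjb hb0 hT') hsepa hsepb h
  -- Distances to the 1-hub agree in both configurations, and so do distances within one side; only
  -- pairs of 2-hubs on opposite sides can differ.
  have heq : ∀ i j, i = 0 ∨ j = 0 →
      greenEntry (X : ℤ⟦X⟧) (a i) (a j) = greenEntry X (b i) (b j) := by
    have key : ∀ j, greenEntry (X : ℤ⟦X⟧) (a 0) (a j) = greenEntry X (b 0) (b j) := by
      intro j
      by_cases hj : j = 0
      · rw [hj, ha0, hb0]
      · have h5 := hb j hj
        have h6 := hbd j hj
        have h3 := hval j
        rw [greenEntry_eq_of_dist X (d := hubPos p j) (by omega) (by rw [ha, ha]; simp [hP0]),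
          greenEntry_eq_of_dist X (d := hubPos p j) (by omega) (by omega)]
    rintro i j (rfl | rfl)
    · exact key j
    · rw [greenEntry_comm, key, greenEntry_comm]
  have hsame : ∀ i j, i ≠ 0 → j ≠ 0 →
      ((b i : ℕ) = hubPos p i ↔ (b j : ℕ) = hubPos p j) →
      greenEntry (X : ℤ⟦X⟧) (a i) (a j) = greenEntry X (b i) (b j) := by
    have key : ∀ i j : Fin (k + 1), (i : ℕ) < j → i ≠ 0 → j ≠ 0 →
        ((b i : ℕ) = hubPos p i ↔ (b j : ℕ) = hubPos p j) →
        greenEntry (X : ℤ⟦X⟧) (a i) (a j) = greenEntry X (b i) (b j) := by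
      intro i j hij hi hj hs
      have h5 := hb i hi
      have h6 := hb j hj
      have h7 := hsep i j hij
      have h8 := ha i
      have h9 := ha j
      have h10 := (a j).2
      rw [greenEntry_eq_of_dist X (d := hubPos p j - hubPos p i) (by omega) (by omega),
        greenEntry_eq_of_dist X (d := hubPos p j - hubPos p i) (by omega) (by omega)]
    intro i j hi hj hs
    by_cases hij : i = j
    · subst hij; rw [greenEntry_self, greenEntry_self]
    · rcases hlt i j hij with h | h
      · exact key i j h hi hj hs
      · rw [greenEntry_comm, key j i h hj hi hs.symm, greenEntry_comm]
  -- On opposite sides the distance is `hubPos p i + hubPos p j` one way and at least 10 the other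
  -- way. Both exceed 6, so the squared entry has no terms below degree 13.
  have hopp : ∀ i j, i ≠ 0 → j ≠ 0 →
      ¬ ((b i : ℕ) = hubPos p i ↔ (b j : ℕ) = hubPos p j) →
      (X ^ 13 : ℤ⟦X⟧) ∣ greenEntry X (b i) (b j) ^ 2 := by
    intro i j hi hj hs
    have hij : i ≠ j := fun h => hs (by rw [h])
    have h5 := hb i hi
    have h6 := hb j hj
    have h7 := hbd i hi
    have h8 := hbd j hj
    have h9 := hsum i j hi hj hij
    have h10 := hlt i j hij
    have h11 : hubPos p i + hubPos p j ≥ 8 := by omega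
    have : (X ^ 7 : ℤ⟦X⟧) ∣ greenEntry X (b i) (b j) := by
      apply pow_dvd_greenEntry_of_dist
      omega
    have h12 := pow_dvd_pow_of_dvd this 2
    rw [← pow_mul] at h12
    exact (pow_dvd_pow _ (by norm_num)).trans h12
  -- Pairs with the 1-hub cancel, and all 2-hubs have the same unit d = 1/(1 - 2r). Multiplication
  -- by (1 - 2r)² leaves the constant weight 2 · 2 = 4.
  have hdvd2 : (X ^ 13 : ℤ⟦X⟧) ∣ ∑ i, ∑ j, if i = j then 0 else 4 *
      (greenEntry X (a i) (a j) ^ 2 - greenEntry X (b i) (b j) ^ 2) := by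
    have h2 : (X ^ 13 : ℤ⟦X⟧) ∣ (∑ i, ∑ j, if i = j then 0 else 4 *
      (greenEntry X (a i) (a j) ^ 2 - greenEntry X (b i) (b j) ^ 2)) - (1 - r * 2) ^ 2 *
        ∑ i, ∑ j, if i = j then 0 else
          d i * ((if i = 0 then 1 else 2 : ℕ) : ℤ⟦X⟧) * (d j * ((if j = 0 then 1 else 2 : ℕ) : ℤ⟦X⟧))
            * (greenEntry X (a i) (a j) ^ 2 - greenEntry X (b i) (b j) ^ 2) := by
      simp only [Finset.mul_sum, ← Finset.sum_sub_distrib]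
      refine Finset.dvd_sum fun i _ => Finset.dvd_sum fun j _ => ?_
      by_cases hij : i = j
      · simp [hij]
      by_cases h0 : i = 0 ∨ j = 0
      · simp [hij, heq i j h0]
      · push Not at h0
        rw [if_neg hij, if_neg hij, if_neg h0.1, if_neg h0.2]
        have h3 := hd i
        have h4 := hd j
        rw [if_neg h0.1] at h3
        rw [if_neg h0.2] at h4
        push_cast at h3 h4 ⊢
        refine ⟨0, ?_⟩
        linear_combination (-4 * (greenEntry X (a i) (a j) ^ 2 - greenEntry X (b i) (b j) ^ 2)) *
          ((d j * (1 - r * 2)) * h3 + h4)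
    exact (dvd_sub_comm.mp h2 |> fun h => (dvd_sub_right (hdvd.mul_left _)).mp h)
  by_contra hs
  have hj0 : j ≠ 0 := fun h => by simp [h] at hij
  have hnonneg : ∀ n < 13, ∀ i j, 0 ≤ coeff n (if i = j then 0 else 4 *
      (greenEntry (X : ℤ⟦X⟧) (a i) (a j) ^ 2 - greenEntry X (b i) (b j) ^ 2)) := by
    intro n hn i j
    split_ifs with hij
    · simp
    · rw [← map_ofNat (C : ℤ →+* ℤ⟦X⟧) 4, coeff_C_mul, map_sub]
      by_cases h0 : i = 0 ∨ j = 0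
      · simp [heq i j h0]
      · push Not at h0
        by_cases hs : (b i : ℕ) = hubPos p i ↔ (b j : ℕ) = hubPos p j
        · simp [hsame i j h0.1 h0.2 hs]
        · rw [X_pow_dvd_iff.mp (hopp i j h0.1 h0.2 hs) n hn, sub_zero]
          exact mul_nonneg (by norm_num) (coeff_greenEntry_sq_nonneg _ _ _)
  have hstep := hubPos_succ hp (show (i : ℕ) < k by have := hval j; omega)
  rw [← hij] at hstep
  set δ := hubPos p j - hubPos p i with hδ
  have hδ6 : 2 * δ < 13 := by omega
  -- Below degree 13 every coefficient is nonnegative, and a consecutive pair that is separated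
  -- contributes positively in degree 2δ, which is 8 or 12. The total would not vanish.
  have hpos : 0 < coeff (2 * δ) (if i = j then 0 else 4 *
      (greenEntry (X : ℤ⟦X⟧) (a i) (a j) ^ 2 - greenEntry X (b i) (b j) ^ 2)) := by
    rw [if_neg (fun h => by rw [h] at hij; omega), ← map_ofNat (C : ℤ →+* ℤ⟦X⟧) 4, coeff_C_mul,
      map_sub, X_pow_dvd_iff.mp (hopp i j hi0 hj0 hs) _ hδ6, sub_zero]
    exact mul_pos (by norm_num) (coeff_greenEntry_sq_pos (by rw [ha, ha]; omega))
  have hzero := X_pow_dvd_iff.mp hdvd2 _ hδ6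
  rw [map_sum] at hzero
  simp only [map_sum] at hzero
  refine absurd hzero (ne_of_gt ?_)
  refine Finset.sum_pos' (fun i _ => Finset.sum_nonneg fun j _ => hnonneg _ hδ6 i j)
    ⟨i, Finset.mem_univ _, ?_⟩
  exact Finset.sum_pos' (fun j _ => hnonneg _ hδ6 i j) ⟨j, Finset.mem_univ _, hpos⟩

/-- The hub determinant determines the positions of the 2-hubs up to reflection. -/
theorem mem_iff_of_det_hubMatrix_eq (hk : 1 ≤ k) (hp : IsHubSequence p k) (hℓ : 12 * k ≤ ℓ)
    {z : Fin ℓ} (hz : (z : ℕ) = 0) {T T' : Finset (Fin ℓ)}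
    (hT : ∀ j : Fin ℓ, j ∈ T ↔ ∃ i, 1 ≤ i ∧ i ≤ k ∧ (j : ℕ) = p i) (hT' : z ∉ T')
    (hcard : T'.card = k)
    (h : (hubMatrix (Polynomial.X : Polynomial ℤ) (hubFun z T')).det
      = (hubMatrix (Polynomial.X : Polynomial ℤ) (hubFun z T)).det) :
    (∀ j : Fin ℓ, j ∈ T' ↔ j ∈ T) ∨
      ∀ j : Fin ℓ, j ∈ T' ↔ ∃ i, 1 ≤ i ∧ i ≤ k ∧ (j : ℕ) + p i = ℓ := by
  have hbd : ∀ i, 1 ≤ i → i ≤ k → 4 ≤ p i ∧ 2 * p i < ℓ := fun i h1 h2 => by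
    have := hp.bounds h1 h2
    omega
  have hinj : ∀ i j, 1 ≤ i → i ≤ k → 1 ≤ j → j ≤ k → p i = p j → i = j := by
    intro i j hi1 hik hj1 hjk hij
    rcases lt_trichotomy i j with h | h | h
    · have := hp.lt hi1 h hjk; omega
    · exact h
    · have := hp.lt hj1 h hik; omega
  have hval : ∀ i : Fin (k + 1), (i : ℕ) ≤ k := fun i => Nat.lt_succ_iff.mp i.2
  have hne0 : ∀ i : Fin (k + 1), i ≠ 0 → 1 ≤ (i : ℕ) := fun i hi =>
    Nat.one_le_iff_ne_zero.mpr fun h => hi (Fin.ext h)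
  have hposlt : ∀ i : Fin (k + 1), hubPos p i < ℓ := fun i => by
    rw [hubPos]
    split_ifs with hi
    · omega
    · have := hbd i (by omega) (hval i)
      omega
  have hP : ∀ i : Fin (k + 1), i ≠ 0 → hubPos p i = p i := fun i hi =>
    if_neg fun h => hi (Fin.ext h)
  let a : Fin (k + 1) → Fin ℓ := fun i => ⟨hubPos p i, hposlt i⟩
  have ha : ∀ i, (a i : ℕ) = hubPos p i := fun i => rfl
  have haT : ∀ j, j ∈ T ↔ ∃ i, i ≠ 0 ∧ a i = j := by
    intro j
    rw [hT]
    constructor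
    · rintro ⟨i, hi1, hik, hij⟩
      have hi0 : (⟨i, by omega⟩ : Fin (k + 1)) ≠ 0 := fun h => by
        have := Fin.ext_iff.mp h
        simp at this
        omega
      exact ⟨⟨i, by omega⟩, hi0, Fin.ext (by rw [ha, hP _ hi0, hij])⟩
    · rintro ⟨i, hi, rfl⟩
      exact ⟨i, hne0 i hi, hval i, by rw [ha, hP i hi]⟩
  have hzT : z ∉ T := fun hzT => by
    obtain ⟨i, h1, h2, h3⟩ := (hT z).mp hzT
    have := hbd i h1 h2
    omega
  have hainj : ∀ i j, i ≠ 0 → j ≠ 0 → a i = a j → i = j := fun i j hi hj hij => by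
    have h1 := Fin.ext_iff.mp hij
    rw [ha, ha, hP i hi, hP j hj] at h1
    exact Fin.ext (hinj i j (hne0 i hi) (hval i) (hne0 j hj) (hval j) h1)
  have herase : (Finset.univ.erase (0 : Fin (k + 1))).card = k := by
    rw [Finset.card_erase_of_mem (Finset.mem_univ _), Finset.card_univ, Fintype.card_fin]
    rfl
  have hTcard : T.card = k := by
    have : T = (Finset.univ.erase (0 : Fin (k + 1))).image a := by
      ext j
      simp [haT]
    rw [this, Finset.card_image_of_injOn, herase]
    intro i hi j hj hij
    exact hainj i j (Finset.ne_of_mem_erase hi) (Finset.ne_of_mem_erase hj) hij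
  have hex : ∀ i : Fin (k + 1), i ≠ 0 →
      ∃ v ∈ T', (v : ℕ) = hubPos p i ∨ (v : ℕ) + hubPos p i = ℓ := by
    intro i hi
    have hbi := hbd i (hne0 i hi) (hval i)
    rw [hP i hi]
    by_contra! hno
    -- In `T` exactly one hub lies at distance `p i` from the 1-hub, contributing 2 ≠ 0 modulo 4, so
    -- `T'` cannot have none there.
    have h1 := two_mul_count_eq z hz T T' hzT hT' (hcard.trans hTcard.symm) h (p i)
    rw [Finset.sum_eq_zero fun v hv => by
      rw [if_neg (hno v hv).1, if_neg (hno v hv).2, add_zero]] at h1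
    rw [Finset.sum_eq_single (a i)] at h1
    · rw [ha, hP i hi, if_pos rfl, if_neg (by omega)] at h1
      exact absurd h1 (by decide)
    · intro v hv hne
      obtain ⟨j, hj1, hjk, hj⟩ := (hT v).mp hv
      have hbj := hbd j hj1 hjk
      rw [if_neg, if_neg (by omega), add_zero]
      intro hvi
      exact hne (Fin.ext (by rw [ha, hP i hi, hvi]))
    · intro hni
      exact absurd ((haT _).mpr ⟨i, hi, rfl⟩) hni
  have hex' : ∀ i : Fin (k + 1), ∃ v : Fin ℓ, (i = 0 → v = z) ∧
      (i ≠ 0 → v ∈ T' ∧ ((v : ℕ) = hubPos p i ∨ (v : ℕ) + hubPos p i = ℓ)) := by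
    intro i
    by_cases hi : i = 0
    · exact ⟨z, fun _ => rfl, fun h => absurd hi h⟩
    · obtain ⟨v, hv, hv'⟩ := hex i hi
      exact ⟨v, fun h => absurd h hi, fun _ => ⟨hv, hv'⟩⟩
  choose b hb0 hb using hex'
  have hbinj : ∀ i j, i ≠ 0 → j ≠ 0 → b i = b j → i = j := fun i j hi hj hij => by
    have h1 := (hb i hi).2
    have h2 := (hb j hj).2
    rw [hij] at h1
    rw [hP i hi] at h1
    rw [hP j hj] at h2
    have h3 := hbd i (hne0 i hi) (hval i)
    have h4 := hbd j (hne0 j hj) (hval j)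
    exact Fin.ext (hinj i j (hne0 i hi) (hval i) (hne0 j hj) (hval j) (by omega))
  -- The k hubs found at distinct distances exhaust `T'`, which has k elements.
  have hbT : ∀ j, j ∈ T' ↔ ∃ i, i ≠ 0 ∧ b i = j := by
    have : (Finset.univ.erase (0 : Fin (k + 1))).image b = T' := by
      apply Finset.eq_of_subset_of_card_le
      · intro v hv
        obtain ⟨i, hi, rfl⟩ := Finset.mem_image.mp hv
        exact (hb i (Finset.ne_of_mem_erase hi)).1
      · rw [Finset.card_image_of_injOn, herase, hcard]
        intro i hi j hj hij
        exact hbinj i j (Finset.ne_of_mem_erase hi) (Finset.ne_of_mem_erase hj) hij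
    intro j
    simp [← this]
  have hps : (hubMatrix (X : ℤ⟦X⟧) (hubFun z T')).det = (hubMatrix X (hubFun z T)).det := by
    have hmap : ∀ ω : Fin ℓ → ℕ, (hubMatrix (X : ℤ⟦X⟧) ω).det
        = Polynomial.coeToPowerSeries.ringHom
          (hubMatrix (Polynomial.X : Polynomial ℤ) ω).det := by
      intro ω
      rw [RingHom.map_det, hubMatrix_map]
      simp
    rw [hmap, hmap, h]
  have hside : ∀ n, ∀ i : Fin (k + 1), (i : ℕ) = n + 1 →
      ((b ⟨1, by omega⟩ : ℕ) = hubPos p 1 ↔ (b i : ℕ) = hubPos p i) := by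
    intro n
    induction n with
    | zero =>
      intro i hi
      have : i = ⟨1, by omega⟩ := Fin.ext hi
      rw [this]
    | succ n ih =>
      intro i hi
      have hlt := i.2
      refine (ih ⟨n + 1, by omega⟩ rfl).trans ?_
      exact side_eq hp hℓ hz ha haT (hb0 0 rfl) (fun i hi => (hb i hi).2) hbT hps
        (fun h => by simpa using Fin.ext_iff.mp h) hi
  by_cases hs : (b ⟨1, by omega⟩ : ℕ) = hubPos p 1
  · left
    intro j
    have hab : ∀ i, i ≠ 0 → b i = a i := fun i hi => by
      have := hne0 i hi
      exact Fin.ext ((hside (i - 1) i (by omega)).mp hs)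
    rw [hbT, haT]
    exact exists_congr fun i => and_congr_right fun hi => by rw [hab i hi]
  · right
    intro j
    have hab : ∀ i, i ≠ 0 → (b i : ℕ) + p i = ℓ := fun i hi => by
      have h1 := hne0 i hi
      have h2 := (hb i hi).2.resolve_left fun h => hs ((hside (i - 1) i (by omega)).mpr h)
      rwa [hP i hi] at h2
    rw [hbT]
    constructor
    · rintro ⟨i, hi, rfl⟩
      exact ⟨i, hne0 i hi, hval i, hab i hi⟩
    · rintro ⟨i, hi1, hik, hij⟩
      have hi0 : (⟨i, by omega⟩ : Fin (k + 1)) ≠ 0 := fun h => by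
        have := Fin.ext_iff.mp h
        simp at this
        omega
      refine ⟨_, hi0, Fin.ext ?_⟩
      have := hab _ hi0
      simp only at this
      omega

end

end Rigidity
end SunGraph

/-! ### Symmetries of the cycle, and isomorphism from equal leaf counts. -/

namespace SunGraph
open Matrix

section Relabel

theorem exists_cycle_shift {ℓ : ℕ} (hℓ : 3 ≤ ℓ) (z c : Fin ℓ) (hz : (z : ℕ) = 0) :
    ∃ φ : SimpleGraph.cycleGraph ℓ ≃g SimpleGraph.cycleGraph ℓ, φ z = c := by
  obtain ⟨m, rfl⟩ := Nat.exists_eq_add_of_le' hℓ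
  refine ⟨⟨Equiv.addRight c, ?_⟩, ?_⟩
  · intro i j
    simp only [SimpleGraph.cycleGraph_adj, Equiv.coe_addRight, add_sub_add_right_eq_sub]
  · have : z = 0 := Fin.ext hz
    change z + c = c
    rw [this, zero_add]

theorem exists_cycle_reflection {ℓ : ℕ} (hℓ : 3 ≤ ℓ) :
    ∃ φ : SimpleGraph.cycleGraph ℓ ≃g SimpleGraph.cycleGraph ℓ,
      ∀ j : Fin ℓ, ((j : ℕ) = 0 ∧ (φ j : ℕ) = 0) ∨ ((j : ℕ) ≠ 0 ∧ (φ j : ℕ) + j = ℓ) := by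
  obtain ⟨m, rfl⟩ := Nat.exists_eq_add_of_le' hℓ
  refine ⟨⟨Equiv.neg _, ?_⟩, fun j => ?_⟩
  · intro i j
    simp only [SimpleGraph.cycleGraph_adj, Equiv.neg_apply]
    rw [show -i - -j = j - i by abel, show -j - -i = i - j by abel, or_comm]
  · change ((j : ℕ) = 0 ∧ ((-j : Fin (m + 3)) : ℕ) = 0)
      ∨ ((j : ℕ) ≠ 0 ∧ ((-j : Fin (m + 3)) : ℕ) + j = m + 3)
    rw [Fin.val_neg']
    by_cases hj : (j : ℕ) = 0
    · left; simp [hj]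
    · right
      refine ⟨hj, ?_⟩
      have := j.2
      rw [Nat.mod_eq_of_lt (by omega)]
      omega

variable {V W : Type*} [Fintype V] [DecidableEq V] [Fintype W] [DecidableEq W]
  {G : SimpleGraph V} [DecidableRel G.Adj] {H : SimpleGraph W} [DecidableRel H.Adj] {ℓ : ℕ}

theorem hubWeight_trans (e : SimpleGraph.cycleGraph ℓ ≃g core G)
    (φ : SimpleGraph.cycleGraph ℓ ≃g SimpleGraph.cycleGraph ℓ) (j : Fin ℓ) :
    hubWeight (φ.trans e) j = hubWeight e (φ j) := rfl

theorem card_leaves_at (hℓ : 3 ≤ ℓ) (e : SimpleGraph.cycleGraph ℓ ≃g core G) {b : V → Fin ℓ}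
    (hb : ∀ v, G.degree v = 1 → ∀ w, G.Adj v w ↔ w = e (b v)) (i : Fin ℓ) :
    Fintype.card {u : {v : V // G.degree v = 1} // b u = i} = hubWeight e i := by
  rw [hubWeight_eq_sum hℓ e hb, Fintype.card_subtype, Finset.card_filter]

/-- Sun-like graphs whose labelled cycles carry the same numbers of leaves are isomorphic. -/
theorem nonempty_iso_of_hubWeight_eq (hG : G.Connected) (hH : H.Connected) (hℓ : 3 ≤ ℓ)
    (e : SimpleGraph.cycleGraph ℓ ≃g core G) (e' : SimpleGraph.cycleGraph ℓ ≃g core H)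
    (h : ∀ j, hubWeight e' j = hubWeight e j) : Nonempty (H ≃g G) := by
  obtain ⟨b, -, hb⟩ := exists_base hG hℓ e
  obtain ⟨b', -, hb'⟩ := exists_base hH hℓ e'
  -- Leaves are matched separately over each cycle vertex, so the resulting bijection respects base
  -- points and hence adjacency.
  have hfib : ∀ i, Nonempty ({u : {v : W // H.degree v = 1} // b' u = i}
      ≃ {u : {v : V // G.degree v = 1} // b u = i}) := fun i => by
    rw [← Fintype.card_eq, card_leaves_at hℓ e hb, card_leaves_at hℓ e' hb', h]
  let f := fun i => (hfib i).some
  let F : {v : W // H.degree v = 1} ≃ {v : V // G.degree v = 1} :=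
    (Equiv.sigmaFiberEquiv fun u : {v : W // H.degree v = 1} => b' u).symm.trans
      ((Equiv.sigmaCongrRight f).trans
        (Equiv.sigmaFiberEquiv fun u : {v : V // G.degree v = 1} => b u))
  have hF : ∀ u, b (F u) = b' u := fun u => (f (b' u) ⟨u, rfl⟩).2
  have hcyc : ∀ (i : Fin ℓ) (u : {v : W // H.degree v = 1}),
      G.Adj (F u) (e i) ↔ H.Adj u (e' i) := fun i u => by
    rw [hb _ (F u).2, hb' _ u.2, hF]
    constructor
    · intro h; rw [e.injective (Subtype.ext h)]
    · intro h; rw [e'.injective (Subtype.ext h)]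
  have hleafG : ∀ u v : {v : V // G.degree v = 1}, ¬ G.Adj (u : V) v := fun u v huv =>
    degree_ne_one_of_adj_leaf hG ⟨e ⟨0, by omega⟩, (e ⟨0, by omega⟩).2⟩ huv u.2 v.2
  have hleafH : ∀ u v : {v : W // H.degree v = 1}, ¬ H.Adj (u : W) v := fun u v huv =>
    degree_ne_one_of_adj_leaf hH ⟨e' ⟨0, by omega⟩, (e' ⟨0, by omega⟩).2⟩ huv u.2 v.2
  let K := Equiv.sumCongr (Equiv.refl (Fin ℓ)) F
  have hK : ∀ x y, G.Adj (labelEquiv e (K x)) (labelEquiv e (K y))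
      ↔ H.Adj (labelEquiv e' x) (labelEquiv e' y) := by
    rintro (i | u) (j | v)
    · change G.Adj (e i) (e j) ↔ H.Adj (e' i) (e' j)
      rw [adj_label_iff, adj_label_iff]
    · change G.Adj (e i) (F v) ↔ H.Adj (e' i) v
      rw [G.adj_comm, H.adj_comm, hcyc]
    · exact hcyc j u
    · exact iff_of_false (hleafG _ _) (hleafH _ _)
  refine ⟨⟨(labelEquiv e').symm.trans (K.trans (labelEquiv e)), ?_⟩⟩
  intro x y
  obtain ⟨x, rfl⟩ := (labelEquiv e').surjective x
  obtain ⟨y, rfl⟩ := (labelEquiv e').surjective y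
  simpa using hK x y

end Relabel
end SunGraph

/-! ### Assembly of the spectral argument. -/

namespace SunGraph
open Matrix

section Spectral

variable {V : Type*} [Fintype V] [DecidableEq V] {G : SimpleGraph V} [DecidableRel G.Adj] {ℓ : ℕ}

theorem det_intLaplacian_eq_zero [Nonempty V] {σ : V → ℤ} (hσ : IsSignColoring G σ) :
    (intLaplacian G).det = 0 := by
  refine exists_mulVec_eq_zero_iff.mp ⟨σ, fun h => ?_, ?_⟩
  · obtain ⟨v⟩ := ‹Nonempty V›
    have := hσ.1 v
    rw [h] at this
    simp at this
  · ext v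
    rw [mulVec, dotProduct, Pi.zero_apply]
    have h1 : ∀ w, intLaplacian G v w * σ w
        = (if v = w then (G.degree v : ℤ) * σ v else 0) + if G.Adj v w then -σ v else 0 := by
      intro w
      rw [intLaplacian_apply]
      by_cases hvw : v = w
      · subst hvw; simp
      · by_cases ha : G.Adj v w
        · simp [hvw, ha, hσ.2 v w ha]
        · simp [hvw, ha]
    simp only [h1, Finset.sum_add_distrib, Finset.sum_ite_eq, Finset.mem_univ, if_true]
    rw [← Finset.sum_filter, ← SimpleGraph.neighborFinset_eq_filter, Finset.sum_const,
      SimpleGraph.card_neighborFinset_eq_degree]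
    simp

theorem degCount_eq_sum_hubWeight (hℓ : 3 ≤ ℓ) (e : SimpleGraph.cycleGraph ℓ ≃g core G) (i : ℕ) :
    degCount G (i + 2) = ∑ j, if hubWeight e j = i then 1 else 0 := by
  rw [degCount, ← (labelEquiv e).sum_comp, Fintype.sum_sum_type]
  have h1 : ∀ u : {v : V // G.degree v = 1},
      (if G.degree (labelEquiv e (Sum.inr u)) = i + 2 then (1 : ℤ) else 0) = 0 := fun u => by
    rw [labelEquiv_inr, u.2, if_neg (by omega)]
  rw [Finset.sum_congr rfl fun u _ => h1 u, Finset.sum_const_zero, add_zero]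
  refine Finset.sum_congr rfl fun j _ => ?_
  have h2 := hubWeight_cast hℓ e j
  have h3 : G.degree (e j : V) = i + 2 ↔ hubWeight e j = i := by omega
  exact if_congr h3 rfl rfl

/-- There is exactly one 1-hub, and a rotation of the labelling moves it to `z`. -/
theorem exists_label_hubFun {k : ℕ} (hℓ : 3 ≤ ℓ) (e : SimpleGraph.cycleGraph ℓ ≃g core G)
    (hdeg : ∀ v, G.degree v ≤ 4) (h3 : degCount G 3 = 1) (h4 : degCount G 4 = k) (z : Fin ℓ)
    (hz : (z : ℕ) = 0) :
    ∃ (e' : SimpleGraph.cycleGraph ℓ ≃g core G) (T : Finset (Fin ℓ)),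
      z ∉ T ∧ T.card = k ∧ hubWeight e' = hubFun z T := by
  rw [show 3 = 1 + 2 from rfl, degCount_eq_sum_hubWeight hℓ e] at h3
  have h3' : (Finset.univ.filter fun j => hubWeight e j = 1).card = 1 := by
    rw [Finset.sum_boole] at h3
    exact_mod_cast h3
  obtain ⟨c, hc⟩ := Finset.card_eq_one.mp h3'
  obtain ⟨φ, hφ⟩ := exists_cycle_shift hℓ z c hz
  have hone : ∀ j, hubWeight (φ.trans e) j = 1 ↔ j = z := by
    intro j
    rw [hubWeight_trans]
    have := Finset.ext_iff.mp hc (φ j)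
    simp only [Finset.mem_filter, Finset.mem_univ, true_and, Finset.mem_singleton] at this
    rw [this, ← hφ, φ.injective.eq_iff]
  refine ⟨φ.trans e, Finset.univ.filter fun j => hubWeight (φ.trans e) j = 2, ?_, ?_, ?_⟩
  · rw [Finset.mem_filter, (hone z).mpr rfl]
    simp
  · rw [show 4 = 2 + 2 from rfl, degCount_eq_sum_hubWeight hℓ (φ.trans e), Finset.sum_boole] at h4
    exact_mod_cast h4
  · ext j
    have h1 := hubWeight_cast hℓ (φ.trans e) j
    have h2 := hdeg ((φ.trans e) j)
    have h3 := hone j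
    rw [hubFun]
    simp only [Finset.mem_filter, Finset.mem_univ, true_and]
    split_ifs with h4 h5
    · exact h3.mpr h4
    · exact h5
    · have : hubWeight (φ.trans e) j ≠ 1 := fun h => h4 (h3.mp h)
      omega

variable {e : SimpleGraph.cycleGraph ℓ ≃g core G} {p : ℕ → ℕ} {k : ℕ}

theorem HubLabel.hubWeight_eq (h : HubLabel G ℓ k e p) {z : Fin ℓ} (hz : (z : ℕ) = 0)
    {T : Finset (Fin ℓ)} (hT : ∀ j : Fin ℓ, j ∈ T ↔ ∃ i, 1 ≤ i ∧ i ≤ k ∧ (j : ℕ) = p i) :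
    hubWeight e = hubFun z T := by
  have h15 := h.fifteen_le
  ext j
  have h1 := hubWeight_cast (by omega) e j
  have h2 := h.degree_le (e j)
  have h3 := h.degree_three j
  have h4 := (h.degree_four j).trans (hT j).symm
  have h5 : j = z ↔ (j : ℕ) = 0 := by rw [Fin.ext_iff, hz]
  rw [hubFun]
  simp only [h5, ← h3, ← h4]
  split_ifs <;> omega

/-- Up to sign the coefficient is nℓ, where n = ℓ + 2k + 1 is odd and ℓ is twice an odd number. -/
theorem HubLabel.not_four_dvd (h : HubLabel G ℓ k e p) (hmod : ℓ ≡ 2 [MOD 4]) :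
    ¬ (4 : ℤ) ∣ (intLaplacian G).charpoly.coeff 1 := by
  have h15 := h.fifteen_le
  have hmod' : ℓ % 4 = 2 := hmod
  have heven : Even ℓ := Nat.even_iff.mpr (by omega)
  obtain ⟨n, hn⟩ := exists_coeff_one_charpoly h.connected (by omega) heven e
  have h1 := h.hasSunProfile.counts.d1
  have h2 : Fintype.card V = ℓ + (2 * k + 1) := by
    rw [card_eq_add_card_leaves e]
    have : degCount G 1 = Fintype.card {v : V // G.degree v = 1} := by
      rw [degCount, Finset.sum_boole, Fintype.card_subtype]
    omega
  have h3 : ((-1 : ℤ) ^ n) * ((-1) ^ n * (Fintype.card V * ℓ)) = Fintype.card V * ℓ := by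
    rw [← mul_assoc, ← mul_pow]; simp
  rw [hn]
  intro hd
  have h4 := hd.mul_left ((-1) ^ n)
  rw [h3, h2] at h4
  have h5 : 4 ∣ (ℓ + (2 * k + 1)) * ℓ := by exact_mod_cast h4
  obtain ⟨q, hq⟩ : ∃ q, ℓ = 4 * q + 2 := ⟨ℓ / 4, by omega⟩
  rw [hq, show (4 * q + 2 + (2 * k + 1)) * (4 * q + 2)
    = 4 * (4 * q * q + 5 * q + 2 * k * q + k + 1) + 2 by ring] at h5
  omega

variable {W : Type*} [Fintype W] [DecidableEq W] {H : SimpleGraph W} [DecidableRel H.Adj]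

/-- A nice graph is isomorphic to every graph with the same signless Laplacian spectrum. -/
theorem HubLabel.nonempty_iso (h : HubLabel G ℓ k e p) (hmod : ℓ ≡ 2 [MOD 4])
    (hs : signlessSpectrum H = signlessSpectrum G) : Nonempty (H ≃g G) := by
  have h15 := h.fifteen_le
  have h3ℓ : 3 ≤ ℓ := by omega
  have hmod' : ℓ % 4 = 2 := hmod
  have heven : Even ℓ := Nat.even_iff.mpr (by omega)
  have hchar := intCharpoly_eq hs
  have hcard := card_eq_of_signlessSpectrum_eq hs
  have hV : 2 ≤ Fintype.card V := by have := card_eq_add_card_leaves e; omega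
  have : Nonempty V := Fintype.card_pos_iff.mp (by omega)
  have : Nonempty W := Fintype.card_pos_iff.mp (by omega)
  have : Nontrivial W := Fintype.one_lt_card_iff_nontrivial.mp (by omega)
  have hH : H.Connected := connected_of_not_four_dvd_coeff_one (by
    rw [hchar]; exact h.not_four_dvd hmod)
  obtain ⟨σ, hσ⟩ := exists_signColoring_of_label h.connected h3ℓ heven e
  have hdetH : (intLaplacian H).det = 0 := by
    have h1 := det_intLaplacian_eq_zero hσ
    rw [det_eq_sign_charpoly_coeff] at h1 ⊢
    rw [hchar, hcard, h1]
  obtain ⟨τ, hτ⟩ := exists_signColoring hH hdetH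
  have hprof := h.hasSunProfile
  -- The common spectrum lies below 6, and d + 1 < 6 gives d ≤ 4.
  have hdegH : ∀ v, 1 ≤ H.degree v ∧ H.degree v ≤ 4 := by
    intro v
    have h1 : 1 ≤ H.degree v := hH.preconnected.degree_pos_of_nontrivial v
    refine ⟨h1, ?_⟩
    have hroots : ∀ r ∈ (signlessLaplacian H).charpoly.roots, r < 6 := by
      change ∀ r ∈ signlessSpectrum H, r < 6
      rw [hs]
      exact hprof.roots_lt
    have h2 := degree_add_one_lt_of_roots_lt hroots h1
    have h3 : H.degree v + 1 < 6 := by exact_mod_cast h2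
    omega
  have htr : ∀ j, ((diagonal (excess H) + H.adjMatrix ℤ) ^ j).trace
      = ((diagonal (excess G) + G.adjMatrix ℤ) ^ j).trace := fun j => by
    rw [← intLaplacian_sub_two, ← intLaplacian_sub_two]
    exact trace_intLaplacian_sub_pow_eq hs 2 j
  have hdeg := degCount_eq_of_trace_eq hσ hτ hprof.degree_mem hdegH hcard htr
  obtain ⟨hcounts, hcodeg⟩ := counts_of_trace_eq hσ hτ hprof hdegH hdeg (htr 4)
  have hleaf := leafCount_eq_of_trace_eq hσ hτ hprof hcounts (hdeg 2 (by decide)) hcodeg (htr 6)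
  have hadj := (edgeCount_eq_zero_iff H 1 1).mp hcounts.e11
  have hcoreG : Fintype.card {v : V | G.degree v ≠ 1} = ℓ := by
    rw [← Fintype.card_congr e.toEquiv, Fintype.card_fin]
  have hcoreH : Fintype.card {v : W | H.degree v ≠ 1} = ℓ := by
    have h1 := card_core (G := G)
    have h2 := card_core (G := H)
    rw [hdeg 1 (by decide), hcard, ← h1, hcoreG] at h2
    exact_mod_cast h2
  have hne : ∃ v, H.degree v ≠ 1 := by
    obtain ⟨v⟩ : Nonempty {v : W | H.degree v ≠ 1} := Fintype.card_pos_iff.mp (by omega)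
    exact ⟨v, v.2⟩
  obtain ⟨e₀⟩ := exists_iso_core hH hne hadj hleaf hcoreH
  let z : Fin ℓ := ⟨0, by omega⟩
  have hz : (z : ℕ) = 0 := rfl
  obtain ⟨e', T', hzT, hT'card, hT'⟩ := exists_label_hubFun h3ℓ e₀ (fun v => (hdegH v).2)
    hcounts.d3 hcounts.d4 z hz
  let T := Finset.univ.filter fun j : Fin ℓ => (j : ℕ) ∈ (Finset.Icc 1 k).image p
  have hTmem : ∀ j : Fin ℓ, j ∈ T ↔ ∃ i, 1 ≤ i ∧ i ≤ k ∧ (j : ℕ) = p i := fun j => by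
    simp only [T, Finset.mem_filter, Finset.mem_univ, true_and, Finset.mem_image, Finset.mem_Icc,
      and_assoc, eq_comm]
  have hT := h.hubWeight_eq hz hTmem
  have hdet := det_hubMatrix_eq h.connected hH h3ℓ e e' hcard hchar
  rw [hT, hT'] at hdet
  rcases mem_iff_of_det_hubMatrix_eq h.one_le_k h.seq h.twelve_mul_le hz hTmem hzT hT'card hdet
    with hmem | hmem
  · refine nonempty_iso_of_hubWeight_eq h.connected hH h3ℓ e e' fun j => ?_
    rw [hT, hT', hubFun, hubFun]
    simp only [hmem]
  -- The hubs of `H` lie at the mirrored positions, and reversing the orientation of its cycle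
  -- restores those of `G`.
  · obtain ⟨φ, hφ⟩ := exists_cycle_reflection h3ℓ
    refine nonempty_iso_of_hubWeight_eq h.connected hH h3ℓ e (φ.trans e') fun j => ?_
    have hφj := hφ j
    have h1 : φ j = z ↔ j = z := by
      rw [Fin.ext_iff, Fin.ext_iff, hz]
      have := j.2
      omega
    have h2 : φ j ∈ T' ↔ j ∈ T := by
      rw [hmem, hTmem]
      refine exists_congr fun i => and_congr_right fun hi => and_congr_right fun hik => ?_
      have h3 := h.seq.bounds hi hik
      have h4 := h.twelve_mul_le
      omega
    rw [hubWeight_trans, hT, hT', hubFun, hubFun]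
    simp only [h1, h2]

end Spectral
end SunGraph

theorem lemma2p4 {V : Type u} [Fintype V] [DecidableEq V] (G : SimpleGraph V)
    [DecidableRel G.Adj] (ℓ k : ℕ) (hG : SunGraph.IsNice G ℓ k) (hℓ : ℓ ≡ 2 [MOD 4]) :
    SunGraph.IsDeterminedBySignlessSpectrum.{u, v} G := by
  obtain ⟨e, p, h⟩ := hG.exists_hubLabel
  intro W _ _ H _ hs
  exact h.nonempty_iso hℓ hs
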